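/- Let $M$ and $N$ be finite-dimensional real-analytic (Hausdorff) manifolds without boundary, endowed with real-analytic connections $\nabla^M$ and $\nabla^N$ on their tangent bundles (torsion is allowed). If $U\subseteq M$ is open, a smooth map $f:U\to N$ is called affine if $$\mathrm d f_x(\nabla^M_vX)=\nabla^N_v(\mathrm d f\circ X)$$ for every $x\in U$, every $v\in T_xM$ and every smooth vector field $X$ on $U$, where $\mathrm d f\circ X$ is regarded as a vector field along $f$ and differentiated with the pull-back connection $f^*\nabla^N$. Assume that $\nabla^N$ is geodesically complete, i.e. for every $y\in N$ the exponential map of $\nabla^N$ at $y$ is defined on all of $T_yN$, and that $M$ is connected and simply connected. Then: (1) For every nonempty connected open subset $U$ of $M$ and every affine map $f:U\to N$ there is an affine map $g:M\to N$ with $g|_U=f$. (2) Let $T$ and $R$ denote torsion and curvature tensors, $T(X,Y)=\nabla_XY-\nabla_YX-[X,Y]$ and $R(X,Y)Z=\nabla_X\nabla_YZ-\nabla_Y\nabla_XZ-\nabla_{[X,Y]}Z$, and let $\nabla^{(r)}$ denote the $r$-th covariant derivative of a tensor field, with $\nabla^{(0)}\tau=\tau$. Let $x_0\in M$, $y_0\in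 N$ and let $\sigma_0:T_{x_0}M\to T_{y_0}N$ be a linear map such that for all $r\ge 0$ and all $w_1,\dots,w_{r+3}\in T_{x_0}M$ $$\sigma_0\big(\nabla^{(r)}T^M_{x_0}(w_1,\dots,w_{r+2})\big)=\nabla^{(r)}T^N_{y_0}(\sigma_0w_1,\dots,\sigma_0w_{r+2}),$$ $$\sigma_0\big(\nabla^{(r)}R^M_{x_0}(w_1,\dots,w_{r+2})\,w_{r+3}\big)=\nabla^{(r)}R^N_{y_0}(\sigma_0w_1,\dots,\sigma_0w_{r+2})\,\sigma_0w_{r+3}.$$ Then there is an affine map $f:M\to N$ with $f(x_0)=y_0$ and $\mathrm d f(x_0)=\sigma_0$. -/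

import Mathlib

open Bundle
open scoped Manifold ContDiff Topology

noncomputable section

namespace AffineGeometry

section Connections

variable {E : Type*} [NormedAddCommGroup E] [NormedSpace ℝ E]
  {M : Type*} [TopologicalSpace M] [ChartedSpace E M] [IsManifold 𝓘(ℝ, E) ω M]

variable (E M) in
/-- A connection on (the tangent bundle of) the manifold `M`: Mathlib's covariant derivatives on
`TM`. For a vector field `X` and `v ∈ T_x M`, `nabla X x v` is `∇_v X`. -/
abbrev Connection : Type _ :=
  CovariantDerivative 𝓘(ℝ, E) E (TangentSpace 𝓘(ℝ, E) : M → Type _)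

/-- The connection is real-analytic: it sends real-analytic vector fields on an open set
to real-analytic sections of `Hom(TM, TM)` over this open set. (All open sets are used, not only
`M` itself, so that real-analytic local frames are available; equivalently, the Christoffel
symbols in real-analytic charts are real-analytic.) -/
def IsAnalyticConnection (nabla : Connection E M) : Prop :=
  ∀ U : Set M, IsOpen U → ContMDiffCovariantDerivativeOn E ω nabla.toFun U

/-- `X` is a smooth (`C^∞`) vector field on the set `U`. -/
def IsSmoothFieldOn (X : Π x : M, TangentSpace 𝓘(ℝ, E) x) (U : Set M) : Prop :=
  ContMDiffOn 𝓘(ℝ, E) 𝓘(ℝ, E).tangent ∞ (fun x ↦ (⟨x, X x⟩ : TangentBundle 𝓘(ℝ, E) M)) U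

end Connections

section Along

variable {F : Type*} [NormedAddCommGroup F] [NormedSpace ℝ F]
  {N : Type*} [TopologicalSpace N] [ChartedSpace F N] [IsManifold 𝓘(ℝ, F) ω N]
  {E : Type*} [NormedAddCommGroup E] [NormedSpace ℝ E]
  {P : Type*} [TopologicalSpace P] [ChartedSpace E P]

/-- The pull-back connection `f^*∇`: the covariant derivative `(f^*∇)_v Y` at `x`, `v ∈ T_x P`, of
a vector field `Y` along a map `f : P → N`. In the local frame `(e_i)` of `TN` around `f x` given by
the preferred chart at `f x` one has `Y = ∑ Y^i (e_i ∘ f)`, and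
`(f^*∇)_v Y = ∑ dY^i(v) e_i (f x) + ∑ Y^i(x) ∇_{df(v)} e_i`.
The field `FiberBundle.extend F (Y x)` is the one with constant components `Y^i(x)` in the frame. -/
def covAlong (nabla : Connection F N) (f : P → N)
    (Y : Π x : P, TangentSpace 𝓘(ℝ, F) (f x)) (x : P) :
    TangentSpace 𝓘(ℝ, E) x →L[ℝ] TangentSpace 𝓘(ℝ, F) (f x) :=
  let t := trivializationAt F (TangentSpace 𝓘(ℝ, F) : N → Type _) (f x)
  (t.symmL ℝ (f x)) ∘L
      (mvfderiv 𝓘(ℝ, E) (fun y : P ↦ (t (⟨f y, Y y⟩ : TangentBundle 𝓘(ℝ, F) N)).2) x)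
    + (nabla (FiberBundle.extend F (x := f x) (Y x)) (f x)) ∘L (mfderiv 𝓘(ℝ, E) 𝓘(ℝ, F) f x)

/-- The velocity `γ'(s)` of a curve `γ` in `N`. -/
def velocity (γ : ℝ → N) (s : ℝ) : TangentSpace 𝓘(ℝ, F) (γ s) :=
  mfderiv 𝓘(ℝ, ℝ) 𝓘(ℝ, F) γ s (1 : ℝ)

/-- `γ` is a geodesic on the open set `J` of parameters: it is smooth there and
`∇_{γ'} γ' = 0`. -/
def IsGeodesicOn (nabla : Connection F N) (γ : ℝ → N) (J : Set ℝ) : Prop :=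
  ContMDiffOn 𝓘(ℝ, ℝ) 𝓘(ℝ, F) ∞ γ J ∧
    ∀ s ∈ J, covAlong (E := ℝ) nabla γ (fun r ↦ velocity (F := F) γ r) s (1 : ℝ) = 0

/-- The domain of the exponential map of `N` at `y`: the vectors `v ∈ T_y N` for which the
geodesic with initial velocity `v` is defined on an open interval containing `0` and `1`. -/
def expDomain (nabla : Connection F N) (y : N) : Set (TangentSpace 𝓘(ℝ, F) y) :=
  {v | ∃ (J : Set ℝ) (γ : ℝ → N), IsOpen J ∧ J.OrdConnected ∧ 0 ∈ J ∧ 1 ∈ J ∧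
    IsGeodesicOn nabla γ J ∧
    (⟨γ 0, velocity (F := F) γ 0⟩ : TangentBundle 𝓘(ℝ, F) N) = ⟨y, v⟩}

/-- Geodesic completeness: every exponential map is defined on the whole tangent space. -/
def IsGeodesicallyComplete (nabla : Connection F N) : Prop :=
  ∀ y : N, expDomain nabla y = Set.univ

/-- The restriction of `f` to the open set `U` is an affine map `U → N`: it is smooth and
`df(∇_v X) = ∇_v (df ∘ X)` for all `x ∈ U`, `v ∈ T_x M` and all smooth vector fields `X` on `U`,
where `df ∘ X` is a vector field along `f`. -/
def IsAffineOn {M : Type*} [TopologicalSpace M] [ChartedSpace E M] [IsManifold 𝓘(ℝ, E) ω M]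
    (nablaM : Connection E M) (nablaN : Connection F N) (f : M → N) (U : Set M) : Prop :=
  ContMDiffOn 𝓘(ℝ, E) 𝓘(ℝ, F) ∞ f U ∧
    ∀ x ∈ U, ∀ v : TangentSpace 𝓘(ℝ, E) x, ∀ X : Π x : M, TangentSpace 𝓘(ℝ, E) x,
      IsSmoothFieldOn X U →
        mfderiv 𝓘(ℝ, E) 𝓘(ℝ, F) f x (nablaM X x v) =
          covAlong nablaN f (fun y ↦ mfderiv 𝓘(ℝ, E) 𝓘(ℝ, F) f y (X y)) x v

end Along

section Tensors

variable {E : Type*} [NormedAddCommGroup E] [NormedSpace ℝ E]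
  {M : Type*} [TopologicalSpace M] [ChartedSpace E M]

variable (E M) in
/-- Fields of `k`-ary operations on the tangent spaces of `M` with values in the tangent spaces;
tensor fields of type `(1, k)` are regarded as such. -/
abbrev OpField (k : ℕ) : Type _ :=
  Π x : M, (Fin k → TangentSpace 𝓘(ℝ, E) x) → TangentSpace 𝓘(ℝ, E) x

variable [IsManifold 𝓘(ℝ, E) ω M]

/-- The curvature `R(X, Y) Z = ∇_X ∇_Y Z - ∇_Y ∇_X Z - ∇_{[X, Y]} Z` on vector fields. -/
def curvature (nabla : Connection E M) (X Y Z : Π x : M, TangentSpace 𝓘(ℝ, E) x) (x : M) :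
    TangentSpace 𝓘(ℝ, E) x :=
  nabla (fun y ↦ nabla Z y (Y y)) x (X x) - nabla (fun y ↦ nabla Z y (X y)) x (Y x)
    - nabla Z x (VectorField.mlieBracket 𝓘(ℝ, E) X Y x)

/-- The curvature tensor `(X, Y, Z) ↦ R(X, Y) Z`, evaluated at tangent vectors at `x` by extending
them to vector fields that are real-analytic around `x`. -/
def curvatureTensor (nabla : Connection E M) : OpField E M 3 := fun x w ↦
  curvature nabla (FiberBundle.extend E (x := x) (w 0)) (FiberBundle.extend E (x := x) (w 1))
    (FiberBundle.extend E (x := x) (w 2)) x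

/-- The torsion tensor `T(X, Y) = ∇_X Y - ∇_Y X - [X, Y]`. -/
def torsionTensor [FiniteDimensional ℝ E] (nabla : Connection E M) : OpField E M 2 := fun x w ↦
  nabla.torsion x (w 0) (w 1)

/-- The covariant derivative of a tensor field,
`(∇τ)(v, W_1, …, W_k) = ∇_v (τ(W_1, …, W_k)) - ∑_i τ(W_1, …, ∇_v W_i, …, W_k)`,
where tangent vectors `W_i` at `x` are extended to vector fields that are real-analytic around
`x`. -/
def covTensor (nabla : Connection E M) {k : ℕ} (τ : OpField E M k) : OpField E M (k + 1) :=
  fun x w ↦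
    let v := w 0
    let W : Fin k → Π y : M, TangentSpace 𝓘(ℝ, E) y := fun i ↦ FiberBundle.extend E (x := x) (w i.succ)
    nabla (fun y ↦ τ y (fun i ↦ W i y)) x v
      - ∑ i, τ x (Function.update (fun j ↦ W j x) i (nabla (W i) x v))

/-- The `r`-th covariant derivative `∇^{(r)} τ`, with `∇^{(0)} τ = τ`. -/
def iterCovTensor (nabla : Connection E M) {k : ℕ} (τ : OpField E M k) :
    (r : ℕ) → OpField E M (k + r)
  | 0 => τ
  | r + 1 => covTensor nabla (iterCovTensor nabla τ r)

/-- The linear map `σ : T_x M → T_y N` relates `τ` at `x` with `τ'` at `y`: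
`σ (τ (w_1, …, w_k)) = τ' (σ w_1, …, σ w_k)`. -/
def Relates {F : Type*} [NormedAddCommGroup F] [NormedSpace ℝ F]
    {N : Type*} [TopologicalSpace N] [ChartedSpace F N] {k : ℕ} {x : M} {y : N}
    (σ : TangentSpace 𝓘(ℝ, E) x →L[ℝ] TangentSpace 𝓘(ℝ, F) y)
    (τ : OpField E M k) (τ' : OpField F N k) : Prop :=
  ∀ w : Fin k → TangentSpace 𝓘(ℝ, E) x, σ (τ x w) = τ' y (fun i ↦ σ (w i))

end Tensors

end AffineGeometry

end

open AffineGeometry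

/-! Local existence. Follow the geodesic `c` from `x₀` with initial velocity `v`, and transport `σ₀`
parallelly to linear maps `S` along the curve `y` with `y' = S c'`; `y` is then the geodesic from
`y₀` with initial velocity `σ₀ v`. In a parallel frame, torsion and curvature are analytic along
`c`, and their Taylor coefficients at time 0 come from the iterated covariant derivatives at `x₀`.
Being related by `σ₀` to all orders, the tensors are therefore related by `S` all along the geodesic
(`tensor_related_along`). Now vary `v`. The defects `dy - S dc` and the covariant derivative of `S`
in the parameter direction solve a homogeneous linear differential equation with zero initial
values, the relations of torsion and curvature having removed the inhomogeneous terms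
(`variation_eq`). So the map sending the end point of `c` to the end point of `y` has differential
`S`, and `S` is parallel in every direction, which is the equation of affine maps
(`exists_chartAffine`, `exists_affine_germ`).

Extension. Affine maps preserve geodesics, so near `x` an affine map `f` equals `exp ∘ df_x ∘
exp_x⁻¹` with `exp` taken at `f x`. Completeness of the target defines this expression wherever
`exp_x⁻¹` is defined, and around every point there is a neighbourhood `W` on which this works for
all `x ∈ W`. The expression is analytic (`exists_analytic_exp`), and affinity is an analytic
equation, so it holds on all of `W` (`exists_nhds_affine_extension`). Hence affine germs extend,
uniquely, to neighbourhoods that do not depend on the germ. The space of affine germs is then a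
covering of `M`, and over a simply connected `M` every germ lies on a global section
(`exists_global_of_unique_extension`).

Analytic dependence of solutions on initial data, used in both halves, comes from the analytic
implicit function theorem in a space of continuous curves (`exists_analytic_flow`). -/

noncomputable section

namespace AffineGeometry

/-! ### Analytic dependence of integral curves on initial conditions. -/

section AnalyticFlow

open Set Metric Filter MeasureTheory intervalIntegral

variable {V W : Type*} [NormedAddCommGroup V] [NormedSpace ℝ V]
  [NormedAddCommGroup W] [NormedSpace ℝ W]

/-- Pointwise application of a continuous multilinear map to continuous functions. -/
def pointwiseMultilinear (K : Type*) [TopologicalSpace K] [CompactSpace K] {n : ℕ}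
    (p : V [×n]→L[ℝ] W) : C(K, V) [×n]→L[ℝ] C(K, W) :=
  MultilinearMap.mkContinuous
    { toFun := fun h ↦ ⟨fun s ↦ p (fun i ↦ h i s), by fun_prop⟩
      map_update_add' := fun h i x y ↦ by
        ext s
        have (z : C(K, V)) : (fun j ↦ (Function.update h i z j) s)
            = Function.update (fun j ↦ h j s) i (z s) := by
          ext j; rcases eq_or_ne j i with rfl | hj <;> simp [*]
        simp [this]
      map_update_smul' := fun h i c x ↦ by
        ext s
        have (z : C(K, V)) : (fun j ↦ (Function.update h i z j) s)
            = Function.update (fun j ↦ h j s) i (z s) := by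
          ext j; rcases eq_or_ne j i with rfl | hj <;> simp [*]
        simp [this] }
    ‖p‖ (fun h ↦ by
      refine (ContinuousMap.norm_le _ (by positivity)).2 fun s ↦ ?_
      refine (p.le_opNorm _).trans ?_
      gcongr with i
      exact (h i).norm_coe_le_norm s)

lemma norm_pointwiseMultilinear_le {K : Type*} [TopologicalSpace K] [CompactSpace K] {n : ℕ}
    (p : V [×n]→L[ℝ] W) : ‖pointwiseMultilinear K p‖ ≤ ‖p‖ :=
  MultilinearMap.mkContinuous_norm_le _ (norm_nonneg _) _

/-- The superposition operator `h ↦ X ∘ (v₀ + h)` is analytic on the space of continuous functions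
if `X` is analytic at `v₀`. -/
lemma exists_analyticAt_superposition [CompleteSpace W] (K : Type*) [TopologicalSpace K]
    [CompactSpace K] {X : V → W} {v₀ : V} (hX : AnalyticAt ℝ X v₀) :
    ∃ S : C(K, V) → C(K, W), AnalyticAt ℝ S 0 ∧
      ∀ᶠ h in 𝓝 (0 : C(K, V)), ∀ s, S h s = X (v₀ + h s) := by
  obtain ⟨p, r, hp⟩ := hX
  let P : FormalMultilinearSeries ℝ C(K, V) C(K, W) := fun n ↦ pointwiseMultilinear K (p n)
  -- Applying a multilinear map pointwise does not increase its norm, so the series of the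
  -- superposition operator converges at least as far as that of `X`.
  have hrad : p.radius ≤ P.radius :=
    FormalMultilinearSeries.radius_le_of_le fun n ↦ norm_pointwiseMultilinear_le (p n)
  have hr : 0 < P.radius := hp.radius_pos.trans_le hrad
  have hP := P.hasFPowerSeriesOnBall hr
  refine ⟨P.sum, ⟨P, _, hP⟩, ?_⟩
  have hrr : 0 < min r P.radius := lt_min hp.r_pos hr
  filter_upwards [Metric.eball_mem_nhds (0 : C(K, V)) hrr] with h hh s
  have h1 : HasSum (fun n ↦ P n fun _ ↦ h) (P.sum h) := by
    have := hP.hasSum (y := h) (Metric.eball_subset_eball (min_le_right _ _) hh)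
    simpa using this
  have h2 : HasSum (fun n ↦ (P n fun _ ↦ h) s) (P.sum h s) :=
    h1.mapL (ContinuousMap.evalCLM ℝ s)
  have h3 : h s ∈ Metric.eball (0 : V) r := by
    have h4 : h ∈ Metric.eball (0 : C(K, V)) r := Metric.eball_subset_eball (min_le_left _ _) hh
    rw [Metric.mem_eball, edist_zero_right] at h4 ⊢
    refine lt_of_le_of_lt ?_ h4
    rw [← ofReal_norm, ← ofReal_norm]
    exact ENNReal.ofReal_le_ofReal (h.norm_coe_le_norm s)
  exact h2.unique (hp.hasSum h3)

/-- Continuous curves parametrized by the unit interval. -/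
abbrev UnitCurves (V : Type*) [NormedAddCommGroup V] : Type _ := C(Icc (0 : ℝ) 1, V)

/-- The primitive `t ↦ ∫₀ᵗ h` of a continuous function on the unit interval. -/
def primitiveCLM (V : Type*) [NormedAddCommGroup V] [NormedSpace ℝ V] :
    C(Icc (0 : ℝ) 1, V) →L[ℝ] C(Icc (0 : ℝ) 1, V) :=
  have hc (h : C(Icc (0 : ℝ) 1, V)) : Continuous fun r : ℝ ↦ h (projIcc 0 1 zero_le_one r) := by
    fun_prop
  LinearMap.mkContinuous
    { toFun := fun h ↦ ⟨fun t ↦ ∫ r in (0 : ℝ)..t, h (projIcc 0 1 zero_le_one r),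
        (continuous_primitive (fun a b ↦ (hc h).intervalIntegrable a b) 0).comp
          continuous_subtype_val⟩
      map_add' := fun h k ↦ by
        ext t
        exact integral_add ((hc h).intervalIntegrable _ _) ((hc k).intervalIntegrable _ _)
      map_smul' := fun c h ↦ by
        ext t
        exact integral_smul c _ }
    1 (fun h ↦ by
      refine (ContinuousMap.norm_le _ (by positivity)).2 fun t ↦ ?_
      have := norm_integral_le_of_norm_le_const (a := (0 : ℝ)) (b := t) (C := ‖h‖)
        (f := fun r ↦ h (projIcc 0 1 zero_le_one r)) (fun r _ ↦ h.norm_coe_le_norm _)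
      refine this.trans ?_
      rw [sub_zero, abs_of_nonneg t.2.1, one_mul]
      exact mul_le_of_le_one_right (norm_nonneg _) t.2.2)

lemma primitiveCLM_apply (h : C(Icc (0 : ℝ) 1, V)) (t : Icc (0 : ℝ) 1) :
    primitiveCLM V h t = ∫ r in (0 : ℝ)..t, h (projIcc 0 1 zero_le_one r) := rfl

/-- **Analytic dependence on initial conditions**: an analytic vector field has an analytic
local flow. -/
theorem exists_analytic_flow [CompleteSpace V] {X : V → V} {v₀ : V} (hX : AnalyticAt ℝ X v₀) :
    ∃ Φ : ℝ × V → V, AnalyticAt ℝ Φ (0, v₀) ∧ (∀ᶠ v in 𝓝 v₀, Φ (0, v) = v) ∧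
      ∀ᶠ q in 𝓝 ((0 : ℝ), v₀), HasDerivAt (fun t ↦ Φ (t, q.2)) (X (Φ q)) q.1 := by
  obtain ⟨S, hS, hSX⟩ := exists_analyticAt_superposition (Icc (0 : ℝ) 1) hX
  let cst : V →L[ℝ] UnitCurves V := ContinuousLinearMap.const ℝ (Icc (0 : ℝ) 1)
  -- Zeros of `G` are the curves `h s = x (t * s) - v₀`, where `x` is the integral curve from `v`.
  -- Rescaling to the unit interval turns the time `t` into a parameter, and at `t = 0` the integral
  -- term disappears, so the partial derivative in `h` is the identity.
  let G : (V × ℝ) × UnitCurves V → UnitCurves V := fun q ↦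
    q.2 - cst (q.1.1 - v₀) - q.1.2 • primitiveCLM V (S q.2)
  have hSc : ContDiffAt ℝ ω S 0 := hS.contDiffAt
  let u₀ : (V × ℝ) × UnitCurves V := ((v₀, 0), 0)
  have hSd : ContDiffAt ℝ ω (fun q : (V × ℝ) × UnitCurves V ↦ S q.2) u₀ :=
    ContDiffAt.comp u₀ (g := S) (f := Prod.snd) hSc contDiffAt_snd
  have hG : ContDiffAt ℝ ω G u₀ := by
    refine (contDiffAt_snd.sub ?_).sub ?_
    · exact cst.contDiff.contDiffAt.comp _ ((contDiffAt_fst.fst).sub contDiffAt_const)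
    · exact (contDiffAt_fst.snd).smul ((primitiveCLM V).contDiff.contDiffAt.comp _ hSd)
  have hG0 : G u₀ = 0 := by simp [G, u₀]
  have hder : fderiv ℝ G u₀ ∘L .inr ℝ (V × ℝ) (UnitCurves V) = ContinuousLinearMap.id ℝ (UnitCurves V) := by
    have h1 : HasFDerivAt (fun h : UnitCurves V ↦ G ((v₀, 0), h))
        (fderiv ℝ G u₀ ∘L .inr ℝ (V × ℝ) (UnitCurves V)) 0 :=
      (hG.differentiableAt (by simp)).hasFDerivAt.comp (0 : UnitCurves V)
        (hasFDerivAt_prodMk_right (v₀, (0 : ℝ)) (0 : UnitCurves V))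
    have h2 : (fun h : UnitCurves V ↦ G ((v₀, 0), h)) = id := by
      ext h; simp [G]
    rw [h2] at h1
    exact h1.unique (hasFDerivAt_id _)
  have hinv : (fderiv ℝ G u₀ ∘L .inr ℝ (V × ℝ) (UnitCurves V)).IsInvertible := by
    rw [hder]; exact ⟨.refl ℝ (UnitCurves V), rfl⟩
  let H : V × ℝ → UnitCurves V := hG.implicitFunction (by simp) hinv
  have hH0 : H (v₀, 0) = 0 := hG.implicitFunction_apply_self (by simp) hinv
  have hHa : ContDiffAt ℝ ω H (v₀, 0) := hG.contDiffAt_implicitFunction (by simp) hinv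
  have hH1 := hG.eventually_apply_implicitFunction (by simp) hinv
  have hH2 := hG.eventually_apply_eq_iff_implicitFunction (by simp) hinv
  rw [hG0] at hH1 hH2
  let Φ : ℝ × V → V := fun q ↦ v₀ + H (q.2, q.1) 1
  have hΦ : AnalyticAt ℝ Φ (0, v₀) := by
    refine ContDiffAt.analyticAt (contDiffAt_const.add ?_)
    have : ContDiffAt ℝ ω (fun q : ℝ × V ↦ H (q.2, q.1)) (0, v₀) :=
      ContDiffAt.comp (0, v₀) (g := H) (f := fun q : ℝ × V ↦ (q.2, q.1)) hHa
        (contDiffAt_snd.prodMk contDiffAt_fst)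
    exact ((ContinuousMap.evalCLM ℝ (1 : Icc (0 : ℝ) 1)).contDiff.contDiffAt).comp _ this
  have hΦ0 : Φ (0, v₀) = v₀ := by simp [Φ, hH0, ContinuousMap.zero_apply]
  have hXΦ : ∀ᶠ q in 𝓝 ((0 : ℝ), v₀), ContinuousAt (fun q ↦ X (Φ q)) q := by
    have : AnalyticAt ℝ (fun q ↦ X (Φ q)) (0, v₀) := by
      refine AnalyticAt.fun_comp (g := X) (f := Φ) ?_ hΦ
      rwa [hΦ0]
    exact this.eventually_analyticAt.mono fun q hq ↦ hq.continuousAt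
  -- The bound `‖h‖ ≤ ‖H (v, t)‖` keeps a competing curve `h` inside the ball where zeros of `G` are
  -- unique and where `S` is composition with `X`.
  have key : ∃ δ > 0, (∀ v ∈ ball v₀ δ, ∀ t ∈ Ioo (-δ) δ, ContinuousAt (fun q ↦ X (Φ q)) (t, v)) ∧
      ∀ v ∈ ball v₀ δ, ∀ t ∈ Ioo (-δ) δ,
        G ((v, t), H (v, t)) = 0 ∧ (∀ s, S (H (v, t)) s = X (v₀ + H (v, t) s)) ∧
        ∀ h : UnitCurves V, ‖h‖ ≤ ‖H (v, t)‖ → (∀ t' ∈ Ioo (-δ) δ, G ((v, t'), h) = 0 →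
          H (v, t') = h) ∧ ∀ s, S h s = X (v₀ + h s) := by
    obtain ⟨ρ, hρ, hρS⟩ := Metric.eventually_nhds_iff_ball.1 hSX
    obtain ⟨ρ₂, hρ₂, hρH⟩ := Metric.eventually_nhds_iff_ball.1 hH2
    have hHn : ∀ᶠ p in 𝓝 (v₀, (0 : ℝ)), ‖H p‖ < min ρ ρ₂ := by
      have : ContinuousAt (fun p ↦ ‖H p‖) (v₀, (0 : ℝ)) := hHa.continuousAt.norm
      refine this.eventually_lt continuousAt_const ?_
      simp [hH0, hρ, hρ₂]
    have hsw : Tendsto (fun p : V × ℝ ↦ (p.2, p.1)) (𝓝 (v₀, (0 : ℝ))) (𝓝 ((0 : ℝ), v₀)) :=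
      (continuous_snd.prodMk continuous_fst).tendsto _
    obtain ⟨δ, hδ, hall⟩ := Metric.eventually_nhds_iff_ball.1
      ((hHn.and hH1).and (hsw.eventually hXΦ))
    have hmem {v : V} {t : ℝ} {d : ℝ} (hv : v ∈ ball v₀ d) (ht : t ∈ Ioo (-d) d) :
        (v, t) ∈ ball (v₀, (0 : ℝ)) d := by
      rw [← ball_prod_same]
      exact ⟨hv, by rw [Real.ball_eq_Ioo]; simpa using ht⟩
    refine ⟨min δ ρ₂, lt_min hδ hρ₂, fun v hv t ht ↦ ?_, fun v hv t ht ↦ ?_⟩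
    · exact (hall _ (ball_subset_ball (min_le_left _ _) (hmem hv ht))).2
    · have hm := hall _ (ball_subset_ball (min_le_left _ _) (hmem hv ht))
      have hball {h : UnitCurves V} {d : ℝ} (hh : ‖h‖ < d) : h ∈ ball (0 : UnitCurves V) d := by simpa using hh
      refine ⟨hm.1.2, hρS _ (hball (hm.1.1.trans_le (min_le_left _ _))), fun h hh ↦ ⟨fun t' ht' h0 ↦ ?_,
        hρS _ (hball ((hh.trans_lt hm.1.1).trans_le (min_le_left _ _)))⟩⟩
      refine (hρH ((v, t'), h) ?_).1 h0
      rw [← ball_prod_same]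
      exact ⟨ball_subset_ball (min_le_right _ _) (hmem hv ht'),
        hball ((hh.trans_lt hm.1.1).trans_le (min_le_right _ _))⟩
  obtain ⟨δ, hδ, hcont, hbox⟩ := key
  have hHeq {v : V} (hv : v ∈ ball v₀ δ) {t : ℝ} (ht : t ∈ Ioo (-δ) δ) (s : Icc (0 : ℝ) 1) :
      H (v, t) s = (v - v₀) + t • ∫ r in (0 : ℝ)..s, X (v₀ + H (v, t) (projIcc 0 1 zero_le_one r)) := by
    obtain ⟨h1, h2, -⟩ := hbox v hv t ht
    have := congrArg (fun h : UnitCurves V ↦ h s) h1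
    simp only [G, ContinuousMap.sub_apply, ContinuousMap.zero_apply, ContinuousMap.smul_apply,
      primitiveCLM_apply, h2] at this
    rw [sub_sub, sub_eq_zero] at this
    exact this
  have hscale {v : V} (hv : v ∈ ball v₀ δ) {t : ℝ} (ht : t ∈ Ioo (-δ) δ) {w : ℝ} (hw : w ∈ Icc (0 : ℝ) 1) :
      Φ (t * w, v) = v₀ + H (v, t) ⟨w, hw⟩ := by
    have hmap : ∀ s : Icc (0 : ℝ) 1, w * s ∈ Icc (0 : ℝ) 1 := fun s ↦
      ⟨mul_nonneg hw.1 s.2.1, mul_le_one₀ hw.2 s.2.1 s.2.2⟩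
    -- An initial piece of the solution for time `t`, rescaled, solves the equation for time `t *
    -- w`; uniqueness identifies it with `H (v, t * w)`. This ties the separate curves `H (v, t)`
    -- together into one integral curve `t ↦ Φ (t, v)`.
    let h : UnitCurves V := ⟨fun s ↦ H (v, t) ⟨w * s, hmap s⟩, by fun_prop⟩
    have htw : t * w ∈ Ioo (-δ) δ := by
      refine abs_lt.1 ?_
      rw [abs_mul, abs_of_nonneg hw.1]
      exact (mul_le_of_le_one_right (abs_nonneg _) hw.2).trans_lt (abs_lt.2 ht)
    have hn : ‖h‖ ≤ ‖H (v, t)‖ :=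
      (ContinuousMap.norm_le _ (norm_nonneg _)).2 fun s ↦ (H (v, t)).norm_coe_le_norm _
    obtain ⟨h1, -, h2⟩ := hbox v hv t ht
    have hSh := (h2 h hn).2
    have h0 : G ((v, t * w), h) = 0 := by
      ext s
      have hs : (h s : V) = (v - v₀) + (t * w) • ∫ r in (0 : ℝ)..s,
          X (v₀ + h (projIcc 0 1 zero_le_one r)) := by
        refine (hHeq hv ht ⟨w * s, hmap s⟩).trans ?_
        congr 1
        have := intervalIntegral.smul_integral_comp_mul_left (a := (0 : ℝ)) (b := s)
          (fun r ↦ X (v₀ + H (v, t) (projIcc 0 1 zero_le_one r))) w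
        rw [mul_zero] at this
        rw [← this, smul_smul]
        congr 1
        refine intervalIntegral.integral_congr fun r hr ↦ ?_
        rw [uIcc_of_le s.2.1] at hr
        have hr1 : r ∈ Icc (0 : ℝ) 1 := ⟨hr.1, hr.2.trans s.2.2⟩
        have hr2 : w * r ∈ Icc (0 : ℝ) 1 := hmap ⟨r, hr1⟩
        simp only [h, ContinuousMap.coe_mk]
        congr 3
        rw [projIcc_of_mem _ hr2]
        ext
        simp [projIcc_of_mem _ hr1]
      simp only [G, ContinuousMap.sub_apply, ContinuousMap.smul_apply, primitiveCLM_apply, hSh,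
        ContinuousMap.zero_apply]
      rw [hs, sub_sub, sub_eq_zero]
      rfl
    have := (h2 h hn).1 _ htw h0
    simp only [Φ, this, h, ContinuousMap.coe_mk, Icc.coe_one, mul_one]
  have hint {v : V} (hv : v ∈ ball v₀ δ) {t : ℝ} (ht : t ∈ Ioo (-δ) δ) :
      Φ (t, v) = v + ∫ r in (0 : ℝ)..t, X (Φ (r, v)) := by
    have h1 : Φ (t, v) = v₀ + H (v, t) 1 := rfl
    rw [h1, hHeq hv ht 1, ← add_assoc, add_sub_cancel]
    congr 1
    have := intervalIntegral.smul_integral_comp_mul_left (a := (0 : ℝ)) (b := 1)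
      (fun r ↦ X (Φ (r, v))) t
    rw [mul_zero, mul_one] at this
    rw [← this]
    congr 1
    refine intervalIntegral.integral_congr fun r hr ↦ ?_
    rw [uIcc_of_le (by simp)] at hr
    have hr1 : r ∈ Icc (0 : ℝ) 1 := ⟨hr.1, by simpa using hr.2⟩
    simp only [hscale hv ht hr1, projIcc_of_mem _ hr1]
  refine ⟨Φ, hΦ, ?_, ?_⟩
  · filter_upwards [ball_mem_nhds v₀ hδ] with v hv
    simpa using hint hv (t := 0) (by simpa using hδ)
  · have hnb : Ioo (-δ) δ ×ˢ ball v₀ δ ∈ 𝓝 ((0 : ℝ), v₀) :=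
      prod_mem_nhds (Ioo_mem_nhds (by linarith) hδ) (ball_mem_nhds v₀ hδ)
    filter_upwards [hnb] with q hq
    obtain ⟨t, v⟩ := q
    have hc : ContinuousOn (fun r ↦ X (Φ (r, v))) (Ioo (-δ) δ) := fun r hr ↦
      ((hcont v hq.2 r hr).comp (f := fun r : ℝ ↦ (r, v))
        (by fun_prop)).continuousWithinAt
    have hsub : uIcc 0 t ⊆ Ioo (-δ) δ :=
      ordConnected_Ioo.uIcc_subset (by simpa using hδ) hq.1
    have hd : HasDerivAt (fun u ↦ v + ∫ r in (0 : ℝ)..u, X (Φ (r, v))) (X (Φ (t, v))) t :=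
      (integral_hasDerivAt_right (hc.mono hsub).intervalIntegrable
        (hc.stronglyMeasurableAtFilter isOpen_Ioo t hq.1)
        (hc.continuousAt (Ioo_mem_nhds hq.1.1 hq.1.2))).const_add v
    refine hd.congr_of_eventuallyEq ?_
    filter_upwards [Ioo_mem_nhds hq.1.1 hq.1.2] with u hu
    exact hint hq.2 hu
end AnalyticFlow

/-! ### Uniqueness for differential equations and vanishing to infinite order. -/

section Uniqueness
open Set Metric Filter Asymptotics

lemma eq_of_mem_closure_setOf_eq {α β : Type*} [TopologicalSpace α] [TopologicalSpace β]
    [T2Space β] {f g : α → β} {s : α} (hf : ContinuousAt f s) (hg : ContinuousAt g s)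
    (hs : s ∈ closure {t | f t = g t}) : f s = g s := by
  by_contra hne
  obtain ⟨t, h1, h2⟩ := mem_closure_iff_nhds.1 hs _ ((hf.ne_iff_eventually_ne hg).1 hne)
  exact h1 h2

/-- Two continuous maps on a preconnected open set agree if they agree at one point and agreement at
a point implies agreement near this point. -/
lemma eqOn_of_isPreconnected {α β : Type*} [TopologicalSpace α] [TopologicalSpace β] [T2Space β]
    {J : Set α} (hJ : IsPreconnected J) {f g : α → β}
    (hf : ∀ t ∈ J, ContinuousAt f t) (hg : ∀ t ∈ J, ContinuousAt g t)
    (hloc : ∀ t ∈ J, f t = g t → f =ᶠ[𝓝 t] g) {t₀ : α} (ht₀ : t₀ ∈ J) (h₀ : f t₀ = g t₀) :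
    EqOn f g J := by
  have hu : IsOpen {t | f =ᶠ[𝓝 t] g} := isOpen_setOfPred_eventually_nhds
  have hsub := hJ.subset_of_closure_inter_subset hu ⟨t₀, ht₀, hloc t₀ ht₀ h₀⟩
  refine fun t ht ↦ (hsub ?_ ht).eq_of_nhds
  rintro s ⟨hs, hsJ⟩
  refine hloc s hsJ ?_
  exact eq_of_mem_closure_setOf_eq (hf s hsJ) (hg s hsJ)
    (closure_mono (fun _ h ↦ h.eq_of_nhds) hs)

variable {V W : Type*} [NormedAddCommGroup V] [NormedSpace ℝ V]
  [NormedAddCommGroup W] [NormedSpace ℝ W]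

lemma eventuallyEq_of_hasDerivAt {X : V → V} {f g : ℝ → V} {t₀ : ℝ} (hX : ContDiffAt ℝ 1 X (f t₀))
    (hf : ∀ᶠ t in 𝓝 t₀, HasDerivAt f (X (f t)) t) (hg : ∀ᶠ t in 𝓝 t₀, HasDerivAt g (X (g t)) t)
    (h : f t₀ = g t₀) : f =ᶠ[𝓝 t₀] g := by
  obtain ⟨K, s, hs, hK⟩ := hX.exists_lipschitzOnWith
  have hfs := hf.self_of_nhds.continuousAt.eventually_mem hs
  have hgs := hg.self_of_nhds.continuousAt.eventually_mem (h ▸ hs)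
  exact ODE_solution_unique_of_eventually (v := fun _ ↦ X) (s := fun _ ↦ s)
    (Eventually.of_forall fun _ ↦ hK) (hf.and hfs) (hg.and hgs) h

/-- Uniqueness of integral curves of a `C¹` vector field. -/
lemma eqOn_of_hasDerivAt {X : V → V} {f g : ℝ → V} {J : Set ℝ} (hJo : IsOpen J)
    (hJ : IsPreconnected J) (hX : ∀ t ∈ J, ContDiffAt ℝ 1 X (f t))
    (hf : ∀ t ∈ J, HasDerivAt f (X (f t)) t) (hg : ∀ t ∈ J, HasDerivAt g (X (g t)) t)
    {t₀ : ℝ} (ht₀ : t₀ ∈ J) (h : f t₀ = g t₀) : EqOn f g J :=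
  eqOn_of_isPreconnected hJ (fun t ht ↦ (hf t ht).continuousAt)
    (fun t ht ↦ (hg t ht).continuousAt)
    (fun t ht h ↦ eventuallyEq_of_hasDerivAt (hX t ht)
      ((hJo.eventually_mem ht).mono hf) ((hJo.eventually_mem ht).mono hg) h) ht₀ h

/-- A solution of a homogeneous linear differential equation that vanishes at one point vanishes. -/
lemma eqOn_zero_of_hasDerivAt_linear {A : ℝ → V →L[ℝ] V} {f : ℝ → V} {J : Set ℝ}
    (hJo : IsOpen J) (hJ : IsPreconnected J) (hA : ∀ t ∈ J, ContinuousAt A t)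
    (hf : ∀ t ∈ J, HasDerivAt f (A t (f t)) t) {t₀ : ℝ} (ht₀ : t₀ ∈ J) (h : f t₀ = 0) :
    ∀ t ∈ J, f t = 0 := by
  refine eqOn_of_isPreconnected (g := fun _ ↦ 0) hJ (fun t ht ↦ (hf t ht).continuousAt)
    (fun t _ ↦ continuousAt_const) (fun t ht h ↦ ?_) ht₀ h
  have hb : ∀ᶠ s in 𝓝 t, ‖A s‖₊ < ‖A t‖₊ + 1 :=
    (hA t ht).nnnorm.eventually_lt continuousAt_const (by simp)
  refine ODE_solution_unique_of_eventually (v := fun s ↦ A s) (s := fun _ ↦ univ)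
    (K := ‖A t‖₊ + 1) (hb.mono fun s hs ↦ ?_)
    (((hJo.eventually_mem ht).mono hf).mono fun s hs ↦ ⟨hs, mem_univ _⟩)
    (Eventually.of_forall fun s ↦ ⟨by simpa using hasDerivAt_const s (0 : V), mem_univ _⟩) h
  exact ((A s).lipschitz.weaken hs.le).lipschitzOnWith

/-- The mean value inequality on `[-|t|, |t|]` gains one power of `t`. This is the inductive step in
proving vanishing to infinite order. -/
lemma isBigO_pow_succ_of_hasDerivAt {f f' : ℝ → W} {n : ℕ}
    (hf : ∀ᶠ t in 𝓝 (0 : ℝ), HasDerivAt f (f' t) t) (h0 : f 0 = 0)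
    (h : f' =O[𝓝 0] fun t : ℝ ↦ t ^ n) : f =O[𝓝 0] fun t : ℝ ↦ t ^ (n + 1) := by
  obtain ⟨C, hC0, hC⟩ := h.exists_nonneg
  obtain ⟨δ, hδ, hall⟩ := Metric.eventually_nhds_iff_ball.1 (hf.and hC.bound)
  refine IsBigO.of_bound C ?_
  filter_upwards [ball_mem_nhds (0 : ℝ) hδ] with t ht
  have hsub : Icc (-|t|) |t| ⊆ ball 0 δ := fun s hs ↦ by
    rw [mem_ball_zero_iff, Real.norm_eq_abs] at ht ⊢
    exact (abs_le.2 hs).trans_lt ht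
  have h1 := (convex_Icc (-|t|) |t|).norm_image_sub_le_of_norm_hasDerivWithin_le (f := f)
    (f' := f') (C := C * |t| ^ n) (x := 0) (y := t)
    (fun s hs ↦ ((hall s (hsub hs)).1).hasDerivWithinAt)
    (fun s hs ↦ ?_) (by simp) ⟨neg_abs_le t, le_abs_self t⟩
  · simpa [h0, pow_succ, mul_assoc] using h1
  · have h2 := (hall s (hsub hs)).2
    refine h2.trans ?_
    rw [norm_pow, Real.norm_eq_abs]
    exact mul_le_mul_of_nonneg_left (pow_le_pow_left₀ (abs_nonneg _) (abs_le.2 hs) n) hC0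

/-- A sequence of functions with `θ_r' = A θ_r + θ_{r+1}` and `θ_r(0) = 0` vanishes near `0` if it
is analytic. -/
lemma eventually_eq_zero_of_hasDerivAt_tower {A : ℝ → W →L[ℝ] W} {θ : ℕ → ℝ → W}
    (hA : ContinuousAt A 0) (h0 : ∀ r, θ r 0 = 0)
    (hd : ∀ r, ∀ᶠ t in 𝓝 (0 : ℝ), HasDerivAt (θ r) (A t (θ r t) + θ (r + 1) t) t)
    (ha : AnalyticAt ℝ (θ 0) 0) : ∀ᶠ t in 𝓝 (0 : ℝ), θ 0 t = 0 := by
  -- The induction on `n` must treat all `r` at once, because the bound for `θ r` uses the previous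
  -- bound for `θ (r + 1)`.
  have hO : ∀ n r, θ r =O[𝓝 0] fun t : ℝ ↦ t ^ n := by
    intro n
    induction n with
    | zero => 
      intro r
      simpa using ((hd r).self_of_nhds.continuousAt.isBigO_one ℝ)
    | succ n ih =>
      intro r
      refine isBigO_pow_succ_of_hasDerivAt (hd r) (h0 r) (IsBigO.add ?_ (ih (r + 1)))
      refine IsBigO.trans ?_ (ih r)
      have hb : ∀ᶠ s in 𝓝 (0 : ℝ), ‖A s‖ < ‖A 0‖ + 1 :=
        hA.norm.eventually_lt continuousAt_const (by simp)
      refine IsBigO.of_bound (‖A 0‖ + 1) (hb.mono fun s hs ↦ ?_)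
      exact (A s).le_of_opNorm_le hs.le _
  by_contra hne
  -- A nonzero analytic germ has a finite order `n`, which contradicts the bound by `t ^ (n + 1)`.
  obtain ⟨n, g, hg, hg0, hfg⟩ := ha.exists_eventuallyEq_pow_smul_nonzero_iff.2 hne
  have h1 : (fun t : ℝ ↦ t ^ n • g t) =O[𝓝[≠] 0] fun t : ℝ ↦ t ^ n * t := by
    have := (hO (n + 1) 0).congr' (hfg.mono fun t ht ↦ by simpa using ht)
      (Eventually.of_forall fun t ↦ pow_succ t n)
    exact this.mono nhdsWithin_le_nhds
  have h2 : g =O[𝓝[≠] 0] fun t : ℝ ↦ t := by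
    obtain ⟨C, hC⟩ := h1.bound
    refine IsBigO.of_bound C ?_
    filter_upwards [hC, self_mem_nhdsWithin] with t ht ht0
    rw [norm_smul, norm_mul, mul_left_comm] at ht
    exact le_of_mul_le_mul_left ht (norm_pos_iff.2 (pow_ne_zero _ ht0))
  have h3 : Tendsto g (𝓝[≠] 0) (𝓝 0) := h2.trans_tendsto (tendsto_id.mono_left nhdsWithin_le_nhds)
  exact hg0 (tendsto_nhds_unique (hg.continuousAt.tendsto.mono_left nhdsWithin_le_nhds) h3)

end Uniqueness

/-! ### Tensor fields in coordinates and their propagation along geodesics. -/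

section ChartTensors

set_option maxSynthPendingDepth 3
set_option linter.unusedSectionVars false

variable {E : Type*} [NormedAddCommGroup E] [NormedSpace ℝ E]
  {F : Type*} [NormedAddCommGroup F] [NormedSpace ℝ F]

/-- Applying an endomorphism in one slot of a multilinear map, summed over all slots. -/
def sumSlots (E : Type*) [NormedAddCommGroup E] [NormedSpace ℝ E] (k : ℕ) :
    (E →L[ℝ] E) →L[ℝ] (E [×k]→L[ℝ] E) →L[ℝ] (E [×k]→L[ℝ] E) :=
  ∑ i : Fin k, (ContinuousMultilinearMap.compContinuousLinearMapContinuousMultilinear ℝ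
    (fun _ : Fin k ↦ E) (fun _ : Fin k ↦ E) E).toContinuousLinearMap
      (fun _ ↦ ContinuousLinearMap.id ℝ E) i

lemma sumSlots_apply {k : ℕ} (A : E →L[ℝ] E) (T : E [×k]→L[ℝ] E) (w : Fin k → E) :
    sumSlots E k A T w = ∑ i, T (Function.update w i (A (w i))) := by
  simp only [sumSlots, sum_apply]
  refine Finset.sum_congr rfl fun i _ ↦ ?_
  simp only [ContinuousMultilinearMap.toContinuousLinearMap_apply,
    ContinuousMultilinearMap.compContinuousLinearMapContinuousMultilinear_apply_apply,
    ContinuousMultilinearMap.compContinuousLinearMap_apply]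
  congr 1
  ext j
  rcases eq_or_ne j i with rfl | hj <;> simp [*]

/-- The covariant derivative of a tensor field in a chart with Christoffel symbols `Γ`. -/
def chartCov (Γ : E → E →L[ℝ] E →L[ℝ] E) {k : ℕ} (T : E → E [×k]→L[ℝ] E) (z : E) :
    E [×(k + 1)]→L[ℝ] E :=
  ContinuousLinearMap.uncurryLeft (Ei := fun _ : Fin (k + 1) ↦ E)
    (fderiv ℝ T z
      + ((ContinuousLinearMap.compContinuousMultilinearMapL ℝ (fun _ : Fin k ↦ E) E E).flip (T z))
          ∘L Γ z
      - ((sumSlots E k).flip (T z)) ∘L Γ z)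

lemma chartCov_apply (Γ : E → E →L[ℝ] E →L[ℝ] E) {k : ℕ} (T : E → E [×k]→L[ℝ] E) (z : E)
    (w : Fin (k + 1) → E) :
    chartCov Γ T z w = fderiv ℝ T z (w 0) (Fin.tail w) + Γ z (w 0) (T z (Fin.tail w))
      - ∑ i, T z (Function.update (Fin.tail w) i (Γ z (w 0) (w i.succ))) := by
  simp only [chartCov, ContinuousLinearMap.uncurryLeft_apply]
  simp [sumSlots_apply, Fin.tail]

lemma contDiffAt_chartCov {Γ : E → E →L[ℝ] E →L[ℝ] E} {k : ℕ} {T : E → E [×k]→L[ℝ] E} {z : E}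
    (hΓ : ContDiffAt ℝ ω Γ z) (hT : ContDiffAt ℝ ω T z) :
    ContDiffAt ℝ ω (chartCov Γ T) z := by
  have h1 : ContDiffAt ℝ ω (fderiv ℝ T) z := hT.fderiv_right le_rfl
  have h2 := ((continuousMultilinearCurryLeftEquiv ℝ (fun _ : Fin (k + 1) ↦ E)
    E).symm.contDiff (n := ω)).contDiffAt.comp z
    ((h1.add (((ContinuousLinearMap.compContinuousMultilinearMapL ℝ (fun _ : Fin k ↦ E)
      E E).flip.contDiff.contDiffAt.comp z hT).clm_comp hΓ)).sub
      (((sumSlots E k).flip.contDiff.contDiffAt.comp z hT).clm_comp hΓ))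
  exact h2

/-- Iterated covariant derivatives of a tensor field in a chart. -/
def chartIterCov (Γ : E → E →L[ℝ] E →L[ℝ] E) {k : ℕ} (T : E → E [×k]→L[ℝ] E) :
    (r : ℕ) → E → E [×(k + r)]→L[ℝ] E
  | 0 => T
  | r + 1 => chartCov Γ (chartIterCov Γ T r)

lemma contDiffAt_chartIterCov {Γ : E → E →L[ℝ] E →L[ℝ] E} {k : ℕ} {T : E → E [×k]→L[ℝ] E} {z : E}
    (hΓ : ContDiffAt ℝ ω Γ z) (hT : ContDiffAt ℝ ω T z) (r : ℕ) :
    ContDiffAt ℝ ω (chartIterCov Γ T r) z := by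
  induction r with
  | zero => exact hT
  | succ r ih => exact contDiffAt_chartCov hΓ ih

/-- The vector `(u, …, u, w₁, …, w_k)` with `r` entries `u`. -/
def consIter {k : ℕ} (u : E) (w : Fin k → E) : (r : ℕ) → Fin (k + r) → E
  | 0 => w
  | r + 1 => Fin.cons u (consIter u w r)

lemma apply_consIter {k : ℕ} (σ : E → F) (u : E) (w : Fin k → E) (r : ℕ) (i : Fin (k + r)) :
    σ (consIter u w r i) = consIter (σ u) (fun j ↦ σ (w j)) r i := by
  induction r with
  | zero => rfl
  | succ r ih => 
    refine Fin.cases ?_ (fun j ↦ ?_) i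
    · rfl
    · exact ih j

/-- The velocity of a geodesic is parallel, so filling the derivative slots with it keeps all
arguments parallel. -/
lemma hasDerivAt_consIter {k : ℕ} {Γ : E →L[ℝ] E} {u : ℝ → E} {w : Fin k → ℝ → E} {t : ℝ}
    (hu : HasDerivAt u (-Γ (u t)) t) (hw : ∀ i, HasDerivAt (w i) (-Γ (w i t)) t) (r : ℕ)
    (i : Fin (k + r)) :
    HasDerivAt (fun s ↦ consIter (u s) (fun j ↦ w j s) r i)
      (-Γ (consIter (u t) (fun j ↦ w j t) r i)) t := by
  induction r with
  | zero => exact hw i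
  | succ r ih => 
    refine Fin.cases ?_ (fun j ↦ ?_) i
    · exact hu
    · exact ih j

/-- For parallel arguments the product rule yields exactly the slot terms of the covariant
derivative; only the connection term of the output is left over. -/
lemma hasDerivAt_tensor_apply {k : ℕ} {Γ : E → E →L[ℝ] E →L[ℝ] E} {T : E → E [×k]→L[ℝ] E}
    {c : ℝ → E} {u : E} {a : Fin k → ℝ → E} {t : ℝ} (hT : DifferentiableAt ℝ T (c t))
    (hc : HasDerivAt c u t) (ha : ∀ i, HasDerivAt (a i) (-Γ (c t) u (a i t)) t) :
    HasDerivAt (fun s ↦ T (c s) (fun i ↦ a i s))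
      (chartCov Γ T (c t) (Fin.cons u (fun i ↦ a i t)) - Γ (c t) u (T (c t) (fun i ↦ a i t))) t := by
  have h := (hT.hasFDerivAt.comp t hc.hasFDerivAt).continuousMultilinearMap_apply
    (fun i ↦ (ha i).hasFDerivAt)
  have h' := h.hasDerivAt
  refine h'.congr_deriv ?_
  rw [chartCov_apply]
  simp only [add_apply, ContinuousLinearMap.comp_apply,
    sum_apply, ContinuousMultilinearMap.apply_apply,
    ContinuousMultilinearMap.toContinuousLinearMap_apply, Function.comp, Fin.cons_zero,
    Fin.cons_succ, Fin.tail_cons]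
  have hneg (i : Fin k) (x : E) : T (c t) (Function.update (fun j ↦ a j t) i (-x))
      = -T (c t) (Function.update (fun j ↦ a j t) i x) :=
    (T (c t)).toMultilinearMap.map_update_neg _ _ _
  simp [hneg]
  abel

lemma analyticAt_tensor_apply {G : Type*} [NormedAddCommGroup G] [NormedSpace ℝ G] {k : ℕ}
    {T : G → E [×k]→L[ℝ] E} {a : Fin k → G → E} {x : G} (hT : AnalyticAt ℝ T x)
    (ha : ∀ i, AnalyticAt ℝ (a i) x) : AnalyticAt ℝ (fun y ↦ T y (fun i ↦ a i y)) x :=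
  ((ContinuousLinearMap.id ℝ (E [×k]→L[ℝ] E)).analyticAt_uncurry_of_multilinear
    (x := (T x, fun i ↦ a i x))).comp_of_eq (hT.prod (AnalyticAt.pi ha)) rfl

variable [CompleteSpace E] [CompleteSpace F]

/-- Tensor fields that are related to all orders at one point by a linear map `S` are related along
geodesics if `S` is extended by parallel transport. -/
lemma tensor_related_along {k : ℕ} {ΓM : E → E →L[ℝ] E →L[ℝ] E} {ΓN : F → F →L[ℝ] F →L[ℝ] F}
    {TM : E → E [×k]→L[ℝ] E} {TN : F → F [×k]→L[ℝ] F}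
    {c u : ℝ → E} {y : ℝ → F} {S : ℝ → E →L[ℝ] F} {P : ℝ → E →L[ℝ] E} {J : Set ℝ}
    (hJo : IsOpen J) (hJ : IsPreconnected J) (h0J : (0 : ℝ) ∈ J)
    (hΓM : ∀ t ∈ J, ContDiffAt ℝ ω ΓM (c t)) (hΓN : ∀ t ∈ J, ContDiffAt ℝ ω ΓN (y t))
    (hTM : ∀ t ∈ J, ContDiffAt ℝ ω TM (c t)) (hTN : ∀ t ∈ J, ContDiffAt ℝ ω TN (y t))
    (hc : ∀ t ∈ J, HasDerivAt c (u t) t)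
    (hu : ∀ t ∈ J, HasDerivAt u (-ΓM (c t) (u t) (u t)) t)
    (hy : ∀ t ∈ J, HasDerivAt y (S t (u t)) t)
    (hS : ∀ t ∈ J, HasDerivAt S (S t ∘L ΓM (c t) (u t) - ΓN (y t) (S t (u t)) ∘L S t) t)
    (hP : ∀ t ∈ J, HasDerivAt P (-(ΓM (c t) (u t) ∘L P t)) t)
    (hca : ∀ t ∈ J, AnalyticAt ℝ c t) (hya : ∀ t ∈ J, AnalyticAt ℝ y t)
    (hSa : ∀ t ∈ J, AnalyticAt ℝ S t) (hPa : ∀ t ∈ J, AnalyticAt ℝ P t)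
    (hP0 : P 0 = .id ℝ E)
    (hrel : ∀ r (w : Fin (k + r) → E), S 0 (chartIterCov ΓM TM r (c 0) w)
      = chartIterCov ΓN TN r (y 0) (fun i ↦ S 0 (w i))) :
    ∀ t ∈ J, ∀ w : Fin k → E,
      S t (TM (c t) (fun i ↦ P t (w i))) = TN (y t) (fun i ↦ S t (P t (w i))) := by
  intro t ht w
  -- The failure of the relation for the `r`-th covariant derivatives, with the velocity in all
  -- derivative slots. All arguments are parallel, so differentiating `θ r` gives `θ (r + 1)` and a
  -- connection term linear in `θ r`.
  let θ : ℕ → ℝ → F := fun r s ↦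
    S s (chartIterCov ΓM TM r (c s) (consIter (u s) (fun i ↦ P s (w i)) r))
      - chartIterCov ΓN TN r (y s) (consIter (S s (u s)) (fun i ↦ S s (P s (w i))) r)
  have hPw (s) (hs : s ∈ J) (i) : HasDerivAt (fun s ↦ P s (w i))
      (-ΓM (c s) (u s) (P s (w i))) s := by
    simpa using (hP s hs).clm_apply (hasDerivAt_const s (w i))
  have hSv (s) (hs : s ∈ J) {v : ℝ → E} (hv : HasDerivAt v (-ΓM (c s) (u s) (v s)) s) :
      HasDerivAt (fun s ↦ S s (v s)) (-ΓN (y s) (S s (u s)) (S s (v s))) s := by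
    refine ((hS s hs).clm_apply hv).congr_deriv ?_
    simp
    abel
  have hθ (r s) (hs : s ∈ J) : HasDerivAt (θ r) ((-ΓN (y s) (S s (u s))) (θ r s) + θ (r + 1) s) s := by
    have h1 := hasDerivAt_tensor_apply (Γ := ΓM)
      ((contDiffAt_chartIterCov (hΓM s hs) (hTM s hs) r).differentiableAt (by simp)) (hc s hs)
      (fun i ↦ hasDerivAt_consIter (hu s hs) (fun j ↦ hPw s hs j) r i)
    have h2 := hasDerivAt_tensor_apply (Γ := ΓN)
      ((contDiffAt_chartIterCov (hΓN s hs) (hTN s hs) r).differentiableAt (by simp)) (hy s hs)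
      (fun i ↦ hasDerivAt_consIter (hSv s hs (hu s hs)) (fun j ↦ hSv s hs (hPw s hs j)) r i)
    refine (((hS s hs).clm_apply h1).sub h2).congr_deriv ?_
    simp only [θ, chartIterCov, consIter]
    simp
    abel
  have hua (s) (hs : s ∈ J) : AnalyticAt ℝ u s :=
    (hca s hs).deriv.congr ((hJo.eventually_mem hs).mono fun s hs ↦ (hc s hs).deriv)
  have hθa (s) (hs : s ∈ J) : AnalyticAt ℝ (θ 0) s := by
    have hPi (i) : AnalyticAt ℝ (fun s ↦ P s (w i)) s :=
      (ContinuousLinearMap.apply ℝ E (w i)).analyticAt _ |>.comp (hPa s hs)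
    have hSPi (i) : AnalyticAt ℝ (fun s ↦ S s (P s (w i))) s :=
      (((hSa s hs).contDiffAt (n := ω)).clm_apply (hPi i).contDiffAt).analyticAt
    have h1 := analyticAt_tensor_apply ((hTM s hs).analyticAt.comp (hca s hs)) hPi
    have h2 := analyticAt_tensor_apply ((hTN s hs).analyticAt.comp (hya s hs)) hSPi
    exact (((hSa s hs).contDiffAt (n := ω)).clm_apply h1.contDiffAt).analyticAt.sub h2
  have hA (s) (hs : s ∈ J) : ContinuousAt (fun s ↦ -ΓN (y s) (S s (u s))) s := by
    have h1 : ContinuousAt (fun s ↦ ΓN (y s)) s :=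
      ContinuousAt.comp (f := y) (g := ΓN) (hΓN s hs).continuousAt (hy s hs).continuousAt
    exact (h1.clm_apply ((hS s hs).continuousAt.clm_apply (hu s hs).continuousAt)).neg
  have hz := eventually_eq_zero_of_hasDerivAt_tower (hA 0 h0J) (θ := θ)
    (fun r ↦ by
      simp only [θ, hrel, hP0, sub_eq_zero]
      congr 1
      ext i
      exact apply_consIter (S 0) _ _ r i)
    (fun r ↦ (hJo.eventually_mem h0J).mono fun s hs ↦ hθ r s hs) (hθa 0 h0J)
  -- Infinite-order vanishing only settles a neighbourhood of time 0; the identity theorem reaches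
  -- the rest of `J`.
  have := AnalyticOnNhd.eqOn_zero_of_preconnected_of_eventuallyEq_zero (f := θ 0) hθa hJ h0J hz ht
  exact sub_eq_zero.1 this

end ChartTensors
-- Torsion, curvature and the variational equation in coordinates.
section ChartCurvature



set_option maxSynthPendingDepth 3
set_option linter.unusedSectionVars false

variable {E : Type*} [NormedAddCommGroup E] [NormedSpace ℝ E]
  {F : Type*} [NormedAddCommGroup F] [NormedSpace ℝ F]

/-- The curvature `R(a, b) = DΓ(a)(b) - DΓ(b)(a) + Γ(a) Γ(b) - Γ(b) Γ(a)` in a chart. -/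
def chartCurvature (Γ : E → E →L[ℝ] E →L[ℝ] E) (z : E) : E →L[ℝ] E →L[ℝ] E →L[ℝ] E :=
  let Q : E →L[ℝ] E →L[ℝ] E →L[ℝ] E :=
    ((ContinuousLinearMap.compL ℝ E (E →L[ℝ] E) (E →L[ℝ] E)).flip (Γ z))
      ∘L ((ContinuousLinearMap.compL ℝ E E E) ∘L Γ z)
  fderiv ℝ Γ z - (fderiv ℝ Γ z).flip + (Q - Q.flip)

lemma chartCurvature_apply (Γ : E → E →L[ℝ] E →L[ℝ] E) (z a b e : E) :
    chartCurvature Γ z a b e = fderiv ℝ Γ z a b e - fderiv ℝ Γ z b a e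
      + (Γ z a (Γ z b e) - Γ z b (Γ z a e)) := by
  simp [chartCurvature]

lemma contDiffAt_chartCurvature {Γ : E → E →L[ℝ] E →L[ℝ] E} {z : E} (hΓ : ContDiffAt ℝ ω Γ z) :
    ContDiffAt ℝ ω (chartCurvature Γ) z := by
  have hD : ContDiffAt ℝ ω (fderiv ℝ Γ) z := hΓ.fderiv_right le_rfl
  have hQ : ContDiffAt ℝ ω (fun z ↦
    ((ContinuousLinearMap.compL ℝ E (E →L[ℝ] E) (E →L[ℝ] E)).flip (Γ z))
      ∘L ((ContinuousLinearMap.compL ℝ E E E) ∘L Γ z)) z :=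
    ((ContinuousLinearMap.compL ℝ E (E →L[ℝ] E) (E →L[ℝ] E)).flip.contDiff.contDiffAt.comp z
      hΓ).clm_comp (contDiffAt_const.clm_comp hΓ)
  have hfl {f : E → E →L[ℝ] E →L[ℝ] E →L[ℝ] E} (hf : ContDiffAt ℝ ω f z) :
      ContDiffAt ℝ ω (fun z ↦ (f z).flip) z :=
    (ContinuousLinearMap.flipₗᵢ ℝ E E (E →L[ℝ] E)).contDiff.contDiffAt.comp z hf
  exact (hD.sub (hfl hD)).add (hQ.sub (hfl hQ))

/-- Uncurrying of bilinear maps. -/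
def uncurry₂ (E : Type*) [NormedAddCommGroup E] [NormedSpace ℝ E] :
    (E →L[ℝ] E →L[ℝ] E) →L[ℝ] E [×2]→L[ℝ] E :=
  ((continuousMultilinearCurryLeftEquiv ℝ (fun _ : Fin 2 ↦ E) E).symm.toContinuousLinearEquiv :
    _ →L[ℝ] _) ∘L ContinuousLinearMap.compL ℝ E (E →L[ℝ] E) (E [×1]→L[ℝ] E)
      ((continuousMultilinearCurryFin1 ℝ E E).symm.toContinuousLinearEquiv : _ →L[ℝ] _)

lemma uncurry₂_apply (B : E →L[ℝ] E →L[ℝ] E) (w : Fin 2 → E) : uncurry₂ E B w = B (w 0) (w 1) := by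
  simp [uncurry₂, Fin.tail]

/-- Uncurrying of trilinear maps. -/
def uncurry₃ (E : Type*) [NormedAddCommGroup E] [NormedSpace ℝ E] :
    (E →L[ℝ] E →L[ℝ] E →L[ℝ] E) →L[ℝ] E [×3]→L[ℝ] E :=
  ((continuousMultilinearCurryLeftEquiv ℝ (fun _ : Fin 3 ↦ E) E).symm.toContinuousLinearEquiv :
    _ →L[ℝ] _) ∘L ContinuousLinearMap.compL ℝ E (E →L[ℝ] E →L[ℝ] E) (E [×2]→L[ℝ] E) (uncurry₂ E)

lemma uncurry₃_apply (B : E →L[ℝ] E →L[ℝ] E →L[ℝ] E) (w : Fin 3 → E) :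
    uncurry₃ E B w = B (w 0) (w 1) (w 2) := by
  simp [uncurry₃, uncurry₂_apply, Fin.tail]

/-- The torsion tensor in a chart. -/
def chartTorsionTensor (Γ : E → E →L[ℝ] E →L[ℝ] E) (z : E) : E [×2]→L[ℝ] E :=
  uncurry₂ E (Γ z - (Γ z).flip)

/-- The curvature tensor in a chart. -/
def chartCurvatureTensor (Γ : E → E →L[ℝ] E →L[ℝ] E) (z : E) : E [×3]→L[ℝ] E :=
  uncurry₃ E (chartCurvature Γ z)

lemma chartTorsionTensor_apply (Γ : E → E →L[ℝ] E →L[ℝ] E) (z : E) (w : Fin 2 → E) :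
    chartTorsionTensor Γ z w = Γ z (w 0) (w 1) - Γ z (w 1) (w 0) := by
  simp [chartTorsionTensor, uncurry₂_apply]

lemma chartCurvatureTensor_apply (Γ : E → E →L[ℝ] E →L[ℝ] E) (z : E) (w : Fin 3 → E) :
    chartCurvatureTensor Γ z w = chartCurvature Γ z (w 0) (w 1) (w 2) :=
  uncurry₃_apply _ _

lemma contDiffAt_chartTorsionTensor {Γ : E → E →L[ℝ] E →L[ℝ] E} {z : E}
    (hΓ : ContDiffAt ℝ ω Γ z) : ContDiffAt ℝ ω (chartTorsionTensor Γ) z :=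
  (uncurry₂ E).contDiff.contDiffAt.comp z
    (hΓ.sub ((ContinuousLinearMap.flipₗᵢ ℝ E E E).contDiff.contDiffAt.comp z hΓ))

lemma contDiffAt_chartCurvatureTensor {Γ : E → E →L[ℝ] E →L[ℝ] E} {z : E}
    (hΓ : ContDiffAt ℝ ω Γ z) : ContDiffAt ℝ ω (chartCurvatureTensor Γ) z :=
  (uncurry₃ E).contDiff.contDiffAt.comp z (contDiffAt_chartCurvature hΓ)

/-- The linear operator of the variational equation for maps with parallel differential. -/
def variationOperator (a : F →L[ℝ] F →L[ℝ] F) (w : F) (u : E) (S : E →L[ℝ] F) (A : E →L[ℝ] E)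
    (R : F →L[ℝ] F →L[ℝ] F →L[ℝ] F) :
    (F × (E →L[ℝ] F)) →L[ℝ] (F × (E →L[ℝ] F)) :=
  .inl ℝ F (E →L[ℝ] F) ∘L (ContinuousLinearMap.apply ℝ F u ∘L .snd ℝ F (E →L[ℝ] F)
      - (ContinuousLinearMap.apply ℝ F w ∘L a) ∘L .fst ℝ F (E →L[ℝ] F))
    + .inr ℝ F (E →L[ℝ] F) ∘L
      (((ContinuousLinearMap.compL ℝ E E F).flip A - ContinuousLinearMap.compL ℝ E F F (a w)) ∘L
        .snd ℝ F (E →L[ℝ] F)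
      + ((ContinuousLinearMap.compL ℝ E F F).flip S ∘L R w) ∘L .fst ℝ F (E →L[ℝ] F))

lemma variationOperator_apply (a : F →L[ℝ] F →L[ℝ] F) (w : F) (u : E) (S : E →L[ℝ] F)
    (A : E →L[ℝ] E) (R : F →L[ℝ] F →L[ℝ] F →L[ℝ] F) (α : F) (β : E →L[ℝ] F) :
    variationOperator a w u S A R (α, β)
      = (β u - a α w, β ∘L A - a w ∘L β + R w α ∘L S) := by
  simp [variationOperator]

lemma continuousAt_variationOperator {a : ℝ → F →L[ℝ] F →L[ℝ] F} {w : ℝ → F} {u : ℝ → E}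
    {S : ℝ → E →L[ℝ] F} {A : ℝ → E →L[ℝ] E} {R : ℝ → F →L[ℝ] F →L[ℝ] F →L[ℝ] F} {t : ℝ}
    (ha : ContinuousAt a t) (hw : ContinuousAt w t) (hu : ContinuousAt u t)
    (hS : ContinuousAt S t) (hA : ContinuousAt A t) (hR : ContinuousAt R t) :
    ContinuousAt (fun t ↦ variationOperator (a t) (w t) (u t) (S t) (A t) (R t)) t := by
  have h1 : ContinuousAt (fun t ↦ ContinuousLinearMap.apply ℝ F (u t)) t :=
    (ContinuousLinearMap.apply ℝ F).continuous.continuousAt.comp hu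
  have h2 : ContinuousAt (fun t ↦ ContinuousLinearMap.apply ℝ F (w t)) t :=
    (ContinuousLinearMap.apply ℝ F).continuous.continuousAt.comp hw
  have h3 : ContinuousAt (fun t ↦ (ContinuousLinearMap.compL ℝ E E F).flip (A t)) t :=
    (ContinuousLinearMap.compL ℝ E E F).flip.continuous.continuousAt.comp hA
  have h4 : ContinuousAt (fun t ↦ (ContinuousLinearMap.compL ℝ E F F).flip (S t)) t :=
    (ContinuousLinearMap.compL ℝ E F F).flip.continuous.continuousAt.comp hS
  have h5 : ContinuousAt (fun t ↦ ContinuousLinearMap.compL ℝ E F F (a t (w t))) t :=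
    (ContinuousLinearMap.compL ℝ E F F).continuous.continuousAt.comp (ha.clm_apply hw)
  have h6 := hR.clm_apply hw
  unfold variationOperator
  exact (continuousAt_const.clm_comp ((h1.clm_comp continuousAt_const).sub
    ((h2.clm_comp ha).clm_comp continuousAt_const))).add (continuousAt_const.clm_comp
    (((h3.sub h5).clm_comp continuousAt_const).add ((h4.clm_comp h6).clm_comp continuousAt_const)))

/-- The prefix `d` stands for the derivative in a parameter. The defect `α = dy - S dc` and the
covariant derivative `β` of `S` in the parameter direction satisfy the homogeneous linear equation
given by `variationOperator`, and both vanish at time 0. -/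
lemma variation_eq {ΓM : E → E →L[ℝ] E →L[ℝ] E} {ΓN : F → F →L[ℝ] F →L[ℝ] F}
    {c u dc du : ℝ → E} {y dy : ℝ → F} {S dS : ℝ → E →L[ℝ] F} {J : Set ℝ}
    (hJo : IsOpen J) (hJ : IsPreconnected J) (h0J : (0 : ℝ) ∈ J)
    (hΓM : ∀ t ∈ J, ContDiffAt ℝ ω ΓM (c t)) (hΓN : ∀ t ∈ J, ContDiffAt ℝ ω ΓN (y t))
    (hc : ∀ t ∈ J, HasDerivAt c (u t) t)
    (hu : ∀ t ∈ J, ContinuousAt u t)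
    (hy : ∀ t ∈ J, HasDerivAt y (S t (u t)) t)
    (hS : ∀ t ∈ J, HasDerivAt S (S t ∘L ΓM (c t) (u t) - ΓN (y t) (S t (u t)) ∘L S t) t)
    (hdc : ∀ t ∈ J, HasDerivAt dc (du t) t)
    (hdy : ∀ t ∈ J, HasDerivAt dy (dS t (u t) + S t (du t)) t)
    (hdS : ∀ t ∈ J, HasDerivAt dS (dS t ∘L ΓM (c t) (u t)
      + S t ∘L (fderiv ℝ ΓM (c t) (dc t) (u t) + ΓM (c t) (du t))
      - ((fderiv ℝ ΓN (y t) (dy t) (S t (u t)) + ΓN (y t) (dS t (u t) + S t (du t))) ∘L S t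
        + ΓN (y t) (S t (u t)) ∘L dS t)) t)
    (hdc0 : dc 0 = 0) (hdy0 : dy 0 = 0) (hdS0 : dS 0 = 0)
    (hT : ∀ t ∈ J, ∀ x, S t (ΓM (c t) (u t) x - ΓM (c t) x (u t))
      = ΓN (y t) (S t (u t)) (S t x) - ΓN (y t) (S t x) (S t (u t)))
    (hR : ∀ t ∈ J, ∀ x e, S t (chartCurvature ΓM (c t) (u t) x e)
      = chartCurvature ΓN (y t) (S t (u t)) (S t x) (S t e)) :
    ∀ t ∈ J, dy t = S t (dc t) ∧
      dS t = S t ∘L ΓM (c t) (dc t) - ΓN (y t) (dy t) ∘L S t := by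
  let α : ℝ → F := fun t ↦ dy t - S t (dc t)
  let β : ℝ → E →L[ℝ] F := fun t ↦ dS t - (S t ∘L ΓM (c t) (dc t) - ΓN (y t) (dy t) ∘L S t)
  have hΓM' (t) (ht : t ∈ J) : HasDerivAt (fun t ↦ ΓM (c t)) (fderiv ℝ ΓM (c t) (u t)) t :=
    ((hΓM t ht).differentiableAt (by simp)).hasFDerivAt.comp_hasDerivAt t (hc t ht)
  have hΓN' (t) (ht : t ∈ J) : HasDerivAt (fun t ↦ ΓN (y t)) (fderiv ℝ ΓN (y t) (S t (u t))) t :=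
    ((hΓN t ht).differentiableAt (by simp)).hasFDerivAt.comp_hasDerivAt t (hy t ht)
  have hα (t) (ht : t ∈ J) : HasDerivAt α (β t (u t) - ΓN (y t) (α t) (S t (u t))) t := by
    refine ((hdy t ht).sub ((hS t ht).clm_apply (hdc t ht))).congr_deriv ?_
    -- Time and parameter derivatives bring the arguments of the Christoffel symbols in opposite
    -- orders; the relation of the torsions reconciles them.
    have := hT t ht (dc t)
    simp [α, β] at this ⊢
    linear_combination (norm := module) (-1 : ℝ) • this
  have hβ (t) (ht : t ∈ J) : HasDerivAt β (β t ∘L ΓM (c t) (u t) - ΓN (y t) (S t (u t)) ∘L β t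
      + chartCurvature ΓN (y t) (S t (u t)) (α t) ∘L S t) t := by
    refine ((hdS t ht).sub (((hS t ht).clm_comp ((hΓM' t ht).clm_apply (hdc t ht))).sub
      (((hΓN' t ht).clm_apply (hdy t ht)).clm_comp (hS t ht)))).congr_deriv ?_
    ext e
    -- Commuting the two covariant derivatives of `S` produces the curvature of `N` in `(S u, dy)`
    -- and that of `M` in `(u, dc)`. Relating the latter to `N` leaves only the curvature of `N` in
    -- `(S u, α)`.
    have := hR t ht (dc t) e
    simp [α, β, chartCurvature_apply] at this ⊢
    linear_combination (norm := module) (-1 : ℝ) • this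
  have hA (t) (ht : t ∈ J) : ContinuousAt (fun t ↦ variationOperator (ΓN (y t)) (S t (u t)) (u t)
      (S t) (ΓM (c t) (u t)) (chartCurvature ΓN (y t))) t := by
    have h1 := (hΓN' t ht).continuousAt
    have h2 := (hΓM' t ht).continuousAt
    have h3 := (hS t ht).continuousAt
    have h4 := hu t ht
    have h5 : ContinuousAt (fun t ↦ chartCurvature ΓN (y t)) t :=
      ContinuousAt.comp (f := y) (g := chartCurvature ΓN)
        (contDiffAt_chartCurvature (hΓN t ht)).continuousAt (hy t ht).continuousAt
    exact continuousAt_variationOperator h1 (h3.clm_apply h4) h4 h3 (h2.clm_apply h4) h5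
  have hz := eqOn_zero_of_hasDerivAt_linear (f := fun t ↦ (α t, β t)) hJo hJ hA
    (fun t ht ↦ ((hα t ht).prodMk (hβ t ht)).congr_deriv
      (variationOperator_apply _ _ _ _ _ _ _ _).symm) h0J
    (by simp [α, β, hdc0, hdy0, hdS0])
  intro t ht
  have h1 := Prod.ext_iff.1 (hz t ht)
  exact ⟨sub_eq_zero.1 h1.1, sub_eq_zero.1 h1.2⟩

end ChartCurvature

/-! ### Local existence of affine maps in coordinates. -/

section ChartExistence
open Set Filter Metric
set_option maxSynthPendingDepth 3
set_option linter.unusedSectionVars false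

variable {E : Type*} [NormedAddCommGroup E] [NormedSpace ℝ E]
  {F : Type*} [NormedAddCommGroup F] [NormedSpace ℝ F]
  {V : Type*} [NormedAddCommGroup V] [NormedSpace ℝ V]

lemma hasDerivAt_fst {U : Type*} [NormedAddCommGroup U] [NormedSpace ℝ U] {f : ℝ → U × V}
    {f' : U × V} {t : ℝ} (h : HasDerivAt f f' t) : HasDerivAt (fun s ↦ (f s).1) f'.1 t :=
  (ContinuousLinearMap.fst ℝ U V).hasFDerivAt.comp_hasDerivAt t h

lemma hasDerivAt_snd {U : Type*} [NormedAddCommGroup U] [NormedSpace ℝ U] {f : ℝ → U × V}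
    {f' : U × V} {t : ℝ} (h : HasDerivAt f f' t) : HasDerivAt (fun s ↦ (f s).2) f'.2 t :=
  (ContinuousLinearMap.snd ℝ U V).hasFDerivAt.comp_hasDerivAt t h

/-- The first variation of a family of integral curves. -/
lemma hasDerivAt_fderiv_flow {X : V → V} {Ψ : ℝ × E → V} {q : ℝ × E}
    (hΨ : ContDiffAt ℝ ω Ψ q) (hX : DifferentiableAt ℝ X (Ψ q))
    (hd : ∀ᶠ p in 𝓝 q, HasDerivAt (fun s ↦ Ψ (s, p.2)) (X (Ψ p)) p.1) (h : E) :
    HasDerivAt (fun t ↦ fderiv ℝ Ψ (t, q.2) (0, h)) (fderiv ℝ X (Ψ q) (fderiv ℝ Ψ q (0, h))) q.1 := by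
  have hD : DifferentiableAt ℝ (fderiv ℝ Ψ) q :=
    (hΨ.fderiv_right (m := ω) le_rfl).differentiableAt (by simp)
  have hΨ1 : ∀ᶠ p in 𝓝 q, DifferentiableAt ℝ Ψ p :=
    (hΨ.eventually (by simp)).mono fun p hp ↦ hp.differentiableAt (by simp)
  have hline (p : ℝ × E) : HasDerivAt (fun s : ℝ ↦ (s, p.2)) ((1 : ℝ), (0 : E)) p.1 :=
    (hasDerivAt_id p.1).prodMk (hasDerivAt_const _ _)
  have heq : (fun p ↦ fderiv ℝ Ψ p (1, 0)) =ᶠ[𝓝 q] fun p ↦ X (Ψ p) := by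
    filter_upwards [hΨ1, hd] with p hp hp'
    have h1 : HasDerivAt (fun s ↦ Ψ (s, p.2)) (fderiv ℝ Ψ p (1, 0)) p.1 :=
      HasFDerivAt.comp_hasDerivAt (l := Ψ) (f := fun s ↦ (s, p.2)) p.1 hp.hasFDerivAt (hline p)
    exact h1.unique hp'
  have h2 : HasFDerivAt (fun p ↦ X (Ψ p)) (fderiv ℝ X (Ψ q) ∘L fderiv ℝ Ψ q) q :=
    hX.hasFDerivAt.comp q hΨ1.self_of_nhds.hasFDerivAt
  have h3 : HasFDerivAt (fun p ↦ fderiv ℝ Ψ p (1, 0))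
      ((ContinuousLinearMap.apply ℝ V ((1 : ℝ), (0 : E))) ∘L fderiv ℝ (fderiv ℝ Ψ) q) q :=
    (ContinuousLinearMap.apply ℝ V ((1 : ℝ), (0 : E))).hasFDerivAt.comp q hD.hasFDerivAt
  have h4 := (h3.congr_of_eventuallyEq heq.symm).unique h2
  have h5 : fderiv ℝ (fderiv ℝ Ψ) q (0, h) (1, 0) = fderiv ℝ X (Ψ q) (fderiv ℝ Ψ q (0, h)) :=
    congrArg (fun L : ℝ × E →L[ℝ] V ↦ L (0, h)) h4
  -- Symmetry of the second derivative exchanges differentiation in time and in the parameter.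
  have hsymm : IsSymmSndFDerivAt ℝ Ψ q := hΨ.isSymmSndFDerivAt (by simp)
  rw [← h5, hsymm.eq]
  have h6 : HasDerivAt (fun t ↦ fderiv ℝ Ψ (t, q.2)) (fderiv ℝ (fderiv ℝ Ψ) q (1, 0)) q.1 :=
    HasFDerivAt.comp_hasDerivAt (l := fderiv ℝ Ψ) (f := fun s ↦ (s, q.2)) q.1 hD.hasFDerivAt
      (hline q)
  exact (ContinuousLinearMap.apply ℝ V ((0 : ℝ), h)).hasFDerivAt.comp_hasDerivAt q.1 h6

/-- The state of parallel transport along a geodesic: position and velocity in the source, position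
in the target, transported linear map, transported frame. -/
abbrev TransportState (E F : Type*) [NormedAddCommGroup E] [NormedSpace ℝ E]
    [NormedAddCommGroup F] [NormedSpace ℝ F] : Type _ :=
  E × E × F × (E →L[ℝ] F) × (E →L[ℝ] E)

/-- The vector field of parallel transport along geodesics. -/
def transportField (ΓM : E → E →L[ℝ] E →L[ℝ] E) (ΓN : F → F →L[ℝ] F →L[ℝ] F)
    (q : TransportState E F) : TransportState E F :=
  (q.2.1, -ΓM q.1 q.2.1 q.2.1, q.2.2.2.1 q.2.1,
    q.2.2.2.1 ∘L ΓM q.1 q.2.1 - ΓN q.2.2.1 (q.2.2.2.1 q.2.1) ∘L q.2.2.2.1,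
    -(ΓM q.1 q.2.1 ∘L q.2.2.2.2))

lemma contDiffAt_transportField {ΓM : E → E →L[ℝ] E →L[ℝ] E} {ΓN : F → F →L[ℝ] F →L[ℝ] F}
    {q : TransportState E F} (hM : ContDiffAt ℝ ω ΓM q.1) (hN : ContDiffAt ℝ ω ΓN q.2.2.1) :
    ContDiffAt ℝ ω (transportField ΓM ΓN) q := by
  have h1 : ContDiffAt ℝ ω (fun q : TransportState E F ↦ ΓM q.1) q :=
    ContDiffAt.comp q (g := ΓM) hM contDiffAt_fst
  have h2 : ContDiffAt ℝ ω (fun q : TransportState E F ↦ ΓN q.2.2.1) q :=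
    ContDiffAt.comp q (g := ΓN) hN (by fun_prop)
  unfold transportField
  have hu : ContDiffAt ℝ ω (fun q : TransportState E F ↦ q.2.1) q := by fun_prop
  have hS : ContDiffAt ℝ ω (fun q : TransportState E F ↦ q.2.2.2.1) q := by fun_prop
  have hP : ContDiffAt ℝ ω (fun q : TransportState E F ↦ q.2.2.2.2) q := by fun_prop
  exact hu.prodMk (((h1.clm_apply hu).clm_apply hu).neg.prodMk ((hS.clm_apply hu).prodMk
    (((hS.clm_comp (h1.clm_apply hu)).sub ((h2.clm_apply (hS.clm_apply hu)).clm_comp hS)).prodMk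
      ((h1.clm_apply hu).clm_comp hP).neg)))

/-- Computed by the product rule along the line `q + s • d`. The frame component is omitted because
the variational equation does not involve it. -/
lemma fderiv_transportField {ΓM : E → E →L[ℝ] E →L[ℝ] E} {ΓN : F → F →L[ℝ] F →L[ℝ] F}
    {q : TransportState E F} (hM : ContDiffAt ℝ ω ΓM q.1) (hN : ContDiffAt ℝ ω ΓN q.2.2.1)
    (d : TransportState E F) :
    (fderiv ℝ (transportField ΓM ΓN) q d).1 = d.2.1 ∧
    (fderiv ℝ (transportField ΓM ΓN) q d).2.1 = -((fderiv ℝ ΓM q.1 d.1 q.2.1 + ΓM q.1 d.2.1) q.2.1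
      + ΓM q.1 q.2.1 d.2.1) ∧
    (fderiv ℝ (transportField ΓM ΓN) q d).2.2.1 = d.2.2.2.1 q.2.1 + q.2.2.2.1 d.2.1 ∧
    (fderiv ℝ (transportField ΓM ΓN) q d).2.2.2.1 = d.2.2.2.1 ∘L ΓM q.1 q.2.1
      + q.2.2.2.1 ∘L (fderiv ℝ ΓM q.1 d.1 q.2.1 + ΓM q.1 d.2.1)
      - ((fderiv ℝ ΓN q.2.2.1 d.2.2.1 (q.2.2.2.1 q.2.1)
          + ΓN q.2.2.1 (d.2.2.2.1 q.2.1 + q.2.2.2.1 d.2.1)) ∘L q.2.2.2.1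
        + ΓN q.2.2.1 (q.2.2.2.1 q.2.1) ∘L d.2.2.2.1) := by
  let γ : ℝ → TransportState E F := fun s ↦ q + s • d
  have hγ : HasDerivAt γ d 0 := by
    have := ((hasDerivAt_id (0 : ℝ)).smul_const d).const_add q
    rw [one_smul] at this
    exact this
  have hγ0 : γ 0 = q := by simp [γ]
  have h := (hγ0 ▸ ((contDiffAt_transportField hM hN).differentiableAt (by simp)).hasFDerivAt
    : HasFDerivAt (transportField ΓM ΓN) (fderiv ℝ (transportField ΓM ΓN) q) (γ 0)).comp_hasDerivAt
      (0 : ℝ) hγ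
  have g1 := hasDerivAt_fst hγ
  have g2 := hasDerivAt_fst (hasDerivAt_snd hγ)
  have g3 := hasDerivAt_fst (hasDerivAt_snd (hasDerivAt_snd hγ))
  have g4 := hasDerivAt_fst (hasDerivAt_snd (hasDerivAt_snd (hasDerivAt_snd hγ)))
  have gM : HasDerivAt (fun s ↦ ΓM (γ s).1) (fderiv ℝ ΓM q.1 d.1) 0 :=
    (hγ0 ▸ (hM.differentiableAt (by simp)).hasFDerivAt :
      HasFDerivAt ΓM (fderiv ℝ ΓM q.1) (γ 0).1).comp_hasDerivAt (0 : ℝ) g1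
  have gN : HasDerivAt (fun s ↦ ΓN (γ s).2.2.1) (fderiv ℝ ΓN q.2.2.1 d.2.2.1) 0 :=
    (hγ0 ▸ (hN.differentiableAt (by simp)).hasFDerivAt :
      HasFDerivAt ΓN (fderiv ℝ ΓN q.2.2.1) (γ 0).2.2.1).comp_hasDerivAt (0 : ℝ) g3
  have g5 := gM.clm_apply g2
  have k2 := (g5.clm_apply g2).neg
  have k4 := (g4.clm_comp g5).sub ((gN.clm_apply (g4.clm_apply g2)).clm_comp g4)
  refine ⟨(hasDerivAt_fst h).unique g2, ?_, ?_, ?_⟩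
  · refine ((hasDerivAt_fst (hasDerivAt_snd h)).unique k2).trans ?_
    simp only [hγ0]
  · refine ((hasDerivAt_fst (hasDerivAt_snd (hasDerivAt_snd h))).unique (g4.clm_apply g2)).trans ?_
    simp only [hγ0]
  · refine ((hasDerivAt_fst (hasDerivAt_snd (hasDerivAt_snd (hasDerivAt_snd h)))).unique k4).trans ?_
    simp only [hγ0]


/-- The equation of affine maps in charts with Christoffel symbols `ΓM` and `ΓN`. -/
def IsChartAffineAt (ΓM : E → E →L[ℝ] E →L[ℝ] E) (ΓN : F → F →L[ℝ] F →L[ℝ] F) (f : E → F)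
    (z : E) : Prop :=
  ∀ u w, fderiv ℝ (fderiv ℝ f) z u w + ΓN (f z) (fderiv ℝ f z u) (fderiv ℝ f z w)
    = fderiv ℝ f z (ΓM z u w)

variable [CompleteSpace E] [CompleteSpace F]

/-- An analytic family of parallel transports along geodesics. -/
lemma exists_transport_family {ΓM : E → E →L[ℝ] E →L[ℝ] E} {ΓN : F → F →L[ℝ] F →L[ℝ] F}
    {z₀ : E} {y₀ : F} (hM : ContDiffAt ℝ ω ΓM z₀) (hN : ContDiffAt ℝ ω ΓN y₀) (σ : E →L[ℝ] F) :
    ∃ ε > 0, ∃ Ψ : ℝ × E → TransportState E F,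
      (∀ v ∈ ball (0 : E) ε, Ψ (0, v) = (z₀, v, y₀, σ, .id ℝ E)) ∧
      ∀ q ∈ Ioo (-ε) ε ×ˢ ball (0 : E) ε,
        ContDiffAt ℝ ω Ψ q ∧ HasDerivAt (fun s ↦ Ψ (s, q.2)) (transportField ΓM ΓN (Ψ q)) q.1 ∧
        ContDiffAt ℝ ω ΓM (Ψ q).1 ∧ ContDiffAt ℝ ω ΓN (Ψ q).2.2.1 ∧ IsUnit (Ψ q).2.2.2.2 := by
  let i : E → TransportState E F := fun v ↦ (z₀, v, y₀, σ, .id ℝ E)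
  have hi : ContDiff ℝ ω i := by fun_prop
  have hX : ContDiffAt ℝ ω (transportField ΓM ΓN) (i 0) := contDiffAt_transportField hM hN
  obtain ⟨Φ, hΦ, hΦ0, hΦd⟩ := exists_analytic_flow hX.analyticAt
  have h00 : Φ (0, i 0) = i 0 := hΦ0.self_of_nhds
  have hit : Tendsto i (𝓝 0) (𝓝 (i 0)) := hi.continuous.tendsto 0
  have hit' : Tendsto (fun q : ℝ × E ↦ (q.1, i q.2)) (𝓝 (0, 0)) (𝓝 (0, i 0)) := by
    have : Continuous (fun q : ℝ × E ↦ (q.1, i q.2)) := by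
      exact continuous_fst.prodMk (hi.continuous.comp continuous_snd)
    exact this.tendsto (0, 0)
  let Ψ : ℝ × E → TransportState E F := fun q ↦ Φ (q.1, i q.2)
  have hΨ : ContDiffAt ℝ ω Ψ (0, 0) :=
    ContDiffAt.comp (0, 0) (g := Φ) (f := fun q : ℝ × E ↦ (q.1, i q.2)) hΦ.contDiffAt
      (contDiffAt_fst.prodMk (hi.contDiffAt.comp _ contDiffAt_snd))
  have hΨc : Tendsto Ψ (𝓝 (0, 0)) (𝓝 (i 0)) := by
    have := hΨ.continuousAt.tendsto
    rwa [show Ψ (0, 0) = i 0 from h00] at this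
  have e1 : ∀ᶠ q in 𝓝 ((0 : ℝ), (0 : E)), ContDiffAt ℝ ω Ψ q := hΨ.eventually (by simp)
  have e2 := hit'.eventually hΦd
  have e3 : ∀ᶠ q in 𝓝 ((0 : ℝ), (0 : E)), ContDiffAt ℝ ω ΓM (Ψ q).1 :=
    (continuous_fst.tendsto _).comp hΨc |>.eventually (hM.eventually (by simp))
  have e4 : ∀ᶠ q in 𝓝 ((0 : ℝ), (0 : E)), ContDiffAt ℝ ω ΓN (Ψ q).2.2.1 :=
    ((by fun_prop : Continuous fun q : TransportState E F ↦ q.2.2.1).tendsto _).comp hΨc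
      |>.eventually (hN.eventually (by simp))
  have e5 : ∀ᶠ q in 𝓝 ((0 : ℝ), (0 : E)), IsUnit (Ψ q).2.2.2.2 := by
    refine ((by fun_prop : Continuous fun q : TransportState E F ↦ q.2.2.2.2).tendsto _).comp hΨc
      |>.eventually (Units.isOpen.mem_nhds ?_)
    exact isUnit_one
  obtain ⟨ε₁, hε₁, h1⟩ := Metric.eventually_nhds_iff_ball.1 (hit.eventually hΦ0)
  obtain ⟨ε₂, hε₂, h2⟩ := Metric.eventually_nhds_iff_ball.1
    (e1.and (e2.and (e3.and (e4.and e5))))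
  refine ⟨min ε₁ ε₂, lt_min hε₁ hε₂, Ψ, fun v hv ↦ h1 v (ball_subset_ball (min_le_left _ _) hv),
    fun q hq ↦ h2 q ?_⟩
  rw [← ball_prod_same]
  refine ⟨?_, ball_subset_ball (min_le_right _ _) hq.2⟩
  rw [Real.ball_eq_Ioo, zero_sub, zero_add]
  exact Ioo_subset_Ioo (neg_le_neg (min_le_right ε₁ ε₂)) (min_le_right ε₁ ε₂) hq.1

lemma transport_family_init {z₀ : E} {y₀ : F} {σ : E →L[ℝ] F} {ε : ℝ}
    {Ψ : ℝ × E → TransportState E F}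
    (hΨ0 : ∀ v ∈ ball (0 : E) ε, Ψ (0, v) = (z₀, v, y₀, σ, .id ℝ E)) {v : E}
    (hv : v ∈ ball (0 : E) ε) (hd : DifferentiableAt ℝ Ψ (0, v)) (h : E) :
    fderiv ℝ Ψ (0, v) (0, h) = (0, h, 0, 0, 0) := by
  have h1 : HasFDerivAt (fun w ↦ Ψ (0, w)) (fderiv ℝ Ψ (0, v) ∘L .inr ℝ ℝ E) v :=
    hd.hasFDerivAt.comp v (hasFDerivAt_prodMk_right (0 : ℝ) v)
  have h2 : HasFDerivAt (fun w : E ↦ ((z₀, w, y₀, σ, .id ℝ E) : TransportState E F))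
      ((0 : E →L[ℝ] E).prod ((ContinuousLinearMap.id ℝ E).prod ((0 : E →L[ℝ] F).prod
        ((0 : E →L[ℝ] (E →L[ℝ] F)).prod (0 : E →L[ℝ] (E →L[ℝ] E)))))) v :=
    (hasFDerivAt_const _ _).prodMk ((hasFDerivAt_id _).prodMk ((hasFDerivAt_const _ _).prodMk
      ((hasFDerivAt_const _ _).prodMk (hasFDerivAt_const _ _))))
  have h3 := h1.unique (h2.congr_of_eventuallyEq
    ((isOpen_ball.eventually_mem hv).mono fun w hw ↦ hΨ0 w hw))
  simpa using congrArg (fun L : E →L[ℝ] TransportState E F ↦ L h) h3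

/-- The differential of the family of parallel transports with respect to the initial velocity, if
torsion and curvature are related to all orders at the base points. -/
lemma transport_family_variation {ΓM : E → E →L[ℝ] E →L[ℝ] E} {ΓN : F → F →L[ℝ] F →L[ℝ] F}
    {z₀ : E} {y₀ : F} {σ : E →L[ℝ] F}
    (hT : ∀ r (w : Fin (2 + r) → E), σ (chartIterCov ΓM (chartTorsionTensor ΓM) r z₀ w)
      = chartIterCov ΓN (chartTorsionTensor ΓN) r y₀ (fun i ↦ σ (w i)))
    (hR : ∀ r (w : Fin (3 + r) → E), σ (chartIterCov ΓM (chartCurvatureTensor ΓM) r z₀ w)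
      = chartIterCov ΓN (chartCurvatureTensor ΓN) r y₀ (fun i ↦ σ (w i)))
    {ε : ℝ} (hε : 0 < ε) {Ψ : ℝ × E → TransportState E F}
    (hΨ0 : ∀ v ∈ ball (0 : E) ε, Ψ (0, v) = (z₀, v, y₀, σ, .id ℝ E))
    (hΨ : ∀ q ∈ Ioo (-ε) ε ×ˢ ball (0 : E) ε,
        ContDiffAt ℝ ω Ψ q ∧ HasDerivAt (fun s ↦ Ψ (s, q.2)) (transportField ΓM ΓN (Ψ q)) q.1 ∧
        ContDiffAt ℝ ω ΓM (Ψ q).1 ∧ ContDiffAt ℝ ω ΓN (Ψ q).2.2.1 ∧ IsUnit (Ψ q).2.2.2.2)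
    (v : E) (hv : v ∈ ball (0 : E) ε) (h : E) :
    ∀ t ∈ Ioo (-ε) ε,
      (fderiv ℝ Ψ (t, v) (0, h)).2.2.1 = (Ψ (t, v)).2.2.2.1 (fderiv ℝ Ψ (t, v) (0, h)).1 ∧
      (fderiv ℝ Ψ (t, v) (0, h)).2.2.2.1
        = (Ψ (t, v)).2.2.2.1 ∘L ΓM (Ψ (t, v)).1 (fderiv ℝ Ψ (t, v) (0, h)).1
          - ΓN (Ψ (t, v)).2.2.1 (fderiv ℝ Ψ (t, v) (0, h)).2.2.1 ∘L (Ψ (t, v)).2.2.2.1 := by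
  have hbox : IsOpen (Ioo (-ε) ε ×ˢ ball (0 : E) ε) := isOpen_Ioo.prod isOpen_ball
  have h0J : (0 : ℝ) ∈ Ioo (-ε) ε := by simpa using hε
  have hmem (t) (ht : t ∈ Ioo (-ε) ε) : (t, v) ∈ Ioo (-ε) ε ×ˢ ball (0 : E) ε := ⟨ht, hv⟩
  have hda (t) (ht : t ∈ Ioo (-ε) ε) := (hΨ _ (hmem t ht)).2.1
  have hMa (t) (ht : t ∈ Ioo (-ε) ε) := (hΨ _ (hmem t ht)).2.2.1
  have hNa (t) (ht : t ∈ Ioo (-ε) ε) := (hΨ _ (hmem t ht)).2.2.2.1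
  have han (t) (ht : t ∈ Ioo (-ε) ε) : ContDiffAt ℝ ω (fun s ↦ Ψ (s, v)) t :=
    ContDiffAt.comp t (g := Ψ) (f := fun s ↦ (s, v)) (hΨ _ (hmem t ht)).1
      (contDiffAt_id.prodMk contDiffAt_const)
  have hc (t) (ht : t ∈ Ioo (-ε) ε) := hasDerivAt_fst (hda t ht)
  have hu (t) (ht : t ∈ Ioo (-ε) ε) := hasDerivAt_fst (hasDerivAt_snd (hda t ht))
  have hy (t) (ht : t ∈ Ioo (-ε) ε) := hasDerivAt_fst (hasDerivAt_snd (hasDerivAt_snd (hda t ht)))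
  have hS (t) (ht : t ∈ Ioo (-ε) ε) :=
    hasDerivAt_fst (hasDerivAt_snd (hasDerivAt_snd (hasDerivAt_snd (hda t ht))))
  have hP (t) (ht : t ∈ Ioo (-ε) ε) :=
    hasDerivAt_snd (hasDerivAt_snd (hasDerivAt_snd (hasDerivAt_snd (hda t ht))))
  have hrel {k : ℕ} {TM : E → E [×k]→L[ℝ] E} {TN : F → F [×k]→L[ℝ] F}
      (hTM : ∀ z, ContDiffAt ℝ ω ΓM z → ContDiffAt ℝ ω TM z)
      (hTN : ∀ z, ContDiffAt ℝ ω ΓN z → ContDiffAt ℝ ω TN z)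
      (hr : ∀ r (w : Fin (k + r) → E), σ (chartIterCov ΓM TM r z₀ w)
        = chartIterCov ΓN TN r y₀ (fun i ↦ σ (w i))) (t) (ht : t ∈ Ioo (-ε) ε) (w : Fin k → E) :
      (Ψ (t, v)).2.2.2.1 (TM (Ψ (t, v)).1 w)
        = TN (Ψ (t, v)).2.2.1 (fun i ↦ (Ψ (t, v)).2.2.2.1 (w i)) := by
    have key := tensor_related_along (J := Ioo (-ε) ε) (c := fun t ↦ (Ψ (t, v)).1)
      (u := fun t ↦ (Ψ (t, v)).2.1) (y := fun t ↦ (Ψ (t, v)).2.2.1)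
      (S := fun t ↦ (Ψ (t, v)).2.2.2.1) (P := fun t ↦ (Ψ (t, v)).2.2.2.2)
      isOpen_Ioo isPreconnected_Ioo h0J hMa hNa (fun t ht ↦ hTM _ (hMa t ht))
      (fun t ht ↦ hTN _ (hNa t ht)) hc hu hy hS hP
      (fun t ht ↦ (han t ht).fst.analyticAt) (fun t ht ↦ (han t ht).snd.snd.fst.analyticAt)
      (fun t ht ↦ (han t ht).snd.snd.snd.fst.analyticAt)
      (fun t ht ↦ (han t ht).snd.snd.snd.snd.analyticAt)
      (by simp only [hΨ0 v hv]) (by simpa only [hΨ0 v hv] using hr) t ht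
    -- The transported frame is still onto at time `t`, so a relation on frame vectors is a relation
    -- on all vectors.
    obtain ⟨P', hP'⟩ := (hΨ _ (hmem t ht)).2.2.2.2.exists_right_inv
    have hinv (x : E) : (Ψ (t, v)).2.2.2.2 (P' x) = x :=
      congrArg (fun L : E →L[ℝ] E ↦ L x) hP'
    simpa only [hinv] using key (fun i ↦ P' (w i))
  have hd (t) (ht : t ∈ Ioo (-ε) ε) := hasDerivAt_fderiv_flow (hΨ _ (hmem t ht)).1
    ((contDiffAt_transportField (hMa t ht) (hNa t ht)).differentiableAt (by simp))
    ((hbox.eventually_mem (hmem t ht)).mono fun p hp ↦ (hΨ p hp).2.1) h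
  have hd' (t) (ht : t ∈ Ioo (-ε) ε) := fderiv_transportField (hMa t ht) (hNa t ht)
    (fderiv ℝ Ψ (t, v) (0, h))
  have hinit := transport_family_init hΨ0 hv ((hΨ _ (hmem 0 h0J)).1.differentiableAt (by simp)) h
  refine variation_eq (J := Ioo (-ε) ε) (c := fun t ↦ (Ψ (t, v)).1) (u := fun t ↦ (Ψ (t, v)).2.1)
    (y := fun t ↦ (Ψ (t, v)).2.2.1) (S := fun t ↦ (Ψ (t, v)).2.2.2.1)
    (dc := fun t ↦ (fderiv ℝ Ψ (t, v) (0, h)).1) (du := fun t ↦ (fderiv ℝ Ψ (t, v) (0, h)).2.1)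
    (dy := fun t ↦ (fderiv ℝ Ψ (t, v) (0, h)).2.2.1)
    (dS := fun t ↦ (fderiv ℝ Ψ (t, v) (0, h)).2.2.2.1)
    isOpen_Ioo isPreconnected_Ioo h0J hMa hNa hc (fun t ht ↦ (hu t ht).continuousAt) hy hS
    ?_ ?_ ?_ ?_ ?_ ?_ ?_ ?_
  · exact fun t ht ↦ (hasDerivAt_fst (hd t ht)).congr_deriv (hd' t ht).1
  · exact fun t ht ↦ (hasDerivAt_fst (hasDerivAt_snd (hasDerivAt_snd (hd t ht)))).congr_deriv
      (hd' t ht).2.2.1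
  · exact fun t ht ↦ (hasDerivAt_fst (hasDerivAt_snd (hasDerivAt_snd
      (hasDerivAt_snd (hd t ht))))).congr_deriv (hd' t ht).2.2.2
  · simp only [hinit]
  · simp only [hinit]
  · simp only [hinit]
  · intro t ht x
    have := hrel (fun _ ↦ contDiffAt_chartTorsionTensor) (fun _ ↦ contDiffAt_chartTorsionTensor)
      hT t ht ![(Ψ (t, v)).2.1, x]
    simpa [chartTorsionTensor_apply] using this
  · intro t ht x e
    have := hrel (fun _ ↦ contDiffAt_chartCurvatureTensor)
      (fun _ ↦ contDiffAt_chartCurvatureTensor) hR t ht ![(Ψ (t, v)).2.1, x, e]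
    simpa [chartCurvatureTensor_apply] using this

lemma eqOn_of_hasDerivAt_same {f g f' : ℝ → V} {J : Set ℝ} (hJo : IsOpen J) (hJ : IsPreconnected J)
    (hf : ∀ t ∈ J, HasDerivAt f (f' t) t) (hg : ∀ t ∈ J, HasDerivAt g (f' t) t)
    {t₀ : ℝ} (ht₀ : t₀ ∈ J) (h : f t₀ = g t₀) : ∀ t ∈ J, f t = g t := fun t ht ↦ by
  refine sub_eq_zero.1 (eqOn_zero_of_hasDerivAt_linear (A := fun _ ↦ 0) (f := fun t ↦ f t - g t)
    hJo hJ (fun _ _ ↦ continuousAt_const) (fun s hs ↦ ?_) ht₀ (sub_eq_zero.2 h) t ht)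
  exact ((hf s hs).sub (hg s hs)).congr_deriv (by simp)

/-- The family of parallel transports along the constant geodesic. -/
lemma transport_family_zero {ΓM : E → E →L[ℝ] E →L[ℝ] E} {ΓN : F → F →L[ℝ] F →L[ℝ] F}
    {z₀ : E} {y₀ : F} {σ : E →L[ℝ] F}
    {ε : ℝ} (hε : 0 < ε) {Ψ : ℝ × E → TransportState E F}
    (hΨ0 : ∀ v ∈ ball (0 : E) ε, Ψ (0, v) = (z₀, v, y₀, σ, .id ℝ E))
    (hΨ : ∀ q ∈ Ioo (-ε) ε ×ˢ ball (0 : E) ε,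
        ContDiffAt ℝ ω Ψ q ∧ HasDerivAt (fun s ↦ Ψ (s, q.2)) (transportField ΓM ΓN (Ψ q)) q.1 ∧
        ContDiffAt ℝ ω ΓM (Ψ q).1 ∧ ContDiffAt ℝ ω ΓN (Ψ q).2.2.1 ∧ IsUnit (Ψ q).2.2.2.2) :
    ∀ t ∈ Ioo (-ε) ε, Ψ (t, 0) = (z₀, 0, y₀, σ, .id ℝ E) ∧
      ∀ h, (fderiv ℝ Ψ (t, 0) (0, h)).1 = t • h := by
  have hbox : IsOpen (Ioo (-ε) ε ×ˢ ball (0 : E) ε) := isOpen_Ioo.prod isOpen_ball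
  have h0J : (0 : ℝ) ∈ Ioo (-ε) ε := by simpa using hε
  have h0b : (0 : E) ∈ ball (0 : E) ε := by simpa using hε
  have hmem (t) (ht : t ∈ Ioo (-ε) ε) : (t, (0 : E)) ∈ Ioo (-ε) ε ×ˢ ball (0 : E) ε := ⟨ht, h0b⟩
  have hMa (t) (ht : t ∈ Ioo (-ε) ε) := (hΨ _ (hmem t ht)).2.2.1
  have hNa (t) (ht : t ∈ Ioo (-ε) ε) := (hΨ _ (hmem t ht)).2.2.2.1
  have hconst : ∀ t ∈ Ioo (-ε) ε, (z₀, 0, y₀, σ, .id ℝ E) = Ψ (t, 0) := by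
    refine eqOn_of_hasDerivAt (X := transportField ΓM ΓN) isOpen_Ioo isPreconnected_Ioo
      (f := fun _ ↦ (z₀, 0, y₀, σ, .id ℝ E)) (g := fun t ↦ Ψ (t, 0))
      (fun t ht ↦ ?_) (fun t ht ↦ ?_) (fun t ht ↦ (hΨ _ (hmem t ht)).2.1) h0J (hΨ0 0 h0b).symm
    · have h1 := hMa 0 h0J
      have h2 := hNa 0 h0J
      simp only [hΨ0 0 h0b] at h1 h2
      exact (contDiffAt_transportField h1 h2).of_le (by simp)
    · refine (hasDerivAt_const t _).congr_deriv ?_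
      simp [transportField]
      rfl
  refine fun t ht ↦ ⟨(hconst t ht).symm, fun h ↦ ?_⟩
  have hd (t) (ht : t ∈ Ioo (-ε) ε) := hasDerivAt_fderiv_flow (hΨ _ (hmem t ht)).1
    ((contDiffAt_transportField (hMa t ht) (hNa t ht)).differentiableAt (by simp))
    ((hbox.eventually_mem (hmem t ht)).mono fun p hp ↦ (hΨ p hp).2.1) h
  have hd' (t) (ht : t ∈ Ioo (-ε) ε) := fderiv_transportField (hMa t ht) (hNa t ht)
    (fderiv ℝ Ψ (t, 0) (0, h))
  have hinit := transport_family_init hΨ0 h0b ((hΨ _ (hmem 0 h0J)).1.differentiableAt (by simp)) h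
  -- The acceleration is quadratic in the velocity, so at the constant geodesic the linearized
  -- velocity is constant and the linearized position grows as `t • h`.
  have hdu : ∀ t ∈ Ioo (-ε) ε, (fderiv ℝ Ψ (t, 0) (0, h)).2.1 = h := by
    refine eqOn_of_hasDerivAt_same (f := fun t ↦ (fderiv ℝ Ψ (t, 0) (0, h)).2.1) (g := fun _ ↦ h)
      (f' := fun _ ↦ 0) isOpen_Ioo isPreconnected_Ioo
      (fun t ht ↦ (hasDerivAt_fst (hasDerivAt_snd (hd t ht))).congr_deriv ?_)
      (fun t _ ↦ hasDerivAt_const t h) h0J (by simp only [hinit])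
    refine (hd' t ht).2.1.trans ?_
    simp [← hconst t ht]
  refine eqOn_of_hasDerivAt_same (f := fun t ↦ (fderiv ℝ Ψ (t, 0) (0, h)).1) (g := fun t ↦ t • h)
      (f' := fun _ ↦ h) isOpen_Ioo isPreconnected_Ioo
      (fun t ht ↦ (hasDerivAt_fst (hd t ht)).congr_deriv ((hd' t ht).1.trans (hdu t ht)))
      (fun t _ ↦ ((hasDerivAt_id t).smul_const h).congr_deriv (one_smul _ _)) h0J
      (by simp only [hinit, zero_smul]) t ht

/-- Local existence of affine maps in charts: a linear map that relates the covariant derivatives of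
torsion and curvature of all orders is the differential of an affine map. -/
theorem exists_chartAffine {ΓM : E → E →L[ℝ] E →L[ℝ] E} {ΓN : F → F →L[ℝ] F →L[ℝ] F}
    {z₀ : E} {y₀ : F} {σ : E →L[ℝ] F} (hM : ContDiffAt ℝ ω ΓM z₀) (hN : ContDiffAt ℝ ω ΓN y₀)
    (hT : ∀ r (w : Fin (2 + r) → E), σ (chartIterCov ΓM (chartTorsionTensor ΓM) r z₀ w)
      = chartIterCov ΓN (chartTorsionTensor ΓN) r y₀ (fun i ↦ σ (w i)))
    (hR : ∀ r (w : Fin (3 + r) → E), σ (chartIterCov ΓM (chartCurvatureTensor ΓM) r z₀ w)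
      = chartIterCov ΓN (chartCurvatureTensor ΓN) r y₀ (fun i ↦ σ (w i))) :
    ∃ f : E → F, ContDiffAt ℝ ω f z₀ ∧ f z₀ = y₀ ∧ fderiv ℝ f z₀ = σ ∧
      ∀ᶠ z in 𝓝 z₀, IsChartAffineAt ΓM ΓN f z := by
  obtain ⟨ε, hε, Ψ, hΨ0, hΨ⟩ := exists_transport_family hM hN σ
  have hvar := transport_family_variation hT hR hε hΨ0 hΨ
  have hzero := transport_family_zero hε hΨ0 hΨ
  -- The family exists only for times below `ε`, so the time-`τ` map replaces the exponential map.
  -- Its differential at `v = 0` is `τ` times the identity, hence it is locally invertible.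
  obtain ⟨τ, hτ, hτε⟩ := exists_between hε
  have hτJ : τ ∈ Ioo (-ε) ε := ⟨by linarith, hτε⟩
  have h0b : (0 : E) ∈ ball (0 : E) ε := by simpa using hε
  let Φ : E → TransportState E F := fun v ↦ Ψ (τ, v)
  have hΦ (v) (hv : v ∈ ball (0 : E) ε) : ContDiffAt ℝ ω Φ v :=
    ContDiffAt.comp v (g := Ψ) (f := fun v ↦ (τ, v)) (hΨ _ ⟨hτJ, hv⟩).1
      (contDiffAt_const.prodMk contDiffAt_id)
  have hΦd (v) (hv : v ∈ ball (0 : E) ε) (h : E) : fderiv ℝ Φ v h = fderiv ℝ Ψ (τ, v) (0, h) := by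
    have h1 : HasFDerivAt Φ (fderiv ℝ Ψ (τ, v) ∘L .inr ℝ ℝ E) v :=
      ((hΨ _ ⟨hτJ, hv⟩).1.differentiableAt (by simp)).hasFDerivAt.comp v
        (hasFDerivAt_prodMk_right τ v)
    rw [h1.fderiv]
    rfl
  have hΦ00 : Φ 0 = (z₀, 0, y₀, σ, .id ℝ E) := (hzero τ hτJ).1
  let A : E ≃L[ℝ] E := ContinuousLinearEquiv.smulLeft (Units.mk0 τ hτ.ne')
  have hc : ContDiffAt ℝ ω (fun v ↦ (Φ v).1) 0 := (hΦ 0 h0b).fst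
  have hcd : HasFDerivAt (fun v ↦ (Φ v).1) (A : E →L[ℝ] E) 0 := by
    have h1 := ((hΦ 0 h0b).differentiableAt (by simp)).hasFDerivAt.fst
    refine h1.congr_fderiv ?_
    ext h
    exact (congrArg Prod.fst (hΦd 0 h0b h)).trans ((hzero τ hτJ).2 h)
  let W := hc.localInverse hcd (by simp)
  have hW : ContDiffAt ℝ ω W z₀ := by simpa [hΦ00] using hc.to_localInverse hcd (by simp)
  have hW0 : W z₀ = 0 := by simpa [hΦ00] using hc.localInverse_apply_image hcd (by simp)
  have hcW : ∀ᶠ x in 𝓝 z₀, (Φ (W x)).1 = x := by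
    have h := (hc.hasStrictFDerivAt' hcd (by simp)).eventually_right_inverse
    simp only [hΦ00] at h
    exact h
  have hWb : ∀ᶠ x in 𝓝 z₀, W x ∈ ball (0 : E) ε :=
    hW.continuousAt.eventually_mem (by simpa [hW0] using ball_mem_nhds (0 : E) hε)
  have hWa : ∀ᶠ x in 𝓝 z₀, ContDiffAt ℝ ω W x := hW.eventually (by simp)
  -- The final state as a function of the end point `x`: its first component is `x`, its third is
  -- the desired map, and its fourth will be the differential of that map.
  let G : E → TransportState E F := fun x ↦ Φ (W x)
  have hG (x) (h1 : W x ∈ ball (0 : E) ε) (h2 : ContDiffAt ℝ ω W x) : ContDiffAt ℝ ω G x :=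
    ContDiffAt.comp x (g := Φ) (hΦ _ h1) h2
  have hGd : ∀ᶠ x in 𝓝 z₀, ∀ h, (fderiv ℝ G x h).2.2.1 = (G x).2.2.2.1 h ∧
      (fderiv ℝ G x h).2.2.2.1
        = (G x).2.2.2.1 ∘L ΓM x h - ΓN (G x).2.2.1 ((G x).2.2.2.1 h) ∘L (G x).2.2.2.1 := by
    filter_upwards [hWb, hWa, hcW.eventually_nhds] with x h1 h2 h3 h
    have h4 : HasFDerivAt G (fderiv ℝ Φ (W x) ∘L fderiv ℝ W x) x :=
      ((hΦ _ h1).differentiableAt (by simp)).hasFDerivAt.comp x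
        (h2.differentiableAt (by simp)).hasFDerivAt
    have h5 : (fderiv ℝ G x h).1 = h :=
      congrArg (fun L : E →L[ℝ] E ↦ L h) ((((hG x h1 h2).differentiableAt
        (by simp)).hasFDerivAt.fst).unique ((hasFDerivAt_id x).congr_of_eventuallyEq h3))
    have h6 : fderiv ℝ G x h = fderiv ℝ Ψ (τ, W x) (0, fderiv ℝ W x h) := by
      rw [h4.fderiv]
      exact hΦd _ h1 _
    have h7 := hvar (W x) h1 (fderiv ℝ W x h) τ hτJ
    rw [← h6, h5] at h7
    change _ = (G x).2.2.2.1 h ∧ _ = (G x).2.2.2.1 ∘L ΓM (G x).1 h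
      - ΓN (G x).2.2.1 (fderiv ℝ G x h).2.2.1 ∘L (G x).2.2.2.1 at h7
    rw [show (G x).1 = x from h3.self_of_nhds] at h7
    exact ⟨h7.1, by rw [h7.2, h7.1]⟩
  have hfd : ∀ᶠ x in 𝓝 z₀, fderiv ℝ (fun x ↦ (G x).2.2.1) x = (G x).2.2.2.1 := by
    filter_upwards [hWb, hWa, hGd] with x h1 h2 h3
    rw [((hG x h1 h2).differentiableAt (by simp)).hasFDerivAt.snd.snd.fst.fderiv]
    ext h
    exact (h3 h).1
  have hG0 : G z₀ = (z₀, 0, y₀, σ, .id ℝ E) := by simp only [G, hW0, hΦ00]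
  refine ⟨fun x ↦ (G x).2.2.1, (hG z₀ hWb.self_of_nhds hW).snd.snd.fst, by simp only [hG0],
    by rw [hfd.self_of_nhds, hG0], ?_⟩
  filter_upwards [hWb, hWa, hGd, hfd.eventually_nhds] with x h1 h2 h3 h4 u w
  have h5 : fderiv ℝ (fderiv ℝ (fun x ↦ (G x).2.2.1)) x u = (fderiv ℝ G x u).2.2.2.1 := by
    rw [(((hG x h1 h2).differentiableAt (by simp)).hasFDerivAt.snd.snd.snd.fst.congr_of_eventuallyEq
      h4).fderiv]
    rfl
  -- Once the differential is `S`, parallelism of `S` in all directions is the affine equation.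
  rw [h5, (h3 u).2, h4.self_of_nhds]
  simp

end ChartExistence

/-! ### Geodesics joining nearby points, in coordinates. -/

section ChartGeodesics
open Set Filter Metric
set_option maxSynthPendingDepth 3
set_option linter.unusedSectionVars false

variable {E : Type*} [NormedAddCommGroup E] [NormedSpace ℝ E]

/-- The geodesic vector field on position-velocity pairs. -/
def geodesicField (Γ : E → E →L[ℝ] E →L[ℝ] E) (q : E × E) : E × E := (q.2, -Γ q.1 q.2 q.2)

lemma contDiffAt_geodesicField {Γ : E → E →L[ℝ] E →L[ℝ] E} {q : E × E}
    (hΓ : ContDiffAt ℝ ω Γ q.1) : ContDiffAt ℝ ω (geodesicField Γ) q := by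
  have h1 : ContDiffAt ℝ ω (fun q : E × E ↦ Γ q.1) q :=
    ContDiffAt.comp q (g := Γ) hΓ contDiffAt_fst
  exact contDiffAt_snd.prodMk ((h1.clm_apply contDiffAt_snd).clm_apply contDiffAt_snd).neg

/-- The Christoffel term is quadratic in the velocity and so has no first-order part at velocity 0.
-/
lemma fderiv_geodesicField_zero {Γ : E → E →L[ℝ] E →L[ℝ] E} {z : E}
    (hΓ : ContDiffAt ℝ ω Γ z) (d : E × E) :
    fderiv ℝ (geodesicField Γ) (z, 0) d = (d.2, 0) := by
  have h1 : HasFDerivAt (fun q : E × E ↦ Γ q.1) (fderiv ℝ Γ z ∘L .fst ℝ E E) (z, 0) :=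
    HasFDerivAt.comp (z, (0 : E)) (g := Γ) (hΓ.differentiableAt (by simp)).hasFDerivAt hasFDerivAt_fst
  have h2 := hasFDerivAt_snd (𝕜 := ℝ) (E := E) (F := E) (p := (z, 0))
  have h3 := (h1.clm_apply h2).clm_apply h2
  have h4 : HasFDerivAt (geodesicField Γ) _ (z, 0) := h2.prodMk h3.neg
  rw [h4.fderiv]
  simp

variable [CompleteSpace E]

/-- Analytic families of geodesics around a point. -/
lemma exists_geodesic_family {Γ : E → E →L[ℝ] E →L[ℝ] E} {z₀ u₀ : E} (hΓ : ContDiffAt ℝ ω Γ z₀)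
    {D : Set E} (hD : D ∈ 𝓝 z₀) :
    ∃ ε > 0, ∃ Φ : ℝ × (E × E) → E × E,
      (∀ v ∈ ball (z₀, u₀) ε, Φ (0, v) = v) ∧
      ∀ q ∈ Ioo (-ε) ε ×ˢ ball (z₀, u₀) ε,
        ContDiffAt ℝ ω Φ q ∧ HasDerivAt (fun s ↦ Φ (s, q.2)) (geodesicField Γ (Φ q)) q.1 ∧
        ContDiffAt ℝ ω Γ (Φ q).1 ∧ (Φ q).1 ∈ D := by
  have hX : ContDiffAt ℝ ω (geodesicField Γ) (z₀, u₀) := contDiffAt_geodesicField hΓ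
  obtain ⟨Φ, hΦ, hΦ0, hΦd⟩ := exists_analytic_flow hX.analyticAt
  have hΦc : Tendsto (fun q ↦ (Φ q).1) (𝓝 (0, (z₀, u₀))) (𝓝 z₀) := by
    have := hΦ.continuousAt.fst.tendsto
    rwa [hΦ0.self_of_nhds] at this
  have e1 : ∀ᶠ q in 𝓝 ((0 : ℝ), (z₀, u₀)), ContDiffAt ℝ ω Φ q := hΦ.contDiffAt.eventually (by simp)
  obtain ⟨ε₁, hε₁, h1⟩ := Metric.eventually_nhds_iff_ball.1 hΦ0
  obtain ⟨ε₂, hε₂, h2⟩ := Metric.eventually_nhds_iff_ball.1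
    (e1.and (hΦd.and ((hΦc.eventually (hΓ.eventually (by simp))).and (hΦc.eventually_mem hD))))
  refine ⟨min ε₁ ε₂, lt_min hε₁ hε₂, Φ, fun v hv ↦ h1 v (ball_subset_ball (min_le_left _ _) hv),
    fun q hq ↦ h2 q ?_⟩
  rw [← ball_prod_same]
  refine ⟨?_, ball_subset_ball (min_le_right _ _) hq.2⟩
  rw [Real.ball_eq_Ioo, zero_sub, zero_add]
  exact Ioo_subset_Ioo (neg_le_neg (min_le_right ε₁ ε₂)) (min_le_right ε₁ ε₂) hq.1

/-- Points close to a given one are joined by geodesics which depend analytically on the end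
points. -/
theorem exists_chart_geodesics {Γ : E → E →L[ℝ] E →L[ℝ] E} {z₀ : E} (hΓ : ContDiffAt ℝ ω Γ z₀)
    {D : Set E} (hD : D ∈ 𝓝 z₀) :
    ∃ r > 0, ∃ (L : E × E → E) (c : ℝ × (E × E) → E × E), ball z₀ r ⊆ D ∧
      (∀ x ∈ ball z₀ r, ∀ t ∈ Ioo (-2 : ℝ) 2, c (t, (x, x)) = (x, 0)) ∧
      ∀ q ∈ ball z₀ r ×ˢ ball z₀ r, ContDiffAt ℝ ω L q ∧ c (0, q) = (q.1, L q) ∧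
        (c (1, q)).1 = q.2 ∧ ∀ t ∈ Ioo (-2 : ℝ) 2, ContDiffAt ℝ ω c (t, q) ∧
          HasDerivAt (fun s ↦ c (s, q)) (geodesicField Γ (c (t, q))) t ∧
          ContDiffAt ℝ ω Γ (c (t, q)).1 ∧ (c (t, q)).1 ∈ D := by
  obtain ⟨ε, hε, Φ, hΦ0, hΦ⟩ := exists_geodesic_family (u₀ := 0) hΓ hD
  have hbox : IsOpen (Ioo (-ε) ε ×ˢ ball (z₀, (0 : E)) ε) := isOpen_Ioo.prod isOpen_ball
  have h0J : (0 : ℝ) ∈ Ioo (-ε) ε := by simpa using hε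
  have hb : (z₀, (0 : E)) ∈ ball (z₀, (0 : E)) ε := mem_ball_self hε
  have hconst (x : E) (hx : (x, 0) ∈ ball (z₀, (0 : E)) ε) :
      ∀ t ∈ Ioo (-ε) ε, (x, 0) = Φ (t, (x, 0)) := by
    refine eqOn_of_hasDerivAt (X := geodesicField Γ) isOpen_Ioo isPreconnected_Ioo
      (f := fun _ ↦ (x, 0)) (g := fun t ↦ Φ (t, (x, 0)))
      (fun t ht ↦ ?_) (fun t ht ↦ ?_) (fun t ht ↦ (hΦ (t, (x, 0)) ⟨ht, hx⟩).2.1) h0J (hΦ0 _ hx).symm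
    · have h1 := (hΦ (0, (x, 0)) ⟨h0J, hx⟩).2.2.1
      rw [hΦ0 _ hx] at h1
      exact (contDiffAt_geodesicField h1).of_le (by simp)
    · refine (hasDerivAt_const t _).congr_deriv ?_
      simp [geodesicField]
      rfl
  -- Time will be rescaled by `τ` so that the end point is reached at time 1. The factor 2 makes the
  -- rescaled geodesics live on `(-2, 2)`, an open interval with room around `[0, 1]`.
  obtain ⟨τ, hτ, hτε⟩ : ∃ τ, 0 < τ ∧ 2 * τ ≤ ε := ⟨ε / 2, by positivity, by linarith⟩
  have hτJ : τ ∈ Ioo (-ε) ε := ⟨by linarith, by linarith⟩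
  have hvar (d : E × E) : (fderiv ℝ Φ (τ, (z₀, 0)) (0, d)).1 = d.1 + τ • d.2 := by
    have hd (t) (ht : t ∈ Ioo (-ε) ε) : HasDerivAt (fun t ↦ fderiv ℝ Φ (t, (z₀, 0)) (0, d))
        ((fderiv ℝ Φ (t, (z₀, 0)) (0, d)).2, 0) t := by
      refine (hasDerivAt_fderiv_flow (q := (t, (z₀, 0))) (hΦ (t, (z₀, 0)) ⟨ht, hb⟩).1
        ((contDiffAt_geodesicField (hΦ (t, (z₀, 0)) ⟨ht, hb⟩).2.2.1).differentiableAt (by simp))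
        ((hbox.eventually_mem ⟨ht, hb⟩).mono fun p hp ↦ (hΦ p hp).2.1) d).congr_deriv ?_
      rw [← hconst _ hb t ht]
      exact fderiv_geodesicField_zero hΓ _
    have hinit : fderiv ℝ Φ (0, (z₀, 0)) (0, d) = d := by
      have h1 : HasFDerivAt (fun w ↦ Φ (0, w)) (fderiv ℝ Φ (0, (z₀, 0)) ∘L .inr ℝ ℝ (E × E)) (z₀, 0) :=
        ((hΦ (0, (z₀, 0)) ⟨h0J, hb⟩).1.differentiableAt (by simp)).hasFDerivAt.comp _
          (hasFDerivAt_prodMk_right (0 : ℝ) _)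
      have h3 := h1.unique ((hasFDerivAt_id _).congr_of_eventuallyEq
        ((isOpen_ball.eventually_mem hb).mono fun w hw ↦ hΦ0 w hw))
      simpa using congrArg (fun L : E × E →L[ℝ] E × E ↦ L d) h3
    have hdu : ∀ t ∈ Ioo (-ε) ε, (fderiv ℝ Φ (t, (z₀, 0)) (0, d)).2 = d.2 :=
      eqOn_of_hasDerivAt_same (f := fun t ↦ (fderiv ℝ Φ (t, (z₀, 0)) (0, d)).2) (g := fun _ ↦ d.2)
        (f' := fun _ ↦ 0) isOpen_Ioo isPreconnected_Ioo (fun t ht ↦ hasDerivAt_snd (hd t ht))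
        (fun t _ ↦ hasDerivAt_const t _) h0J (by simp only [hinit])
    refine eqOn_of_hasDerivAt_same (f := fun t ↦ (fderiv ℝ Φ (t, (z₀, 0)) (0, d)).1)
      (g := fun t ↦ d.1 + t • d.2) (f' := fun _ ↦ d.2) isOpen_Ioo isPreconnected_Ioo
      (fun t ht ↦ (hasDerivAt_fst (hd t ht)).congr_deriv (hdu t ht))
      (fun t _ ↦ (((hasDerivAt_id t).smul_const d.2).const_add _).congr_deriv (one_smul _ _)) h0J
      (by simp only [hinit, zero_smul, add_zero]) τ hτJ
  -- `H` sends initial position and velocity to the pair of end points. By `hvar` its differential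
  -- at `(z₀, 0)` is block triangular with invertible diagonal, so it can be inverted locally.
  let H : E × E → E × E := fun q ↦ (q.1, (Φ (τ, q)).1)
  have hH : ContDiffAt ℝ ω H (z₀, 0) :=
    contDiffAt_fst.prodMk (ContDiffAt.comp (z₀, (0 : E)) (g := Φ) (f := fun v ↦ (τ, v))
      (hΦ (τ, (z₀, 0)) ⟨hτJ, hb⟩).1 (contDiffAt_const.prodMk contDiffAt_id)).fst
  let A : (E × E) ≃L[ℝ] E × E := ContinuousLinearEquiv.equivOfInverse
    ((ContinuousLinearMap.fst ℝ E E).prod (.fst ℝ E E + τ • .snd ℝ E E))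
    ((ContinuousLinearMap.fst ℝ E E).prod (τ⁻¹ • (.snd ℝ E E - .fst ℝ E E)))
    (fun q ↦ by ext <;> simp [hτ.ne']) (fun q ↦ by ext <;> simp [hτ.ne'])
  have hHd : HasFDerivAt H (A : E × E →L[ℝ] E × E) (z₀, 0) := by
    have h1 : HasFDerivAt (fun w ↦ Φ (τ, w)) (fderiv ℝ Φ (τ, (z₀, 0)) ∘L .inr ℝ ℝ (E × E)) (z₀, 0) :=
      ((hΦ (τ, (z₀, 0)) ⟨hτJ, hb⟩).1.differentiableAt (by simp)).hasFDerivAt.comp _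
        (hasFDerivAt_prodMk_right τ _)
    refine (hasFDerivAt_fst.prodMk h1.fst).congr_fderiv ?_
    refine ContinuousLinearMap.ext fun d ↦ Prod.ext rfl (hvar d)
  have hH0 : H (z₀, 0) = (z₀, z₀) := by simp only [H, ← hconst z₀ hb τ hτJ]
  let I := hH.localInverse hHd (by simp)
  have hI : ContDiffAt ℝ ω I (z₀, z₀) := by simpa [hH0] using hH.to_localInverse hHd (by simp)
  have hI0 : I (z₀, z₀) = (z₀, 0) := by
    simpa [hH0] using hH.localInverse_apply_image hHd (by simp)
  have hHI : ∀ᶠ q in 𝓝 (z₀, z₀), H (I q) = q := by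
    have h := (hH.hasStrictFDerivAt' hHd (by simp)).eventually_right_inverse
    simp only [hH0] at h
    exact h
  have hIH : ∀ᶠ q in 𝓝 (z₀, 0), I (H q) = q :=
    (hH.hasStrictFDerivAt' hHd (by simp)).eventually_left_inverse
  have hIb : ∀ᶠ q in 𝓝 (z₀, z₀), I q ∈ ball (z₀, (0 : E)) ε :=
    hI.continuousAt.eventually_mem (by simpa [hI0] using ball_mem_nhds (z₀, (0 : E)) hε)
  have hdiag : ∀ᶠ x in 𝓝 z₀, (x, 0) ∈ ball (z₀, (0 : E)) ε ∧ I (x, x) = (x, 0) := by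
    have h1 : Tendsto (fun x : E ↦ (x, (0 : E))) (𝓝 z₀) (𝓝 (z₀, 0)) :=
      (Continuous.prodMk_left (0 : E)).tendsto z₀
    filter_upwards [h1.eventually hIH, h1.eventually (isOpen_ball.eventually_mem hb)] with x h2 h3
    refine ⟨h3, ?_⟩
    rwa [show H (x, 0) = (x, x) by simp only [H, ← hconst x h3 τ hτJ]] at h2
  obtain ⟨r₁, hr₁, h1⟩ := Metric.eventually_nhds_iff_ball.1
    (hdiag.and hD)
  obtain ⟨r₂, hr₂, h2⟩ := Metric.eventually_nhds_iff_ball.1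
    (hHI.and (hIb.and (hI.eventually (by simp))))
  have hτt {t : ℝ} (ht : t ∈ Ioo (-2 : ℝ) 2) : τ * t ∈ Ioo (-ε) ε :=
    ⟨by nlinarith [ht.1], by nlinarith [ht.2]⟩
  refine ⟨min r₁ r₂, lt_min hr₁ hr₂, fun q ↦ τ • (I q).2,
    fun p ↦ ((Φ (τ * p.1, I p.2)).1, τ • (Φ (τ * p.1, I p.2)).2),
    fun x hx ↦ (h1 x (ball_subset_ball (min_le_left _ _) hx)).2, fun x hx t ht ↦ ?_,
    fun q hq ↦ ?_⟩
  · obtain ⟨⟨h3, h4⟩, -⟩ := h1 x (ball_subset_ball (min_le_left _ _) hx)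
    simp only [h4, ← hconst x h3 _ (hτt ht), smul_zero]
  · obtain ⟨h3, h4, h5⟩ := h2 q (by
      rw [← ball_prod_same]
      exact ⟨ball_subset_ball (min_le_right _ _) hq.1, ball_subset_ball (min_le_right _ _) hq.2⟩)
    refine ⟨h5.snd.const_smul τ, ?_, ?_, fun t ht ↦ ?_⟩
    · simp only [mul_zero, hΦ0 _ h4]
      have h6 : (H (I q)).1 = q.1 := congrArg Prod.fst h3
      rw [show (I q).1 = q.1 from h6]
    · simp only [mul_one]
      have h6 : (H (I q)).2 = q.2 := congrArg Prod.snd h3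
      exact h6
    · obtain ⟨h6, h7, h8, h9⟩ := hΦ (τ * t, I q) ⟨hτt ht, h4⟩
      have h10 : ContDiffAt ℝ ω (fun p : ℝ × (E × E) ↦ Φ (τ * p.1, I p.2)) (t, q) := by
        refine ContDiffAt.comp (t, q) (g := Φ) (f := fun p : ℝ × (E × E) ↦ (τ * p.1, I p.2)) h6 ?_
        exact (contDiffAt_const.mul contDiffAt_fst).prodMk
          (ContDiffAt.comp (t, q) (g := I) h5 contDiffAt_snd)
      refine ⟨h10.fst.prodMk (h10.snd.const_smul τ), ?_, h8, h9⟩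
      have h11 : HasDerivAt (fun s ↦ Φ (τ * s, I q)) (τ • geodesicField Γ (Φ (τ * t, I q))) t := by
        have := HasDerivAt.scomp (h := fun s ↦ τ * s) t h7 ((hasDerivAt_id t).const_mul τ)
        rwa [mul_one] at this
      refine ((hasDerivAt_fst h11).prodMk ((hasDerivAt_snd h11).const_smul τ)).congr_deriv ?_
      simp [geodesicField]

end ChartGeodesics

/-! ### Functions, tangent vectors and vector fields in the preferred charts. -/

section Charts
open Set Filter
set_option maxSynthPendingDepth 3
set_option linter.unusedSectionVars false

variable {E : Type*} [NormedAddCommGroup E] [NormedSpace ℝ E]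
  {M : Type*} [TopologicalSpace M] [ChartedSpace E M] [IsManifold 𝓘(ℝ, E) ω M]
  {V : Type*} [NormedAddCommGroup V] [NormedSpace ℝ V]

/-- Coordinates of tangent vectors at `x` in the preferred chart at `q`. -/
def toChart (q x : M) : TangentSpace 𝓘(ℝ, E) x →L[ℝ] E :=
  (trivializationAt E (TangentSpace 𝓘(ℝ, E) : M → Type _) q).continuousLinearMapAt ℝ x

/-- The tangent vector at `x` with given coordinates in the preferred chart at `q`. -/
def ofChart (q x : M) : E →L[ℝ] TangentSpace 𝓘(ℝ, E) x :=
  (trivializationAt E (TangentSpace 𝓘(ℝ, E) : M → Type _) q).symmL ℝ x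

/-- The vector field with constant coordinates in the preferred chart at `q`. -/
def constField (q : M) (a : E) (x : M) : TangentSpace 𝓘(ℝ, E) x := ofChart q x a

/-- The coordinates of a vector field as a function on the range of the chart. -/
def chartField (q : M) (X : Π x : M, TangentSpace 𝓘(ℝ, E) x) (z : E) : E :=
  toChart q ((extChartAt 𝓘(ℝ, E) q).symm z) (X ((extChartAt 𝓘(ℝ, E) q).symm z))

variable {q x : M}

lemma toChart_ofChart (hx : x ∈ (chartAt E q).source) (a : E) : toChart q x (ofChart q x a) = a :=
  Trivialization.continuousLinearMapAt_symmL _ (by simpa using hx) a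

lemma ofChart_toChart (hx : x ∈ (chartAt E q).source) (v : TangentSpace 𝓘(ℝ, E) x) :
    ofChart q x (toChart q x v) = v :=
  Trivialization.symmL_continuousLinearMapAt _ (by simpa using hx) v

lemma trivializationAt_snd (hx : x ∈ (chartAt E q).source) (v : TangentSpace 𝓘(ℝ, E) x) :
    (trivializationAt E (TangentSpace 𝓘(ℝ, E) : M → Type _) q ⟨x, v⟩).2 = toChart q x v := by
  rw [toChart, Trivialization.continuousLinearMapAt_apply,
    Trivialization.coe_linearMapAt_of_mem _ (by simpa using hx)]

lemma toChart_injective (hx : x ∈ (chartAt E q).source) : Function.Injective (toChart (E := E) q x) :=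
  fun v w h ↦ by rw [← ofChart_toChart hx v, h, ofChart_toChart hx]

/-- This concerns the chart at `x` itself; in the chart at another point the extension generally has
nonconstant coordinates. -/
lemma extend_eq_constField (v : TangentSpace 𝓘(ℝ, E) x) {y : M} (hy : y ∈ (chartAt E x).source) :
    FiberBundle.extend E (x := x) v y = constField x (toChart x x v) y := by
  rw [← trivializationAt_snd (mem_chart_source E x)]
  exact (Trivialization.symmL_apply _ (by simpa using hy) _).symm

lemma toChart_eq_mfderiv (hx : x ∈ (chartAt E q).source) :
    toChart q x = mfderiv 𝓘(ℝ, E) 𝓘(ℝ, E) (extChartAt 𝓘(ℝ, E) q) x :=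
  TangentBundle.continuousLinearMapAt_trivializationAt hx

lemma chart_symm_apply (hx : x ∈ (chartAt E q).source) :
    (extChartAt 𝓘(ℝ, E) q).symm (extChartAt 𝓘(ℝ, E) q x) = x :=
  (extChartAt 𝓘(ℝ, E) q).left_inv (by simpa using hx)

lemma eventually_chart_symm_mem (hx : x ∈ (chartAt E q).source) :
    ∀ᶠ z in 𝓝 (extChartAt 𝓘(ℝ, E) q x), z ∈ (extChartAt 𝓘(ℝ, E) q).target :=
  (isOpen_extChartAt_target q).mem_nhds ((extChartAt 𝓘(ℝ, E) q).map_source (by simpa using hx))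

lemma tendsto_chart_symm (hx : x ∈ (chartAt E q).source) :
    Tendsto (extChartAt 𝓘(ℝ, E) q).symm (𝓝 (extChartAt 𝓘(ℝ, E) q x)) (𝓝 x) := by
  have := continuousAt_extChartAt_symm' (I := 𝓘(ℝ, E)) (x := q) (x' := x) (by simpa using hx)
  simpa only [ContinuousAt, chart_symm_apply hx] using this

lemma contMDiffAt_iff_chart {n : WithTop ℕ∞} {g : M → V} (hx : x ∈ (chartAt E q).source) :
    ContMDiffAt 𝓘(ℝ, E) 𝓘(ℝ, V) n g x ↔
      ContDiffAt ℝ n (g ∘ (extChartAt 𝓘(ℝ, E) q).symm) (extChartAt 𝓘(ℝ, E) q x) := by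
  have : IsManifold 𝓘(ℝ, E) n M := .of_le (n := ω) le_top
  rw [contMDiffAt_iff_source_of_mem_source hx, ← contMDiffAt_iff_contDiffAt]
  simp [contMDiffWithinAt_univ]

lemma mfderiv_eq_fderiv_chart {g : M → V} (hx : x ∈ (chartAt E q).source)
    (hg : ContMDiffAt 𝓘(ℝ, E) 𝓘(ℝ, V) 1 g x) (v : TangentSpace 𝓘(ℝ, E) x) :
    mfderiv 𝓘(ℝ, E) 𝓘(ℝ, V) g x v =
      fderiv ℝ (g ∘ (extChartAt 𝓘(ℝ, E) q).symm) (extChartAt 𝓘(ℝ, E) q x) (toChart q x v) := by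
  have h1 := ((contMDiffAt_iff_chart hx).1 hg).differentiableAt (by simp)
  have h2 : HasMFDerivAt 𝓘(ℝ, E) 𝓘(ℝ, E) (extChartAt 𝓘(ℝ, E) q) x (toChart q x) := by
    rw [toChart_eq_mfderiv hx]
    exact (mdifferentiableAt_extChartAt hx).hasMFDerivAt
  have h3 := HasMFDerivAt.comp x h1.hasFDerivAt.hasMFDerivAt h2
  have h4 : g =ᶠ[𝓝 x] (g ∘ (extChartAt 𝓘(ℝ, E) q).symm) ∘ extChartAt 𝓘(ℝ, E) q := by
    filter_upwards [(chartAt E q).open_source.mem_nhds hx] with y hy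
    simp only [Function.comp_apply, chart_symm_apply hy]
  rw [(h3.congr_of_eventuallyEq h4).mfderiv]
  rfl

lemma eventually_mem_source (hx : x ∈ (chartAt E q).source) :
    ∀ᶠ y in 𝓝 x, y ∈ (chartAt E q).source := (chartAt E q).open_source.mem_nhds hx

lemma contMDiffAt_field_iff {n : WithTop ℕ∞} {X : Π x : M, TangentSpace 𝓘(ℝ, E) x}
    (hx : x ∈ (chartAt E q).source) :
    ContMDiffAt 𝓘(ℝ, E) 𝓘(ℝ, E).tangent n (fun x ↦ (⟨x, X x⟩ : TangentBundle 𝓘(ℝ, E) M)) x ↔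
      ContDiffAt ℝ n (chartField q X) (extChartAt 𝓘(ℝ, E) q x) := by
  have : IsManifold 𝓘(ℝ, E) n M := .of_le (n := ω) le_top
  have : IsManifold 𝓘(ℝ, E) (n + 1) M := .of_le (n := ω) le_top
  rw [(trivializationAt E (TangentSpace 𝓘(ℝ, E) : M → Type _) q).contMDiffAt_section_iff
    (IB := 𝓘(ℝ, E)) (s := X) (by simpa using hx), contMDiffAt_iff_chart hx]
  have h : (fun z ↦ (trivializationAt E (TangentSpace 𝓘(ℝ, E) : M → Type _) q ⟨z, X z⟩).2) ∘
      (extChartAt 𝓘(ℝ, E) q).symm =ᶠ[𝓝 (extChartAt 𝓘(ℝ, E) q x)] chartField q X := ?_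
  · exact ⟨fun h' ↦ h'.congr_of_eventuallyEq h.symm, fun h' ↦ h'.congr_of_eventuallyEq h⟩
  filter_upwards [(tendsto_chart_symm hx).eventually (eventually_mem_source hx)] with z hz
  exact trivializationAt_snd hz _

lemma chartField_apply {X : Π x : M, TangentSpace 𝓘(ℝ, E) x}
    (hx : x ∈ (chartAt E q).source) :
    chartField q X (extChartAt 𝓘(ℝ, E) q x) = toChart q x (X x) := by
  have h := chart_symm_apply hx
  unfold chartField
  -- The base point occurs in the types, so its equality with `x` is eliminated by substitution
  -- instead of rewriting.
  generalize (extChartAt 𝓘(ℝ, E) q).symm (extChartAt 𝓘(ℝ, E) q x) = y at h ⊢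
  subst h
  rfl

lemma chartField_constField (a : E) :
    EqOn (chartField q (constField q a)) (fun _ ↦ a) (extChartAt 𝓘(ℝ, E) q).target := fun z hz ↦
  toChart_ofChart (by simpa using (extChartAt 𝓘(ℝ, E) q).map_target hz) a

lemma contMDiffAt_constField {n : WithTop ℕ∞} (hx : x ∈ (chartAt E q).source) (a : E) :
    ContMDiffAt 𝓘(ℝ, E) 𝓘(ℝ, E).tangent n
      (fun x ↦ (⟨x, constField q a x⟩ : TangentBundle 𝓘(ℝ, E) M)) x := by
  rw [contMDiffAt_field_iff hx]
  refine (contDiffAt_const (c := a)).congr_of_eventuallyEq ?_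
  filter_upwards [eventually_chart_symm_mem hx] with z hz using chartField_constField a hz

end Charts

/-! ### Christoffel symbols and the coordinate formula for the covariant derivative. -/

section Christoffel
open Set Filter
set_option maxSynthPendingDepth 3
set_option linter.unusedSectionVars false

variable {E : Type*} [NormedAddCommGroup E] [NormedSpace ℝ E] [FiniteDimensional ℝ E]
  {M : Type*} [TopologicalSpace M] [ChartedSpace E M] [IsManifold 𝓘(ℝ, E) ω M]

/-- The covariant derivative of a constant field in a chart. -/
def frameDerivative (nabla : Connection E M) (q : M) (a z : E) : E →L[ℝ] E :=
  toChart q ((extChartAt 𝓘(ℝ, E) q).symm z) ∘L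
    nabla (constField q a) ((extChartAt 𝓘(ℝ, E) q).symm z) ∘L
      ofChart q ((extChartAt 𝓘(ℝ, E) q).symm z)

/-- The Christoffel symbols in the preferred chart at `q`: `christoffel nabla q z u a` are the
coordinates of the covariant derivative in direction `u` of the field with constant coordinates
`a`. -/
def christoffel (nabla : Connection E M) (q : M) (z : E) : E →L[ℝ] E →L[ℝ] E :=
  ∑ i, ContinuousLinearMap.smulRightL ℝ E E
      ((Module.finBasis ℝ E).coord i).toContinuousLinearMap ∘L
    frameDerivative nabla q (Module.finBasis ℝ E i) z

lemma christoffel_apply (nabla : Connection E M) (q : M) (z u a : E) :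
    christoffel nabla q z u a = ∑ i, (Module.finBasis ℝ E).coord i a •
      frameDerivative nabla q (Module.finBasis ℝ E i) z u := by
  simp [christoffel]

/-- Coordinate frame fields are analytic on the chart domain, so the hypothesis on this open set
makes their covariant derivatives analytic. In the trivialization of the Hom bundle at `q` these are
the frame derivatives. -/
lemma contDiffAt_christoffel {nabla : Connection E M} (h : IsAnalyticConnection nabla) {q : M} {z : E}
    (hz : z ∈ (extChartAt 𝓘(ℝ, E) q).target) : ContDiffAt ℝ ω (christoffel nabla q) z := by
  have key (a : E) : ContDiffAt ℝ ω (frameDerivative nabla q a) z := by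
    have h1 : ContMDiffOn 𝓘(ℝ, E) 𝓘(ℝ, E).tangent (ω + 1)
        (fun x ↦ (⟨x, constField q a x⟩ : TangentBundle 𝓘(ℝ, E) M)) (chartAt E q).source :=
      fun x hx ↦ (contMDiffAt_constField hx a).contMDiffWithinAt
    have h2 := (h _ (chartAt E q).open_source).contMDiff h1
    have hx : (extChartAt 𝓘(ℝ, E) q).symm z ∈ (chartAt E q).source := by
      simpa using (extChartAt 𝓘(ℝ, E) q).map_target hz
    have h3 := h2.contMDiffAt ((chartAt E q).open_source.mem_nhds hx)
    rw [(trivializationAt (E →L[ℝ] E) (fun x : M ↦ TangentSpace 𝓘(ℝ, E) x →L[ℝ] TangentSpace 𝓘(ℝ, E) x)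
      q).contMDiffAt_section_iff (IB := 𝓘(ℝ, E)) (s := fun x ↦ nabla (constField q a) x)
      (by simpa using hx), contMDiffAt_iff_chart hx, (extChartAt 𝓘(ℝ, E) q).right_inv hz] at h3
    exact h3
  unfold christoffel
  exact ContDiffAt.sum fun i _ ↦ contDiffAt_const.clm_comp (key _)

variable {q x : M}

lemma nabla_congr (nabla : Connection E M) {X Y : Π x : M, TangentSpace 𝓘(ℝ, E) x}
    (hx : x ∈ (chartAt E q).source)
    (hX : ContDiffAt ℝ 1 (chartField q X) (extChartAt 𝓘(ℝ, E) q x))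
    (h : ∀ᶠ y in 𝓝 x, X y = Y y) : nabla X x = nabla Y x := by
  have h1 := (contMDiffAt_field_iff hx).2 hX
  refine nabla.isCovariantDerivativeOnUniv.congr_of_eventuallyEq (h1.mdifferentiableAt (by simp))
    ((h1.congr_of_eventuallyEq ?_).mdifferentiableAt (by simp)) univ_mem h
  filter_upwards [h] with y hy
  rw [hy]

/-- Regularity of the partial sums is part of the induction, since additivity of the connection is
available for differentiable sections only. -/
lemma nabla_sum_smul_constField (nabla : Connection E M) (hx : x ∈ (chartAt E q).source)
    {ι : Type*} (s : Finset ι) (g : ι → M → ℝ) (a : ι → E)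
    (hg : ∀ i ∈ s, ContMDiffAt 𝓘(ℝ, E) 𝓘(ℝ, ℝ) 1 (g i) x) :
    ContMDiffAt 𝓘(ℝ, E) 𝓘(ℝ, E).tangent 1
      (fun y ↦ (⟨y, (∑ i ∈ s, g i • constField q (a i)) y⟩ : TangentBundle 𝓘(ℝ, E) M)) x ∧
    nabla (∑ i ∈ s, g i • constField q (a i)) x = ∑ i ∈ s, (g i x • nabla (constField q (a i)) x
      + (mvfderiv 𝓘(ℝ, E) (g i) x).smulRight (constField q (a i) x)) := by
  classical
  have : IsManifold 𝓘(ℝ, E) 2 M := .of_le (n := ω) le_top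
  induction s using Finset.induction_on with
  | empty =>
    simp only [Finset.sum_empty]
    exact ⟨contMDiffAt_zeroSection _ _, nabla.isCovariantDerivativeOnUniv.zero⟩
  | insert i s hi ih =>
    obtain ⟨h1, h2⟩ := ih fun j hj ↦ hg j (Finset.mem_insert_of_mem hj)
    have h3 := contMDiffAt_constField (n := 1) hx (a i)
    have h4 : ContMDiffAt 𝓘(ℝ, E) 𝓘(ℝ, E).tangent 1
      (fun y ↦ (⟨y, (g i • constField q (a i)) y⟩ : TangentBundle 𝓘(ℝ, E) M)) x :=
      (hg i (Finset.mem_insert_self i s)).smul_section h3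
    rw [Finset.sum_insert hi, Finset.sum_insert hi, ← h2]
    refine ⟨h4.add_section h1, ?_⟩
    rw [nabla.isCovariantDerivativeOnUniv.add (h4.mdifferentiableAt (by simp))
      (h1.mdifferentiableAt (by simp)), nabla.isCovariantDerivativeOnUniv.leibniz
        (h3.mdifferentiableAt (by simp)) ((hg i (Finset.mem_insert_self i s)).mdifferentiableAt
          (by simp))]

/-- The covariant derivative in coordinates. -/
theorem toChart_nabla (nabla : Connection E M) {X : Π x : M, TangentSpace 𝓘(ℝ, E) x}
    (hx : x ∈ (chartAt E q).source)
    (hX : ContDiffAt ℝ 1 (chartField q X) (extChartAt 𝓘(ℝ, E) q x)) (v : TangentSpace 𝓘(ℝ, E) x) :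
    toChart q x (nabla X x v) = fderiv ℝ (chartField q X) (extChartAt 𝓘(ℝ, E) q x) (toChart q x v)
      + christoffel nabla q (extChartAt 𝓘(ℝ, E) q x) (toChart q x v)
        (chartField q X (extChartAt 𝓘(ℝ, E) q x)) := by
  let b := Module.finBasis ℝ E
  let g : Fin (Module.finrank ℝ E) → M → ℝ := fun i y ↦ b.coord i (toChart q y (X y))
  have hgc (i) : g i ∘ (extChartAt 𝓘(ℝ, E) q).symm
      = fun z ↦ (b.coord i).toContinuousLinearMap (chartField q X z) := rfl
  have hg (i) : ContMDiffAt 𝓘(ℝ, E) 𝓘(ℝ, ℝ) 1 (g i) x := by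
    rw [contMDiffAt_iff_chart hx, hgc]
    exact (b.coord i).toContinuousLinearMap.contDiff.contDiffAt.comp _ hX
  -- Expansion in the coordinate frame; locality and the Leibniz rule then reduce the claim to the
  -- frame fields.
  have hXsum : ∀ᶠ y in 𝓝 x, X y = (∑ i, g i • constField q (b i)) y := by
    filter_upwards [eventually_mem_source hx] with y hy
    refine toChart_injective hy ?_
    simp only [Finset.sum_apply, Pi.smul_apply', map_sum, map_smul, constField, toChart_ofChart hy]
    exact (b.sum_repr _).symm
  have hXx := chartField_apply (X := X) hx
  rw [nabla_congr nabla hx hX hXsum, (nabla_sum_smul_constField nabla hx _ g b fun i _ ↦ hg i).2]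
  have hd (i) : mvfderiv 𝓘(ℝ, E) (g i) x v
      = b.coord i (fderiv ℝ (chartField q X) (extChartAt 𝓘(ℝ, E) q x) (toChart q x v)) := by
    refine (mfderiv_eq_fderiv_chart hx (hg i) v).trans ?_
    exact congrArg (fun L : E →L[ℝ] ℝ ↦ L (toChart q x v))
      ((b.coord i).toContinuousLinearMap.hasFDerivAt.comp _
        (hX.differentiableAt (by simp)).hasFDerivAt).fderiv
  have hA (i) : frameDerivative nabla q (b i) (extChartAt 𝓘(ℝ, E) q x) (toChart q x v)
      = toChart q x (nabla (constField q (b i)) x v) := by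
    have h := chart_symm_apply hx
    unfold frameDerivative
    generalize (extChartAt 𝓘(ℝ, E) q).symm (extChartAt 𝓘(ℝ, E) q x) = y at h ⊢
    subst h
    simp only [ContinuousLinearMap.comp_apply, ofChart_toChart hx]
  rw [christoffel_apply, hXx]
  simp only [sum_apply, add_apply, map_sum, map_add,
    smul_apply, ContinuousLinearMap.smulRight_apply, map_smul, hd, constField,
    toChart_ofChart hx, Finset.sum_add_distrib]
  rw [add_comm]
  congr 1
  · exact b.sum_repr _
  · exact Finset.sum_congr rfl fun i _ ↦ congrArg _ (hA i).symm

end Christoffel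

/-! ### Maps between manifolds and the pull-back connection in coordinates. -/

section Along
open Set Filter
set_option maxSynthPendingDepth 3
set_option linter.unusedSectionVars false

variable {E : Type*} [NormedAddCommGroup E] [NormedSpace ℝ E]
  {P : Type*} [TopologicalSpace P] [ChartedSpace E P] [IsManifold 𝓘(ℝ, E) ω P]
  {F : Type*} [NormedAddCommGroup F] [NormedSpace ℝ F]
  {N : Type*} [TopologicalSpace N] [ChartedSpace F N] [IsManifold 𝓘(ℝ, F) ω N]

/-- A map in the preferred charts at `q` and `p`. -/
def chartMap (q : P) (p : N) (f : P → N) (z : E) : F :=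
  extChartAt 𝓘(ℝ, F) p (f ((extChartAt 𝓘(ℝ, E) q).symm z))

variable {q x : P} {p : N} {f : P → N}

lemma chartMap_apply (hx : x ∈ (chartAt E q).source) :
    chartMap q p f (extChartAt 𝓘(ℝ, E) q x) = extChartAt 𝓘(ℝ, F) p (f x) := by
  rw [chartMap, chart_symm_apply hx]

lemma contMDiffAt_iff_chartMap {n : WithTop ℕ∞} (hx : x ∈ (chartAt E q).source)
    (hfx : f x ∈ (chartAt F p).source) :
    ContMDiffAt 𝓘(ℝ, E) 𝓘(ℝ, F) n f x ↔ ContinuousAt f x ∧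
      ContDiffAt ℝ n (chartMap (F := F) q p f) (extChartAt 𝓘(ℝ, E) q x) := by
  have : IsManifold 𝓘(ℝ, F) n N := .of_le (n := ω) le_top
  rw [contMDiffAt_iff_target_of_mem_source hfx, contMDiffAt_iff_chart hx]
  rfl

lemma toChart_mfderiv (hx : x ∈ (chartAt E q).source) (hfx : f x ∈ (chartAt F p).source)
    (hf : ContMDiffAt 𝓘(ℝ, E) 𝓘(ℝ, F) 1 f x) (v : TangentSpace 𝓘(ℝ, E) x) :
    toChart p (f x) (mfderiv 𝓘(ℝ, E) 𝓘(ℝ, F) f x v)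
      = fderiv ℝ (chartMap q p f) (extChartAt 𝓘(ℝ, E) q x) (toChart q x v) := by
  have : IsManifold 𝓘(ℝ, F) 1 N := .of_le (n := ω) le_top
  have h1 : ContMDiffAt 𝓘(ℝ, E) 𝓘(ℝ, F) 1 (extChartAt 𝓘(ℝ, F) p ∘ f) x :=
    ((contMDiffAt_iff_target_of_mem_source hfx).1 hf).2
  refine Eq.trans ?_ (mfderiv_eq_fderiv_chart hx h1 v)
  rw [toChart_eq_mfderiv hfx, mfderiv_comp x (mdifferentiableAt_extChartAt hfx)
    (hf.mdifferentiableAt (by simp))]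
  rfl

/-- The change of coordinates of tangent vectors. -/
def coordChange (p p' n : N) : F →L[ℝ] F := toChart p' n ∘L ofChart p n

lemma coordChange_toChart {p p' n : N} (h : n ∈ (chartAt F p).source)
    (v : TangentSpace 𝓘(ℝ, F) n) : coordChange (F := F) p p' n (toChart p n v) = toChart p' n v := by
  rw [coordChange, ContinuousLinearMap.comp_apply, ofChart_toChart h]

lemma contMDiffAt_coordChange {p p' n : N} (h : n ∈ (chartAt F p).source)
    (h' : n ∈ (chartAt F p').source) :
    ContMDiffAt 𝓘(ℝ, F) 𝓘(ℝ, F →L[ℝ] F) ω (coordChange (F := F) p p') n := by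
  have := contMDiffAt_coordChangeL (IB := 𝓘(ℝ, F)) (n := ω)
    (e := trivializationAt F (TangentSpace 𝓘(ℝ, F) : N → Type _) p)
    (e' := trivializationAt F (TangentSpace 𝓘(ℝ, F) : N → Type _) p')
    (x := n) (by simpa using h) (by simpa using h')
  refine this.congr_of_eventuallyEq ?_
  filter_upwards [eventually_mem_source h, eventually_mem_source h'] with y hy hy'
  ext a
  refine Eq.symm ((Trivialization.coordChangeL_apply _ _ ?_ a).trans ?_)
  · simpa using ⟨hy, hy'⟩
  · refine (trivializationAt_snd hy' _).trans (congrArg (toChart p' y) ?_)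
    exact (Trivialization.symmL_apply _ (by simpa using hy) _).symm

variable [FiniteDimensional ℝ F]

/-- The pull-back connection in coordinates. -/
theorem toChart_covAlong (nabla : Connection F N) {Y : Π y : P, TangentSpace 𝓘(ℝ, F) (f y)}
    (hx : x ∈ (chartAt E q).source) (hfx : f x ∈ (chartAt F p).source)
    (hY : ContMDiffAt 𝓘(ℝ, E) 𝓘(ℝ, F).tangent 1 (fun y ↦ (⟨f y, Y y⟩ : TangentBundle 𝓘(ℝ, F) N)) x)
    (v : TangentSpace 𝓘(ℝ, E) x) :
    toChart p (f x) (covAlong nabla f Y x v) =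
      fderiv ℝ ((fun y ↦ toChart p (f y) (Y y)) ∘ (extChartAt 𝓘(ℝ, E) q).symm)
        (extChartAt 𝓘(ℝ, E) q x) (toChart q x v)
      + christoffel nabla p (extChartAt 𝓘(ℝ, F) p (f x))
        (toChart p (f x) (mfderiv 𝓘(ℝ, E) 𝓘(ℝ, F) f x v)) (toChart p (f x) (Y x)) := by
  have : IsManifold 𝓘(ℝ, F) 2 N := .of_le (n := ω) le_top
  have hff := mem_chart_source F (f x)
  obtain ⟨hf, hYt⟩ := contMDiffAt_totalSpace.1 hY
  have hf' : ContMDiffAt 𝓘(ℝ, E) 𝓘(ℝ, F) 1 f x := hf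
  have hYt' : ContMDiffAt 𝓘(ℝ, E) 𝓘(ℝ, F) 1 (fun y ↦ toChart (f x) (f y) (Y y)) x := by
    refine hYt.congr_of_eventuallyEq ?_
    filter_upwards [hf'.continuousAt.eventually (eventually_mem_source hff)] with y hy
    exact (trivializationAt_snd hy _).symm
  have hC := (contMDiffAt_coordChange hff hfx).of_le (show (1 : WithTop ℕ∞) ≤ ω from le_top)
  have hCψ := ((contMDiffAt_iff_chart hfx).1 hC).differentiableAt (by simp)
  have hfc := (((contMDiffAt_iff_chartMap hx hfx).1 hf').2).differentiableAt (by simp)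
  have hYc := ((contMDiffAt_iff_chart hx).1 hYt').differentiableAt (by simp)
  rw [← chartMap_apply (q := q) hx] at hCψ
  -- `covAlong` uses the chart at `f x`, while the formula uses the chart at `p`. The derivative of
  -- the coordinate change occurs on both sides: here through the components of `Y`, and in `h8`
  -- through the extension of `Y x`, which is not constant in the chart at `p`.
  have h1 := (hCψ.hasFDerivAt.comp (extChartAt 𝓘(ℝ, E) q x) hfc.hasFDerivAt).clm_apply
    hYc.hasFDerivAt
  have h2 : ((fun y ↦ toChart p (f y) (Y y)) ∘ (extChartAt 𝓘(ℝ, E) q).symm)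
      =ᶠ[𝓝 (extChartAt 𝓘(ℝ, E) q x)] fun z ↦
        ((coordChange (f x) p ∘ (extChartAt 𝓘(ℝ, F) p).symm) ∘ chartMap q p f) z
          (((fun y ↦ toChart (f x) (f y) (Y y)) ∘ (extChartAt 𝓘(ℝ, E) q).symm) z) := by
    have h3 := (tendsto_chart_symm hx).eventually
      (hf'.continuousAt.eventually ((eventually_mem_source hff).and (eventually_mem_source hfx)))
    filter_upwards [h3] with z hz
    have h4 : (extChartAt 𝓘(ℝ, F) p).symm (chartMap q p f z)
        = f ((extChartAt 𝓘(ℝ, E) q).symm z) := chart_symm_apply hz.2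
    simp only [Function.comp_apply]
    rw [h4]
    exact (coordChange_toChart hz.1 _).symm
  rw [(h1.congr_of_eventuallyEq h2).fderiv]
  have h5 : chartField p (FiberBundle.extend F (x := f x) (Y x)) =ᶠ[𝓝 (extChartAt 𝓘(ℝ, F) p (f x))]
      fun z ↦ (coordChange (f x) p ∘ (extChartAt 𝓘(ℝ, F) p).symm) z (toChart (f x) (f x) (Y x)) := by
    filter_upwards [(tendsto_chart_symm hfx).eventually (eventually_mem_source hff)] with z hz
    simp only [chartField, extend_eq_constField (Y x) hz]
    rfl
  have h6 := (((contMDiffAt_iff_chart hfx).1 hC).clm_apply contDiffAt_const).congr_of_eventuallyEq h5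
  have h7 : FiberBundle.extend F (x := f x) (Y x) (f x) = Y x := FiberBundle.extend_apply_self F _
  have h8 : fderiv ℝ (chartField p (FiberBundle.extend F (x := f x) (Y x)))
      (extChartAt 𝓘(ℝ, F) p (f x)) = (fderiv ℝ (coordChange (f x) p ∘ (extChartAt 𝓘(ℝ, F) p).symm)
        (extChartAt 𝓘(ℝ, F) p (f x))).flip (toChart (f x) (f x) (Y x)) := by
    rw [chartMap_apply hx] at hCψ
    rw [((hCψ.hasFDerivAt.clm_apply (hasFDerivAt_const _ _)).congr_of_eventuallyEq h5).fderiv]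
    ext u
    simp
  have h9 : toChart p (f x) (covAlong nabla f Y x v) =
      coordChange (f x) p (f x) (fderiv ℝ ((fun y ↦ toChart (f x) (f y) (Y y)) ∘
        (extChartAt 𝓘(ℝ, E) q).symm) (extChartAt 𝓘(ℝ, E) q x) (toChart q x v))
      + toChart p (f x) (nabla (FiberBundle.extend F (x := f x) (Y x)) (f x)
        (mfderiv 𝓘(ℝ, E) 𝓘(ℝ, F) f x v)) := by
    rw [← mfderiv_eq_fderiv_chart hx hYt' v]
    have h10 : mvfderiv 𝓘(ℝ, E) (fun y : P ↦ (trivializationAt F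
        (TangentSpace 𝓘(ℝ, F) : N → Type _) (f x) (⟨f y, Y y⟩ : TangentBundle 𝓘(ℝ, F) N)).2) x v
        = mfderiv 𝓘(ℝ, E) 𝓘(ℝ, F) (fun y ↦ toChart (f x) (f y) (Y y)) x v := by
      have h11 : (fun y : P ↦ (trivializationAt F
        (TangentSpace 𝓘(ℝ, F) : N → Type _) (f x) (⟨f y, Y y⟩ : TangentBundle 𝓘(ℝ, F) N)).2)
          =ᶠ[𝓝 x] (fun y ↦ toChart (f x) (f y) (Y y)) := by
        filter_upwards [hf'.continuousAt.eventually (eventually_mem_source hff)] with y hy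
        exact trivializationAt_snd hy _
      change mfderiv 𝓘(ℝ, E) 𝓘(ℝ, F) _ x v = _
      rw [h11.mfderiv_eq]
      rfl
    rw [← h10]
    simp only [covAlong, add_apply, map_add]
    rfl
  rw [h9, toChart_nabla nabla hfx h6, h8, toChart_mfderiv hx hfx hf', chartField_apply hfx, h7]
  have h12 : ((fun y ↦ toChart (f x) (f y) (Y y)) ∘ (extChartAt 𝓘(ℝ, E) q).symm)
      (extChartAt 𝓘(ℝ, E) q x) = toChart (f x) (f x) (Y x) :=
    congrArg (fun y ↦ toChart (f x) (f y) (Y y)) (chart_symm_apply hx)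
  have h13 : ((coordChange (f x) p ∘ (extChartAt 𝓘(ℝ, F) p).symm) ∘ chartMap q p f)
      (extChartAt 𝓘(ℝ, E) q x) = coordChange (F := F) (f x) p (f x) := by
    simp only [Function.comp_apply, chartMap_apply hx, chart_symm_apply hfx]
  rw [h12, h13, chartMap_apply hx]
  simp only [add_apply, ContinuousLinearMap.flip_apply, ContinuousLinearMap.comp_apply]
  abel

lemma contMDiffAt_along_iff {n : WithTop ℕ∞} {Y : Π y : P, TangentSpace 𝓘(ℝ, F) (f y)}
    (hf : ContMDiffAt 𝓘(ℝ, E) 𝓘(ℝ, F) n f x) (hfx : f x ∈ (chartAt F p).source) :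
    ContMDiffAt 𝓘(ℝ, E) 𝓘(ℝ, F).tangent n (fun y ↦ (⟨f y, Y y⟩ : TangentBundle 𝓘(ℝ, F) N)) x ↔
      ContMDiffAt 𝓘(ℝ, E) 𝓘(ℝ, F) n (fun y ↦ toChart p (f y) (Y y)) x := by
  have : IsManifold 𝓘(ℝ, F) (n + 1) N := .of_le (n := ω) le_top
  rw [(trivializationAt F (TangentSpace 𝓘(ℝ, F) : N → Type _) p).contMDiffAt_iff
    (by simpa [Trivialization.mem_source] using hfx)]
  have h : (fun y : P ↦ (trivializationAt F (TangentSpace 𝓘(ℝ, F) : N → Type _) p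
      (⟨f y, Y y⟩ : TangentBundle 𝓘(ℝ, F) N)).2) =ᶠ[𝓝 x] fun y ↦ toChart p (f y) (Y y) := by
    filter_upwards [hf.continuousAt.eventually (eventually_mem_source hfx)] with y hy
    exact trivializationAt_snd hy _
  exact ⟨fun h' ↦ h'.2.congr_of_eventuallyEq h.symm, fun h' ↦ ⟨hf, h'.congr_of_eventuallyEq h⟩⟩

lemma eventually_contMDiffAt {n : WithTop ℕ∞} (hn : n ≠ ∞) {f : P → N}
    (hf : ContMDiffAt 𝓘(ℝ, E) 𝓘(ℝ, F) n f x) :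
    ∀ᶠ y in 𝓝 x, ContMDiffAt 𝓘(ℝ, E) 𝓘(ℝ, F) n f y := by
  have : IsManifold 𝓘(ℝ, E) n P := .of_le (n := ω) le_top
  have : IsManifold 𝓘(ℝ, F) n N := .of_le (n := ω) le_top
  exact (contMDiffAt_iff_contMDiffAt_nhds hn).1 hf

lemma eventuallyEq_toChart_mfderiv (hx : x ∈ (chartAt E q).source)
    (hfx : f x ∈ (chartAt F p).source) (hf : ContMDiffAt 𝓘(ℝ, E) 𝓘(ℝ, F) 1 f x)
    (X : Π x : P, TangentSpace 𝓘(ℝ, E) x) :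
    (fun y ↦ toChart p (f y) (mfderiv 𝓘(ℝ, E) 𝓘(ℝ, F) f y (X y))) ∘ (extChartAt 𝓘(ℝ, E) q).symm
      =ᶠ[𝓝 (extChartAt 𝓘(ℝ, E) q x)] fun z ↦ fderiv ℝ (chartMap q p f) z (chartField q X z) := by
  filter_upwards [eventually_chart_symm_mem hx, (tendsto_chart_symm hx).eventually
    ((eventually_contMDiffAt (by simp) hf).and
      (hf.continuousAt.eventually (eventually_mem_source hfx)))] with z hz h
  have h1 : (extChartAt 𝓘(ℝ, E) q).symm z ∈ (chartAt E q).source := by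
    simpa using (extChartAt 𝓘(ℝ, E) q).map_target hz
  refine (toChart_mfderiv h1 h.2 h.1 _).trans ?_
  rw [(extChartAt 𝓘(ℝ, E) q).right_inv hz]
  rfl

/-- The covariant derivative along `f` of the image of a vector field, in coordinates. -/
theorem toChart_covAlong_mfderiv (nabla : Connection F N) {X : Π x : P, TangentSpace 𝓘(ℝ, E) x}
    (hx : x ∈ (chartAt E q).source) (hfx : f x ∈ (chartAt F p).source)
    (hf : ContMDiffAt 𝓘(ℝ, E) 𝓘(ℝ, F) 2 f x)
    (hX : ContDiffAt ℝ 1 (chartField q X) (extChartAt 𝓘(ℝ, E) q x)) (v : TangentSpace 𝓘(ℝ, E) x) :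
    toChart p (f x) (covAlong nabla f (fun y ↦ mfderiv 𝓘(ℝ, E) 𝓘(ℝ, F) f y (X y)) x v) =
      fderiv ℝ (fderiv ℝ (chartMap q p f)) (extChartAt 𝓘(ℝ, E) q x) (toChart q x v)
        (toChart q x (X x))
      + fderiv ℝ (chartMap q p f) (extChartAt 𝓘(ℝ, E) q x)
        (fderiv ℝ (chartField q X) (extChartAt 𝓘(ℝ, E) q x) (toChart q x v))
      + christoffel nabla p (extChartAt 𝓘(ℝ, F) p (f x))
        (fderiv ℝ (chartMap q p f) (extChartAt 𝓘(ℝ, E) q x) (toChart q x v))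
        (fderiv ℝ (chartMap q p f) (extChartAt 𝓘(ℝ, E) q x) (toChart q x (X x))) := by
  have hf1 : ContMDiffAt 𝓘(ℝ, E) 𝓘(ℝ, F) 1 f x := hf.of_le (by norm_num)
  have heq := eventuallyEq_toChart_mfderiv hx hfx hf1 X
  have hfc := ((contMDiffAt_iff_chartMap hx hfx).1 hf).2
  have hfc' := hfc.fderiv_right (m := 1) (by norm_num)
  have hY : ContMDiffAt 𝓘(ℝ, E) 𝓘(ℝ, F).tangent 1
      (fun y ↦ (⟨f y, mfderiv 𝓘(ℝ, E) 𝓘(ℝ, F) f y (X y)⟩ : TangentBundle 𝓘(ℝ, F) N)) x := by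
    rw [contMDiffAt_along_iff hf1 hfx, contMDiffAt_iff_chart hx]
    exact (hfc'.clm_apply hX).congr_of_eventuallyEq heq
  rw [toChart_covAlong nabla hx hfx hY, toChart_mfderiv hx hfx hf1, toChart_mfderiv hx hfx hf1,
    (((hfc'.differentiableAt (by simp)).hasFDerivAt.clm_apply
      (hX.differentiableAt (by simp)).hasFDerivAt).congr_of_eventuallyEq heq).fderiv]
  simp only [add_apply, ContinuousLinearMap.flip_apply, ContinuousLinearMap.comp_apply,
    chartField_apply hx]
  abel

/-- The curve `γ` in coordinates satisfies the geodesic equation if and only if `∇_{γ'} γ' = 0`. -/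
theorem toChart_covAlong_velocity (nabla : Connection F N) {γ : ℝ → N} {s : ℝ}
    (hs : γ s ∈ (chartAt F p).source) (hγ : ContMDiffAt 𝓘(ℝ, ℝ) 𝓘(ℝ, F) 2 γ s) :
    toChart p (γ s) (covAlong (E := ℝ) nabla γ (fun r ↦ velocity (F := F) γ r) s (1 : ℝ)) =
      deriv (deriv (extChartAt 𝓘(ℝ, F) p ∘ γ)) s
      + christoffel nabla p (extChartAt 𝓘(ℝ, F) p (γ s))
        (deriv (extChartAt 𝓘(ℝ, F) p ∘ γ) s) (deriv (extChartAt 𝓘(ℝ, F) p ∘ γ) s) := by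
  have h1 (r : ℝ) : toChart s r (1 : ℝ) = (1 : ℝ) := by
    simp [toChart]
    rfl
  have h2 : chartField (M := ℝ) s (fun _ ↦ (1 : ℝ)) = fun _ ↦ 1 := funext fun r ↦ h1 _
  have h3 : chartMap s p γ = extChartAt 𝓘(ℝ, F) p ∘ γ := by
    funext r
    simp [chartMap, chartAt_self_eq]
  have hc : ContDiffAt ℝ 2 (extChartAt 𝓘(ℝ, F) p ∘ γ) s := by
    have := ((contMDiffAt_iff_chartMap (q := s) (mem_chart_source ℝ s) hs).1 hγ).2
    rw [h3] at this
    simpa [chartAt_self_eq] using this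
  have h4 : deriv (deriv (extChartAt 𝓘(ℝ, F) p ∘ γ)) s
      = fderiv ℝ (fderiv ℝ (extChartAt 𝓘(ℝ, F) p ∘ γ)) s 1 1 :=
    ((ContinuousLinearMap.apply ℝ F (1 : ℝ)).hasFDerivAt.comp_hasDerivAt s
      ((hc.fderiv_right (m := 1) (by norm_num)).differentiableAt
        (by simp)).hasFDerivAt.hasDerivAt).deriv
  -- The velocity is the image under `γ` of the constant field 1 on the line.
  have := toChart_covAlong_mfderiv (q := s) nabla (X := fun _ ↦ (1 : ℝ)) (mem_chart_source ℝ s) hs hγ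
    (by rw [h2]; exact contDiffAt_const) (1 : ℝ)
  refine this.trans ?_
  rw [h2, h3, h1, h4]
  simp [chartAt_self_eq]

end Along

/-! ### The equation of affine maps in coordinates. -/

section Affine
open Set Filter
set_option maxSynthPendingDepth 3
set_option linter.unusedSectionVars false

variable {E : Type*} [NormedAddCommGroup E] [NormedSpace ℝ E] [FiniteDimensional ℝ E]
  {M : Type*} [TopologicalSpace M] [ChartedSpace E M] [IsManifold 𝓘(ℝ, E) ω M]
  {F : Type*} [NormedAddCommGroup F] [NormedSpace ℝ F] [FiniteDimensional ℝ F]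
  {N : Type*} [TopologicalSpace N] [ChartedSpace F N] [IsManifold 𝓘(ℝ, F) ω N]

/-- `f` is smooth and satisfies the equation of affine maps at `x`. -/
def IsAffineAt (nablaM : Connection E M) (nablaN : Connection F N) (f : M → N) (x : M) : Prop :=
  ContMDiffAt 𝓘(ℝ, E) 𝓘(ℝ, F) ∞ f x ∧
    ∀ (v : TangentSpace 𝓘(ℝ, E) x) (X : Π x : M, TangentSpace 𝓘(ℝ, E) x),
      ContMDiffAt 𝓘(ℝ, E) 𝓘(ℝ, E).tangent ∞ (fun x ↦ (⟨x, X x⟩ : TangentBundle 𝓘(ℝ, E) M)) x →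
      mfderiv 𝓘(ℝ, E) 𝓘(ℝ, F) f x (nablaM X x v) =
        covAlong nablaN f (fun y ↦ mfderiv 𝓘(ℝ, E) 𝓘(ℝ, F) f y (X y)) x v

variable {nablaM : Connection E M} {nablaN : Connection F N} {f g : M → N} {x q : M} {p : N}

/-- Both sides contain `Df (DX v)`. After cancelling it, only the values of `v` and `X` at `x`
remain, so the condition is tensorial. -/
lemma affine_equation_iff (hx : x ∈ (chartAt E q).source)
    (hfx : f x ∈ (chartAt F p).source) (hf : ContMDiffAt 𝓘(ℝ, E) 𝓘(ℝ, F) ∞ f x)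
    {X : Π x : M, TangentSpace 𝓘(ℝ, E) x}
    (hX : ContMDiffAt 𝓘(ℝ, E) 𝓘(ℝ, E).tangent ∞ (fun x ↦ (⟨x, X x⟩ : TangentBundle 𝓘(ℝ, E) M)) x)
    (v : TangentSpace 𝓘(ℝ, E) x) :
    mfderiv 𝓘(ℝ, E) 𝓘(ℝ, F) f x (nablaM X x v) =
        covAlong nablaN f (fun y ↦ mfderiv 𝓘(ℝ, E) 𝓘(ℝ, F) f y (X y)) x v ↔
    fderiv ℝ (fderiv ℝ (chartMap q p f)) (extChartAt 𝓘(ℝ, E) q x) (toChart q x v) (toChart q x (X x))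
      + christoffel nablaN p (chartMap q p f (extChartAt 𝓘(ℝ, E) q x))
        (fderiv ℝ (chartMap q p f) (extChartAt 𝓘(ℝ, E) q x) (toChart q x v))
        (fderiv ℝ (chartMap q p f) (extChartAt 𝓘(ℝ, E) q x) (toChart q x (X x)))
      = fderiv ℝ (chartMap q p f) (extChartAt 𝓘(ℝ, E) q x)
        (christoffel nablaM q (extChartAt 𝓘(ℝ, E) q x) (toChart q x v) (toChart q x (X x))) := by
  have hX' := ((contMDiffAt_field_iff hx).1 hX).of_le (show (1 : WithTop ℕ∞) ≤ ∞ by norm_cast)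
  rw [← (toChart_injective hfx).eq_iff, toChart_mfderiv hx hfx (hf.of_le (by norm_cast)),
    toChart_nabla nablaM hx hX', toChart_covAlong_mfderiv nablaN hx hfx
      (hf.of_le (by norm_cast)) hX', chartField_apply hx, chartMap_apply hx, map_add]
  constructor
  · intro h
    linear_combination (norm := module) (-1 : ℝ) • h
  · intro h
    linear_combination (norm := module) (-1 : ℝ) • h

theorem isAffineAt_iff (hx : x ∈ (chartAt E q).source) (hfx : f x ∈ (chartAt F p).source) :
    IsAffineAt nablaM nablaN f x ↔ ContMDiffAt 𝓘(ℝ, E) 𝓘(ℝ, F) ∞ f x ∧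
      IsChartAffineAt (christoffel nablaM q) (christoffel nablaN p) (chartMap q p f)
        (extChartAt 𝓘(ℝ, E) q x) := by
  refine and_congr_right fun hf ↦ ⟨fun h u w ↦ ?_, fun h v X hX ↦ ?_⟩
  · have hX := contMDiffAt_constField (n := ∞) hx w
    have := (affine_equation_iff hx hfx hf hX (ofChart q x u)).1 (h _ _ hX)
    simpa only [constField, toChart_ofChart hx] using this
  · exact (affine_equation_iff hx hfx hf hX v).2 (h _ _)

/-- A bump function extends a coordinate field by zero. `IsAffineOn` tests only fields that are
smooth on the whole set, so fields given near `x` would not do. -/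
lemma exists_smoothField [T2Space M] (x : M) (a : E) :
    ∃ X : Π x : M, TangentSpace 𝓘(ℝ, E) x, IsSmoothFieldOn X univ ∧ X x = ofChart x x a := by
  have h2 : IsManifold 𝓘(ℝ, E) ∞ M := .of_le (n := ω) le_top
  let ρ : SmoothBumpFunction 𝓘(ℝ, E) x := Classical.arbitrary _
  refine ⟨(ρ : M → ℝ) • constField x a, fun y _ ↦ ?_, ?_⟩
  · by_cases hy : y ∈ (chartAt E x).source
    · exact (ρ.contMDiff.contMDiffAt.smul_section (contMDiffAt_constField hy a)).contMDiffWithinAt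
    · have h : ∀ᶠ z in 𝓝 y, (ρ : M → ℝ) z = 0 := by
        have := notMem_tsupport_iff_eventuallyEq.1 fun h ↦ hy (ρ.tsupport_subset_chartAt_source h)
        exact this
      have h0 : ContMDiffAt 𝓘(ℝ, E) 𝓘(ℝ, E).tangent ∞
        (zeroSection E (TangentSpace 𝓘(ℝ, E) : M → Type _)) y := contMDiffAt_zeroSection ℝ _
      refine (h0.congr_of_eventuallyEq ?_).contMDiffWithinAt
      filter_upwards [h] with z hz
      simp [zeroSection, hz]
  · simp [constField]

/-- By tensoriality one test field through each tangent vector suffices, and it may be taken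
globally smooth. -/
theorem isAffineOn_iff [T2Space M] {U : Set M} (hU : IsOpen U) :
    IsAffineOn nablaM nablaN f U ↔ ∀ x ∈ U, IsAffineAt nablaM nablaN f x := by
  refine ⟨fun h x hx ↦ ?_, fun h ↦ ⟨fun x hx ↦ (h x hx).1.contMDiffWithinAt,
    fun x hx v X hX ↦ (h x hx).2 v X (hX.contMDiffAt (hU.mem_nhds hx))⟩⟩
  have hf := h.1.contMDiffAt (hU.mem_nhds hx)
  have hq := mem_chart_source E x
  have hp := mem_chart_source F (f x)
  refine (isAffineAt_iff hq hp).2 ⟨hf, fun u w ↦ ?_⟩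
  obtain ⟨X, hX, hXx⟩ := exists_smoothField (E := E) x w
  have := (affine_equation_iff hq hp hf (hX.contMDiffAt univ_mem) (ofChart x x u)).1
    (h.2 x hx _ X (hX.mono (subset_univ U)))
  simpa only [hXx, toChart_ofChart hq] using this

lemma IsAffineAt.congr (h : IsAffineAt nablaM nablaN f x) (hfg : f =ᶠ[𝓝 x] g) :
    IsAffineAt nablaM nablaN g x := by
  have hx := mem_chart_source E x
  have hfx := mem_chart_source F (f x)
  have hgx : g x ∈ (chartAt F (f x)).source := hfg.self_of_nhds ▸ hfx
  obtain ⟨h1, h2⟩ := (isAffineAt_iff hx hfx).1 h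
  refine (isAffineAt_iff hx hgx).2 ⟨h1.congr_of_eventuallyEq hfg.symm, fun u w ↦ ?_⟩
  have h3 : chartMap (F := F) x (f x) f =ᶠ[𝓝 (extChartAt 𝓘(ℝ, E) x x)] chartMap x (f x) g := by
    filter_upwards [(tendsto_chart_symm hx).eventually hfg] with z hz
    simp only [chartMap, hz]
  rw [← h3.fderiv.fderiv_eq, ← h3.fderiv_eq, ← h3.eq_of_nhds]
  exact h2 u w

end Affine

/-! ### Covariant derivatives of tensor fields in coordinates. -/

section Tensors
open Set Filter
set_option maxSynthPendingDepth 3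
set_option linter.unusedSectionVars false

variable {E : Type*} [NormedAddCommGroup E] [NormedSpace ℝ E] [FiniteDimensional ℝ E]
  {M : Type*} [TopologicalSpace M] [ChartedSpace E M] [IsManifold 𝓘(ℝ, E) ω M]

/-- `T` is the coordinate representation of the tensor field `τ` in the preferred chart at `q`. -/
def IsCoordinateTensor (q : M) {k : ℕ} (τ : OpField E M k) (T : E → E [×k]→L[ℝ] E) : Prop :=
  ∀ x ∈ (chartAt E q).source, ∀ w, toChart q x (τ x w)
    = T (extChartAt 𝓘(ℝ, E) q x) (fun i ↦ toChart q x (w i))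

variable {nabla : Connection E M} {q x : M}

lemma contDiffAt_chartField_extend (hx : x ∈ (chartAt E q).source) (v : TangentSpace 𝓘(ℝ, E) x) :
    ContDiffAt ℝ ω (chartField q (FiberBundle.extend E (x := x) v)) (extChartAt 𝓘(ℝ, E) q x) := by
  rw [← contMDiffAt_field_iff hx]
  refine (contMDiffAt_constField (mem_chart_source E x) (toChart x x v)).congr_of_eventuallyEq ?_
  filter_upwards [eventually_mem_source (mem_chart_source E x)] with y hy
  rw [extend_eq_constField v hy]

lemma chartField_extend_apply (hx : x ∈ (chartAt E q).source) (v : TangentSpace 𝓘(ℝ, E) x) :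
    chartField q (FiberBundle.extend E (x := x) v) (extChartAt 𝓘(ℝ, E) q x) = toChart q x v := by
  rw [chartField_apply hx, FiberBundle.extend_apply_self]

/-- The ordinary derivatives of the extended arguments appear in the product rule and again in the
correction terms, and cancel; only the Christoffel terms survive. -/
theorem IsCoordinateTensor.covTensor {k : ℕ} {τ : OpField E M k} {T : E → E [×k]→L[ℝ] E}
    (h : IsCoordinateTensor q τ T)
    (hT : ∀ z ∈ (extChartAt 𝓘(ℝ, E) q).target, ContDiffAt ℝ ω T z) :
    IsCoordinateTensor q (covTensor nabla τ) (chartCov (christoffel nabla q) T) := by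
  intro x hx w
  have hz : extChartAt 𝓘(ℝ, E) q x ∈ (extChartAt 𝓘(ℝ, E) q).target :=
    (extChartAt 𝓘(ℝ, E) q).map_source (by simpa using hx)
  have hW (i : Fin k) := contDiffAt_chartField_extend hx (w i.succ)
  have hW1 (i : Fin k) := (hW i).of_le (show (1 : WithTop ℕ∞) ≤ ω from le_top)
  have heq : chartField q (fun y ↦ τ y (fun i ↦ FiberBundle.extend E (x := x) (w i.succ) y))
      =ᶠ[𝓝 (extChartAt 𝓘(ℝ, E) q x)] fun z ↦ T z (fun i ↦
        chartField q (FiberBundle.extend E (x := x) (w i.succ)) z) := by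
    filter_upwards [eventually_chart_symm_mem hx] with z hz'
    have h1 : (extChartAt 𝓘(ℝ, E) q).symm z ∈ (chartAt E q).source := by
      simpa using (extChartAt 𝓘(ℝ, E) q).map_target hz'
    refine (h _ h1 _).trans ?_
    rw [(extChartAt 𝓘(ℝ, E) q).right_inv hz']
    rfl
  have h2 : ContDiffAt ℝ ω (fun z ↦ T z (fun i ↦
        chartField q (FiberBundle.extend E (x := x) (w i.succ)) z)) (extChartAt 𝓘(ℝ, E) q x) :=
    (analyticAt_tensor_apply (hT _ hz).analyticAt fun i ↦ (hW i).analyticAt).contDiffAt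
  have h3 := (((hT _ hz).differentiableAt (by simp)).hasFDerivAt.continuousMultilinearMap_apply
    (fun i ↦ ((hW i).differentiableAt (by simp)).hasFDerivAt)).congr_of_eventuallyEq heq
  have h4 (i : Fin k) : toChart q x (τ x (Function.update
      (fun j ↦ FiberBundle.extend E (x := x) (w j.succ) x) i
        (nabla (FiberBundle.extend E (x := x) (w i.succ)) x (w 0)))) =
      T (extChartAt 𝓘(ℝ, E) q x) (Function.update (fun j : Fin k ↦ toChart q x (w j.succ)) i
        (fderiv ℝ (chartField q (FiberBundle.extend E (x := x) (w i.succ)))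
          (extChartAt 𝓘(ℝ, E) q x) (toChart q x (w 0))
        + christoffel nabla q (extChartAt 𝓘(ℝ, E) q x) (toChart q x (w 0))
          (toChart q x (w i.succ)))) := by
    rw [h x hx]
    congr 1
    funext j
    rcases eq_or_ne j i with rfl | hji
    · simp only [Function.update_self]
      rw [toChart_nabla nabla hx (hW1 j), chartField_extend_apply hx]
    · simp only [Function.update_of_ne hji, FiberBundle.extend_apply_self]
  simp only [AffineGeometry.covTensor, map_sub, map_sum, h4]
  rw [toChart_nabla nabla hx ((h2.congr_of_eventuallyEq heq).of_le le_top), h3.fderiv,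
    heq.eq_of_nhds, chartCov_apply]
  simp only [add_apply, ContinuousLinearMap.comp_apply, sum_apply,
    ContinuousMultilinearMap.apply_apply, ContinuousMultilinearMap.toContinuousLinearMap_apply,
    chartField_extend_apply hx, ContinuousMultilinearMap.map_update_add, Finset.sum_add_distrib]
  simp only [Fin.tail_def]
  abel

theorem IsCoordinateTensor.iterCovTensor {k : ℕ} {τ : OpField E M k} {T : E → E [×k]→L[ℝ] E}
    (hnabla : IsAnalyticConnection nabla) (h : IsCoordinateTensor q τ T)
    (hT : ∀ z ∈ (extChartAt 𝓘(ℝ, E) q).target, ContDiffAt ℝ ω T z) (r : ℕ) :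
    IsCoordinateTensor q (iterCovTensor nabla τ r) (chartIterCov (christoffel nabla q) T r) := by
  induction r with
  | zero => exact h
  | succ r ih =>
    exact ih.covTensor fun z hz ↦ contDiffAt_chartIterCov (contDiffAt_christoffel hnabla hz) (hT z hz) r

end Tensors

/-! ### Torsion, Lie brackets and curvature in coordinates. -/

section TorsionCurvature
open Set Filter
set_option maxSynthPendingDepth 3
set_option linter.unusedSectionVars false

variable {E : Type*} [NormedAddCommGroup E] [NormedSpace ℝ E] [FiniteDimensional ℝ E]
  {M : Type*} [TopologicalSpace M] [ChartedSpace E M] [IsManifold 𝓘(ℝ, E) ω M]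
  {nabla : Connection E M} {q x : M}

lemma mlieBracket_const (V W : Π z : E, TangentSpace 𝓘(ℝ, E) z) {a b : E} (hV : ∀ z, V z = a)
    (hW : ∀ z, W z = b) (z : E) : VectorField.mlieBracket 𝓘(ℝ, E) V W z = 0 := by
  have hV' : V = fun _ ↦ a := funext hV
  have hW' : W = fun _ ↦ b := funext hW
  rw [← VectorField.mlieBracketWithin_univ, VectorField.mlieBracketWithin_eq_lieBracketWithin]
  have h : VectorField.lieBracketWithin ℝ (fun _ : E ↦ a) (fun _ ↦ b) Set.univ z = 0 := by
    simp [VectorField.lieBracket]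
  subst hV' hW'
  exact h

/-- These fields are pull-backs under the chart of constant fields on `E`, and pull-back commutes
with brackets. -/
lemma mlieBracket_constField (hx : x ∈ (chartAt E q).source) (a b : E) :
    VectorField.mlieBracket 𝓘(ℝ, E) (constField q a) (constField q b) x = 0 := by
  have : CompleteSpace E := FiniteDimensional.complete ℝ E
  have h2 : IsManifold 𝓘(ℝ, E) (minSmoothness ℝ 3) M := .of_le (n := ω) le_top
  have h3 : IsManifold 𝓘(ℝ, E) 2 M := .of_le (n := ω) le_top
  let V : E → Π z : E, TangentSpace 𝓘(ℝ, E) z := fun c _ ↦ c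
  have h1 (c : E) : constField q c =ᶠ[𝓝 x] VectorField.mpullback 𝓘(ℝ, E) 𝓘(ℝ, E)
      (extChartAt 𝓘(ℝ, E) q) (V c) := by
    filter_upwards [eventually_mem_source hx] with y hy
    have h5 : (mfderiv 𝓘(ℝ, E) 𝓘(ℝ, E) (extChartAt 𝓘(ℝ, E) q) y).inverse = ofChart (E := E) q y :=
      ContinuousLinearMap.inverse_eq
        (ContinuousLinearMap.ext fun v ↦ by
          rw [← toChart_eq_mfderiv hy]; exact toChart_ofChart hy v)
        (ContinuousLinearMap.ext fun v ↦ by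
          rw [← toChart_eq_mfderiv hy]; exact ofChart_toChart hy v)
    rw [VectorField.mpullback_apply, h5]
    rfl
  have h4 (c : E) : MDifferentiableAt 𝓘(ℝ, E) 𝓘(ℝ, E).tangent
      (fun z : E ↦ (⟨z, V c z⟩ : TangentBundle 𝓘(ℝ, E) E)) (extChartAt 𝓘(ℝ, E) q x) := by
    refine ContMDiffAt.mdifferentiableAt (n := 1) ?_ (by simp)
    exact (contMDiffAt_vectorSpace_iff_contDiffAt (V := V c)).2 contDiffAt_const
  rw [(h1 a).mlieBracket_vectorField_eq (h1 b), ← VectorField.mpullback_mlieBracket (n := ω)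
    (h4 a) (h4 b) (contMDiffAt_extChartAt' hx) le_top, VectorField.mpullback_apply,
    mlieBracket_const (V a) (V b) (fun _ ↦ rfl) (fun _ ↦ rfl), map_zero]

theorem isCoordinateTensor_torsionTensor (nabla : Connection E M) (q : M) :
    IsCoordinateTensor q (torsionTensor nabla) (chartTorsionTensor (christoffel nabla q)) := by
  intro x hx w
  have : CompleteSpace E := FiniteDimensional.complete ℝ E
  have h2 : IsManifold 𝓘(ℝ, E) 2 M := .of_le (n := ω) le_top
  have hc (c : E) := contMDiffAt_constField (n := 1) hx c
  have hcc (c : E) : chartField q (constField q c) =ᶠ[𝓝 (extChartAt 𝓘(ℝ, E) q x)] fun _ ↦ c := by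
    filter_upwards [eventually_chart_symm_mem hx] with z hz using chartField_constField c hz
  have hv (v : TangentSpace 𝓘(ℝ, E) x) : constField q (toChart q x v) x = v := ofChart_toChart hx v
  have hn (c : E) (v : TangentSpace 𝓘(ℝ, E) x) : toChart q x (nabla (constField q c) x v)
      = christoffel nabla q (extChartAt 𝓘(ℝ, E) q x) (toChart q x v) c := by
    rw [toChart_nabla nabla hx ((contMDiffAt_field_iff hx).1 (hc c)), (hcc c).fderiv_eq,
      (hcc c).eq_of_nhds]
    simp
  have h := nabla.torsion_apply ((hc (toChart q x (w 0))).mdifferentiableAt (by simp))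
    ((hc (toChart q x (w 1))).mdifferentiableAt (by simp))
  rw [hv, hv, mlieBracket_constField hx, sub_zero] at h
  rw [torsionTensor, h, map_sub, hn, hn, chartTorsionTensor_apply]

/-- The Lie bracket in coordinates. -/
lemma toChart_mlieBracket (nabla : Connection E M) {X Y : Π x : M, TangentSpace 𝓘(ℝ, E) x}
    (hx : x ∈ (chartAt E q).source)
    (hX : ContDiffAt ℝ 1 (chartField q X) (extChartAt 𝓘(ℝ, E) q x))
    (hY : ContDiffAt ℝ 1 (chartField q Y) (extChartAt 𝓘(ℝ, E) q x)) :
    toChart q x (VectorField.mlieBracket 𝓘(ℝ, E) X Y x) =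
      fderiv ℝ (chartField q Y) (extChartAt 𝓘(ℝ, E) q x) (toChart q x (X x))
      - fderiv ℝ (chartField q X) (extChartAt 𝓘(ℝ, E) q x) (toChart q x (Y x)) := by
  have : CompleteSpace E := FiniteDimensional.complete ℝ E
  have h2 : IsManifold 𝓘(ℝ, E) 2 M := .of_le (n := ω) le_top
  -- The bracket is solved for in the torsion identity, whose other terms are already known in
  -- coordinates; the Christoffel terms cancel, whatever the connection.
  have h := nabla.torsion_apply (((contMDiffAt_field_iff hx).2 hX).mdifferentiableAt (by simp))
    (((contMDiffAt_field_iff hx).2 hY).mdifferentiableAt (by simp))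
  have h3 := isCoordinateTensor_torsionTensor nabla q x hx ![X x, Y x]
  simp only [torsionTensor, Matrix.cons_val_zero, Matrix.cons_val_one, chartTorsionTensor_apply] at h3
  rw [h, map_sub, map_sub, toChart_nabla nabla hx hX, toChart_nabla nabla hx hY, chartField_apply hx,
    chartField_apply hx] at h3
  linear_combination (norm := module) (-1 : ℝ) • h3

/-- Iterated covariant derivatives of vector fields in coordinates. -/
lemma chartField_nabla (nabla : Connection E M) {Y Z : Π x : M, TangentSpace 𝓘(ℝ, E) x}
    (hx : x ∈ (chartAt E q).source)
    (hZ : ContDiffAt ℝ ω (chartField q Z) (extChartAt 𝓘(ℝ, E) q x)) :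
    chartField q (fun y ↦ nabla Z y (Y y)) =ᶠ[𝓝 (extChartAt 𝓘(ℝ, E) q x)]
      fun z ↦ fderiv ℝ (chartField q Z) z (chartField q Y z)
        + christoffel nabla q z (chartField q Y z) (chartField q Z z) := by
  filter_upwards [eventually_chart_symm_mem hx, hZ.eventually (by simp)] with z hz hz'
  have h1 : (extChartAt 𝓘(ℝ, E) q).symm z ∈ (chartAt E q).source := by
    simpa using (extChartAt 𝓘(ℝ, E) q).map_target hz
  have h2 : extChartAt 𝓘(ℝ, E) q ((extChartAt 𝓘(ℝ, E) q).symm z) = z :=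
    (extChartAt 𝓘(ℝ, E) q).right_inv hz
  have h3 := toChart_nabla nabla h1 (X := Z) (by rw [h2]; exact hz'.of_le le_top)
    (Y ((extChartAt 𝓘(ℝ, E) q).symm z))
  rw [h2] at h3
  exact h3

/-- Second derivatives of the third field cancel by symmetry, derivatives of the first two are
absorbed by the bracket term, and the mixed Christoffel terms are symmetric in the first two
arguments. -/
theorem isCoordinateTensor_curvatureTensor (hnabla : IsAnalyticConnection nabla) (q : M) :
    IsCoordinateTensor q (curvatureTensor nabla) (chartCurvatureTensor (christoffel nabla q)) := by
  intro x hx w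
  have hz : extChartAt 𝓘(ℝ, E) q x ∈ (extChartAt 𝓘(ℝ, E) q).target :=
    (extChartAt 𝓘(ℝ, E) q).map_source (by simpa using hx)
  have hW (i : Fin 3) := contDiffAt_chartField_extend hx (w i)
  have hW1 (i : Fin 3) := (hW i).of_le (show (1 : WithTop ℕ∞) ≤ ω from le_top)
  have hd (i : Fin 3) := ((hW i).differentiableAt (by simp)).hasFDerivAt
  have hd2 := (((hW 2).fderiv_right (m := ω) le_rfl).differentiableAt (by simp)).hasFDerivAt
  have hΓ := ((contDiffAt_christoffel hnabla hz).differentiableAt (by simp)).hasFDerivAt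
  have hsymm := ((hW 2).isSymmSndFDerivAt (by simp)).eq
  have key (i j : Fin 3) : toChart q x (nabla (fun y ↦ nabla (FiberBundle.extend E (x := x) (w 2)) y
      (FiberBundle.extend E (x := x) (w j) y)) x (FiberBundle.extend E (x := x) (w i) x)) =
      let z := extChartAt 𝓘(ℝ, E) q x
      let W := fun i ↦ chartField q (FiberBundle.extend E (x := x) (w i))
      let Γ := christoffel nabla q
      let u := toChart q x (FiberBundle.extend E (x := x) (w i) x)
      fderiv ℝ (fderiv ℝ (W 2)) z u (W j z) + fderiv ℝ (W 2) z (fderiv ℝ (W j) z u)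
        + (fderiv ℝ Γ z u (W j z) (W 2 z) + Γ z (fderiv ℝ (W j) z u) (W 2 z)
          + Γ z (W j z) (fderiv ℝ (W 2) z u))
        + Γ z u (fderiv ℝ (W 2) z (W j z) + Γ z (W j z) (W 2 z)) := by
    have h1 := chartField_nabla nabla (Y := FiberBundle.extend E (x := x) (w j)) hx (hW 2)
    have h2 := (hd2.clm_apply (hd j)).add ((hΓ.clm_apply (hd j)).clm_apply (hd 2))
    have h3 : ContDiffAt ℝ ω _ (extChartAt 𝓘(ℝ, E) q x) :=
      (((hW 2).fderiv_right (m := ω) le_rfl).clm_apply (hW j)).add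
        (((contDiffAt_christoffel hnabla hz).clm_apply (hW j)).clm_apply (hW 2))
    rw [toChart_nabla nabla hx ((h3.congr_of_eventuallyEq h1).of_le le_top),
      (h2.congr_of_eventuallyEq h1).fderiv, h1.eq_of_nhds]
    simp only [add_apply, ContinuousLinearMap.flip_apply, ContinuousLinearMap.comp_apply]
    abel
  simp only [curvatureTensor, curvature, map_sub]
  rw [key, key, toChart_nabla nabla hx (hW1 2), toChart_mlieBracket nabla hx (hW1 0) (hW1 1),
    chartCurvatureTensor_apply, chartCurvature_apply]
  simp only [chartField_extend_apply hx, FiberBundle.extend_apply_self, map_sub, map_add, sub_apply,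
    hsymm (toChart q x (w 1)) (toChart q x (w 0))]
  abel

end TorsionCurvature

/-! ### Germs of affine maps with prescribed differential. -/

section LocalExistence
open Set Filter
set_option maxSynthPendingDepth 3
set_option linter.unusedSectionVars false

variable {E : Type*} [NormedAddCommGroup E] [NormedSpace ℝ E] [FiniteDimensional ℝ E]
  {M : Type*} [TopologicalSpace M] [ChartedSpace E M] [IsManifold 𝓘(ℝ, E) ω M]
  {F : Type*} [NormedAddCommGroup F] [NormedSpace ℝ F] [FiniteDimensional ℝ F]
  {N : Type*} [TopologicalSpace N] [ChartedSpace F N] [IsManifold 𝓘(ℝ, F) ω N]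
  {nablaM : Connection E M} {nablaN : Connection F N}

lemma Relates.coordinates {k : ℕ} {x : M} {y : N} {τ : OpField E M k} {τ' : OpField F N k}
    {σ : TangentSpace 𝓘(ℝ, E) x →L[ℝ] TangentSpace 𝓘(ℝ, F) y} (h : Relates σ τ τ')
    {T : E → E [×k]→L[ℝ] E} {T' : F → F [×k]→L[ℝ] F} (hT : IsCoordinateTensor x τ T)
    (hT' : IsCoordinateTensor y τ' T') (w : Fin k → E) :
    (toChart y y ∘L σ ∘L ofChart x x) (T (extChartAt 𝓘(ℝ, E) x x) w)
      = T' (extChartAt 𝓘(ℝ, F) y y) (fun i ↦ (toChart y y ∘L σ ∘L ofChart x x) (w i)) := by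
  have hx := mem_chart_source E x
  have h1 := hT x hx (fun i ↦ ofChart x x (w i))
  simp only [toChart_ofChart hx] at h1
  have h2 := hT' y (mem_chart_source F y) (fun i ↦ σ (ofChart x x (w i)))
  rw [← h1]
  simp only [ContinuousLinearMap.comp_apply, ofChart_toChart hx]
  rw [← h2]
  exact congrArg (toChart y y) (h _)

/-- Equality in the tangent bundle avoids a transport between the tangent spaces at `f x` and at
`y`. -/
lemma tangentMap_eq_of_toChart {f : M → N} {x : M} {y : N} (hy : f x = y)
    {σ : TangentSpace 𝓘(ℝ, E) x →L[ℝ] TangentSpace 𝓘(ℝ, F) y} (v : TangentSpace 𝓘(ℝ, E) x)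
    (h : toChart y (f x) (mfderiv 𝓘(ℝ, E) 𝓘(ℝ, F) f x v) = toChart y y (σ v)) :
    tangentMap 𝓘(ℝ, E) 𝓘(ℝ, F) f ⟨x, v⟩ = ⟨y, σ v⟩ := by
  subst hy
  exact congrArg _ (toChart_injective (mem_chart_source F (f x)) h)

/-- A local version of the existence of affine maps with prescribed differential. -/
theorem exists_affine_germ (hM : IsAnalyticConnection nablaM) (hN : IsAnalyticConnection nablaN)
    {x₀ : M} {y₀ : N} {σ₀ : TangentSpace 𝓘(ℝ, E) x₀ →L[ℝ] TangentSpace 𝓘(ℝ, F) y₀}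
    (h : ∀ r : ℕ,
        Relates σ₀ (iterCovTensor nablaM (torsionTensor nablaM) r)
          (iterCovTensor nablaN (torsionTensor nablaN) r) ∧
        Relates σ₀ (iterCovTensor nablaM (curvatureTensor nablaM) r)
          (iterCovTensor nablaN (curvatureTensor nablaN) r)) :
    ∃ f : M → N, (∀ᶠ x in 𝓝 x₀, IsAffineAt nablaM nablaN f x) ∧ f x₀ = y₀ ∧
      ∀ v : TangentSpace 𝓘(ℝ, E) x₀, tangentMap 𝓘(ℝ, E) 𝓘(ℝ, F) f ⟨x₀, v⟩ = ⟨y₀, σ₀ v⟩ := by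
  have : CompleteSpace E := FiniteDimensional.complete ℝ E
  have : CompleteSpace F := FiniteDimensional.complete ℝ F
  have hx := mem_chart_source E x₀
  have hy := mem_chart_source F y₀
  have hΓM {z} (hz : z ∈ (extChartAt 𝓘(ℝ, E) x₀).target) := contDiffAt_christoffel hM hz
  have hΓN {z} (hz : z ∈ (extChartAt 𝓘(ℝ, F) y₀).target) := contDiffAt_christoffel hN hz
  obtain ⟨φ, hφ, hφ0, hφd, hφa⟩ := exists_chartAffine
    (σ := toChart y₀ y₀ ∘L σ₀ ∘L ofChart x₀ x₀)
    (hΓM (mem_extChartAt_target x₀)) (hΓN (mem_extChartAt_target y₀))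
    (fun r w ↦ (h r).1.coordinates
      ((isCoordinateTensor_torsionTensor nablaM x₀).iterCovTensor hM
        (fun z hz ↦ contDiffAt_chartTorsionTensor (hΓM hz)) r)
      ((isCoordinateTensor_torsionTensor nablaN y₀).iterCovTensor hN
        (fun z hz ↦ contDiffAt_chartTorsionTensor (hΓN hz)) r) w)
    (fun r w ↦ (h r).2.coordinates
      ((isCoordinateTensor_curvatureTensor hM x₀).iterCovTensor hM
        (fun z hz ↦ contDiffAt_chartCurvatureTensor (hΓM hz)) r)
      ((isCoordinateTensor_curvatureTensor hN y₀).iterCovTensor hN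
        (fun z hz ↦ contDiffAt_chartCurvatureTensor (hΓN hz)) r) w)
  -- Only the germ at `x₀` matters; far from it the values of `f` carry no meaning.
  let f : M → N := fun x ↦ (extChartAt 𝓘(ℝ, F) y₀).symm (φ (extChartAt 𝓘(ℝ, E) x₀ x))
  have hf0 : f x₀ = y₀ := by simp only [f, hφ0, chart_symm_apply hy]
  have ht : ∀ᶠ z in 𝓝 (extChartAt 𝓘(ℝ, E) x₀ x₀), φ z ∈ (extChartAt 𝓘(ℝ, F) y₀).target :=
    hφ.continuousAt.eventually_mem (by rw [hφ0]; exact extChartAt_target_mem_nhds y₀)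
  have hfφ : chartMap x₀ y₀ f =ᶠ[𝓝 (extChartAt 𝓘(ℝ, E) x₀ x₀)] φ := by
    filter_upwards [ht, eventually_chart_symm_mem hx] with z h1 h2
    simp only [chartMap, f, (extChartAt 𝓘(ℝ, E) x₀).right_inv h2, (extChartAt 𝓘(ℝ, F) y₀).right_inv h1]
  have hcx : ContinuousAt (extChartAt 𝓘(ℝ, E) x₀) x₀ := continuousAt_extChartAt x₀
  have hcont : ContinuousAt f x₀ := by
    have h1 : ContinuousAt (extChartAt 𝓘(ℝ, F) y₀).symm (φ (extChartAt 𝓘(ℝ, E) x₀ x₀)) := by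
      rw [hφ0]
      exact continuousAt_extChartAt_symm y₀
    exact ContinuousAt.comp (g := (extChartAt 𝓘(ℝ, F) y₀).symm)
      (f := fun x ↦ φ (extChartAt 𝓘(ℝ, E) x₀ x)) h1 (ContinuousAt.comp (g := φ) hφ.continuousAt hcx)
  have hsm : ContMDiffAt 𝓘(ℝ, E) 𝓘(ℝ, F) ω f x₀ :=
    (contMDiffAt_iff_chartMap hx (hf0 ▸ hy)).2 ⟨hcont, hφ.congr_of_eventuallyEq hfφ⟩
  refine ⟨f, ?_, hf0, fun v ↦ tangentMap_eq_of_toChart hf0 v ?_⟩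
  · filter_upwards [eventually_mem_source hx, hcont.eventually_mem
      ((chartAt F y₀).open_source.mem_nhds (hf0 ▸ hy)), eventually_contMDiffAt (by simp) hsm,
      hcx.eventually hφa, hcx.eventually hfφ.eventually_nhds] with x h1 h2 h3 h4 h5
    refine (isAffineAt_iff h1 h2).2 ⟨h3.of_le le_top, fun u w ↦ ?_⟩
    have h6 : chartMap x₀ y₀ f =ᶠ[𝓝 (extChartAt 𝓘(ℝ, E) x₀ x)] φ := h5
    rw [h6.fderiv.fderiv_eq, h6.fderiv_eq, h6.eq_of_nhds]
    exact h4 u w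
  · rw [toChart_mfderiv hx (hf0 ▸ hy) (hsm.of_le le_top), hfφ.fderiv_eq, hφd]
    simp only [ContinuousLinearMap.comp_apply, ofChart_toChart hx]

end LocalExistence

/-! ### Geodesics on a manifold and their uniqueness. -/

section Geodesics
open Set Filter
set_option maxSynthPendingDepth 3
set_option linter.unusedSectionVars false

variable {F : Type*} [NormedAddCommGroup F] [NormedSpace ℝ F] [FiniteDimensional ℝ F]
  {N : Type*} [TopologicalSpace N] [ChartedSpace F N] [IsManifold 𝓘(ℝ, F) ω N]
  {nabla : Connection F N} {γ γ₁ γ₂ : ℝ → N} {s t : ℝ} {p : N}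

lemma contMDiffAt_curve_iff {n : WithTop ℕ∞} (hs : γ s ∈ (chartAt F p).source) :
    ContMDiffAt 𝓘(ℝ, ℝ) 𝓘(ℝ, F) n γ s ↔
      ContinuousAt γ s ∧ ContDiffAt ℝ n (extChartAt 𝓘(ℝ, F) p ∘ γ) s := by
  have : IsManifold 𝓘(ℝ, F) n N := .of_le (n := ω) le_top
  rw [contMDiffAt_iff_target_of_mem_source hs, contMDiffAt_iff_contDiffAt]

lemma toChart_velocity (hs : γ s ∈ (chartAt F p).source)
    (hγ : ContMDiffAt 𝓘(ℝ, ℝ) 𝓘(ℝ, F) 1 γ s) :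
    toChart p (γ s) (velocity (F := F) γ s) = deriv (extChartAt 𝓘(ℝ, F) p ∘ γ) s := by
  have h1 : ContMDiffAt 𝓘(ℝ, ℝ) 𝓘(ℝ, F) 1 (extChartAt 𝓘(ℝ, F) p ∘ γ) s :=
    ((contMDiffAt_curve_iff hs).1 hγ).2.contMDiffAt
  rw [toChart_eq_mfderiv hs, velocity]
  have h2 := mfderiv_comp s (mdifferentiableAt_extChartAt hs) (hγ.mdifferentiableAt (by simp))
  rw [mfderiv_eq_fderiv] at h2
  rw [← fderiv_apply_one_eq_deriv, h2]
  rfl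

/-- The curve `γ` is smooth at `s` and satisfies the equation of geodesics at `s`. -/
def IsGeodesicAt (nabla : Connection F N) (γ : ℝ → N) (s : ℝ) : Prop :=
  ContMDiffAt 𝓘(ℝ, ℝ) 𝓘(ℝ, F) ∞ γ s ∧
    covAlong (E := ℝ) nabla γ (fun r ↦ velocity (F := F) γ r) s (1 : ℝ) = 0

lemma isGeodesicOn_iff {J : Set ℝ} (hJ : IsOpen J) :
    IsGeodesicOn nabla γ J ↔ ∀ s ∈ J, IsGeodesicAt nabla γ s :=
  ⟨fun h s hs ↦ ⟨h.1.contMDiffAt (hJ.mem_nhds hs), h.2 s hs⟩,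
    fun h ↦ ⟨fun s hs ↦ (h s hs).1.contMDiffWithinAt, fun s hs ↦ (h s hs).2⟩⟩

lemma isGeodesicAt_iff (hs : γ s ∈ (chartAt F p).source) :
    IsGeodesicAt nabla γ s ↔ ContMDiffAt 𝓘(ℝ, ℝ) 𝓘(ℝ, F) ∞ γ s ∧
      deriv (deriv (extChartAt 𝓘(ℝ, F) p ∘ γ)) s
      + christoffel nabla p (extChartAt 𝓘(ℝ, F) p (γ s))
        (deriv (extChartAt 𝓘(ℝ, F) p ∘ γ) s) (deriv (extChartAt 𝓘(ℝ, F) p ∘ γ) s) = 0 := by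
  refine and_congr_right fun hγ ↦ ?_
  rw [← toChart_covAlong_velocity nabla hs (hγ.of_le (by norm_cast)), ← (toChart_injective hs).eq_iff,
    map_zero]

/-- Position and velocity of a curve in the preferred chart at `p`. -/
def chartState (p : N) (γ : ℝ → N) (s : ℝ) : F × F :=
  (extChartAt 𝓘(ℝ, F) p (γ s), deriv (extChartAt 𝓘(ℝ, F) p ∘ γ) s)

lemma IsGeodesicAt.hasDerivAt_chartState (h : IsGeodesicAt nabla γ s)
    (hs : γ s ∈ (chartAt F p).source) :
    HasDerivAt (chartState p γ) (geodesicField (christoffel nabla p) (chartState p γ s)) s := by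
  obtain ⟨h1, h2⟩ := (isGeodesicAt_iff hs).1 h
  have h3 := ((contMDiffAt_curve_iff hs).1 h1).2
  have h4 := (h3.differentiableAt (by simp)).hasDerivAt
  have h5 : HasDerivAt (deriv (extChartAt 𝓘(ℝ, F) p ∘ γ))
      (deriv (deriv (extChartAt 𝓘(ℝ, F) p ∘ γ)) s) s := by
    refine DifferentiableAt.hasDerivAt ?_
    have h6 := (h3.of_le (show (2 : WithTop ℕ∞) ≤ ∞ by norm_cast)).fderiv_right (m := 1) (by norm_num)
    exact ((h6.clm_apply contDiffAt_const).differentiableAt (by simp))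
  rw [eq_neg_of_add_eq_zero_left h2] at h5
  exact h4.prodMk h5

lemma IsGeodesicAt.continuousAt (h : IsGeodesicAt nabla γ s) : ContinuousAt γ s := h.1.continuousAt

lemma eventuallyEq_of_chartState_eq [CompleteSpace F] (hN : IsAnalyticConnection nabla)
    (h₁ : ∀ᶠ s in 𝓝 t, IsGeodesicAt nabla γ₁ s) (h₂ : ∀ᶠ s in 𝓝 t, IsGeodesicAt nabla γ₂ s)
    (ht₁ : γ₁ t ∈ (chartAt F p).source) (ht₂ : γ₂ t ∈ (chartAt F p).source)
    (h : chartState (F := F) p γ₁ t = chartState p γ₂ t) : γ₁ =ᶠ[𝓝 t] γ₂ := by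
  have hs₁ := h₁.self_of_nhds.continuousAt.eventually (eventually_mem_source ht₁)
  have hs₂ := h₂.self_of_nhds.continuousAt.eventually (eventually_mem_source ht₂)
  have hX : ContDiffAt ℝ 1 (geodesicField (christoffel nabla p)) (chartState p γ₁ t) :=
    (contDiffAt_geodesicField (contDiffAt_christoffel hN
      ((extChartAt 𝓘(ℝ, F) p).map_source (by simpa using ht₁)))).of_le le_top
  have h3 := eventuallyEq_of_hasDerivAt (f := chartState p γ₁) (g := chartState p γ₂) hX
    (by filter_upwards [h₁, hs₁] with s h1 h2 using h1.hasDerivAt_chartState h2)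
    (by filter_upwards [h₂, hs₂] with s h1 h2 using h1.hasDerivAt_chartState h2) h
  filter_upwards [h3, hs₁, hs₂] with s h4 h5 h6
  rw [← chart_symm_apply h5, ← chart_symm_apply h6]
  exact congrArg (fun q : F × F ↦ (extChartAt 𝓘(ℝ, F) p).symm q.1) h4

lemma chartState_eq (hs : γ s ∈ (chartAt F p).source) (hγ : ContMDiffAt 𝓘(ℝ, ℝ) 𝓘(ℝ, F) 1 γ s) :
    chartState p γ s = (extChartAt 𝓘(ℝ, F) p (γ s), toChart p (γ s) (velocity (F := F) γ s)) := by
  rw [toChart_velocity hs hγ, chartState]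

/-- Geodesics are determined by their initial position and velocity. -/
theorem eventuallyEq_of_isGeodesicAt [T2Space N] (hN : IsAnalyticConnection nabla) {J : Set ℝ}
    (hJo : IsOpen J) (hJ : IsPreconnected J) (h₁ : ∀ s ∈ J, IsGeodesicAt nabla γ₁ s)
    (h₂ : ∀ s ∈ J, IsGeodesicAt nabla γ₂ s) {t₀ : ℝ} (ht₀ : t₀ ∈ J)
    (h : (⟨γ₁ t₀, velocity (F := F) γ₁ t₀⟩ : TangentBundle 𝓘(ℝ, F) N)
      = ⟨γ₂ t₀, velocity (F := F) γ₂ t₀⟩) : ∀ t ∈ J, γ₁ =ᶠ[𝓝 t] γ₂ := by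
  have : CompleteSpace F := FiniteDimensional.complete ℝ F
  have hev {γ : ℝ → N} (hγ : ∀ s ∈ J, IsGeodesicAt nabla γ s) {t : ℝ} (ht : t ∈ J) :
      ∀ᶠ s in 𝓝 t, IsGeodesicAt nabla γ s := by
    filter_upwards [hJo.mem_nhds ht] with s hs using hγ s hs
  have hu : IsOpen {t | γ₁ =ᶠ[𝓝 t] γ₂} := isOpen_setOfPred_eventually_nhds
  have h0 : γ₁ t₀ = γ₂ t₀ := congrArg TotalSpace.proj h
  refine hJ.subset_of_closure_inter_subset hu ⟨t₀, ht₀, ?_⟩ fun t ⟨ht, htJ⟩ ↦ ?_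
  · refine eventuallyEq_of_chartState_eq (p := γ₁ t₀) hN (hev h₁ ht₀) (hev h₂ ht₀)
      (mem_chart_source F _) (h0 ▸ mem_chart_source F _) ?_
    rw [chartState_eq (mem_chart_source F _) ((h₁ t₀ ht₀).1.of_le (by norm_cast)),
      chartState_eq (h0 ▸ mem_chart_source F _) ((h₂ t₀ ht₀).1.of_le (by norm_cast))]
    exact congrArg (fun w : TangentBundle 𝓘(ℝ, F) N ↦
      (extChartAt 𝓘(ℝ, F) (γ₁ t₀) w.1, toChart (γ₁ t₀) w.1 w.2)) h
  · have hsub : {t | γ₁ =ᶠ[𝓝 t] γ₂} ⊆ {t | γ₁ t = γ₂ t} := fun s hs ↦ hs.self_of_nhds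
    have h1 : γ₁ t = γ₂ t := eq_of_mem_closure_setOf_eq (h₁ t htJ).continuousAt
      (h₂ t htJ).continuousAt (closure_mono hsub ht)
    have hp := mem_chart_source F (γ₁ t)
    refine eventuallyEq_of_chartState_eq (p := γ₁ t) hN (hev h₁ htJ) (hev h₂ htJ) hp (h1 ▸ hp) ?_
    -- At a limit time positions agree because `N` is Hausdorff. Velocities are then compared in one
    -- fixed chart, where the state curves are continuous.
    refine eq_of_mem_closure_setOf_eq
      ((h₁ t htJ).hasDerivAt_chartState hp).continuousAt
      ((h₂ t htJ).hasDerivAt_chartState (h1 ▸ hp)).continuousAt (closure_mono (fun s hs ↦ ?_) ht)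
    have hs' : γ₁ =ᶠ[𝓝 s] γ₂ := hs
    have h2 : (extChartAt 𝓘(ℝ, F) (γ₁ t) ∘ γ₁) =ᶠ[𝓝 s] extChartAt 𝓘(ℝ, F) (γ₁ t) ∘ γ₂ :=
      hs'.fun_comp _
    exact Prod.ext h2.self_of_nhds h2.deriv_eq

/-- A solution of the geodesic equation in coordinates is a geodesic. -/
lemma isGeodesicAt_of_hasDerivAt {c : ℝ → F × F} (hc : ContDiffAt ℝ ∞ c t)
    (hd : ∀ᶠ s in 𝓝 t, HasDerivAt c (geodesicField (christoffel nabla p) (c s)) s)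
    (ht : (c t).1 ∈ (extChartAt 𝓘(ℝ, F) p).target) :
    IsGeodesicAt nabla (fun s ↦ (extChartAt 𝓘(ℝ, F) p).symm (c s).1) t ∧
      chartState p (fun s ↦ (extChartAt 𝓘(ℝ, F) p).symm (c s).1) t = c t := by
  have h1 : (extChartAt 𝓘(ℝ, F) p ∘ fun s ↦ (extChartAt 𝓘(ℝ, F) p).symm (c s).1) =ᶠ[𝓝 t]
      fun s ↦ (c s).1 := by
    filter_upwards [hc.continuousAt.fst.eventually_mem
      ((isOpen_extChartAt_target p).mem_nhds ht)] with s hs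
    exact (extChartAt 𝓘(ℝ, F) p).right_inv hs
  have h2 : deriv (extChartAt 𝓘(ℝ, F) p ∘ fun s ↦ (extChartAt 𝓘(ℝ, F) p).symm (c s).1) =ᶠ[𝓝 t]
      fun s ↦ (c s).2 := by
    filter_upwards [h1.eventuallyEq_nhds, hd] with s h2 h3
    rw [h2.deriv_eq]
    exact (hasDerivAt_fst h3).deriv
  have hs : (extChartAt 𝓘(ℝ, F) p).symm (c t).1 ∈ (chartAt F p).source := by
    simpa using (extChartAt 𝓘(ℝ, F) p).map_target ht
  have h3 : ContMDiffAt 𝓘(ℝ, ℝ) 𝓘(ℝ, F) ∞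
      (fun s ↦ (extChartAt 𝓘(ℝ, F) p).symm (c s).1) t := by
    refine (contMDiffAt_curve_iff hs).2 ⟨?_, (hc.fst).congr_of_eventuallyEq h1⟩
    exact ContinuousAt.comp (g := (extChartAt 𝓘(ℝ, F) p).symm) (f := fun s ↦ (c s).1)
      (continuousAt_extChartAt_symm'' ht) hc.continuousAt.fst
  refine ⟨(isGeodesicAt_iff hs).2 ⟨h3, ?_⟩, Prod.ext h1.self_of_nhds h2.self_of_nhds⟩
  have h4 : extChartAt 𝓘(ℝ, F) p ((extChartAt 𝓘(ℝ, F) p).symm (c t).1) = (c t).1 :=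
    h1.self_of_nhds
  rw [h2.deriv_eq, h2.self_of_nhds, h4, (hasDerivAt_snd hd.self_of_nhds).deriv]
  simp [geodesicField]

lemma eq_of_chartState_eq {γ : ℝ → N} {w : TangentBundle 𝓘(ℝ, F) N}
    (hs : γ s ∈ (chartAt F p).source) (hγ : ContMDiffAt 𝓘(ℝ, ℝ) 𝓘(ℝ, F) 1 γ s)
    (hw : w.1 ∈ (chartAt F p).source)
    (h : chartState p γ s = (extChartAt 𝓘(ℝ, F) p w.1, toChart p w.1 w.2)) :
    (⟨γ s, velocity (F := F) γ s⟩ : TangentBundle 𝓘(ℝ, F) N) = w := by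
  rw [chartState_eq hs hγ] at h
  obtain ⟨y, v⟩ := w
  have h1 : γ s = y := by
    refine (chart_symm_apply (E := F) hs).symm.trans (Eq.trans ?_ (chart_symm_apply (E := F) hw))
    exact congrArg (fun q : F × F ↦ (extChartAt 𝓘(ℝ, F) p).symm q.1) h
  subst h1
  exact congrArg _ (toChart_injective hs (congrArg Prod.snd h))

end Geodesics

/-! ### Analyticity of the exponential map. -/

section Exponential
open Set Filter Metric
set_option maxSynthPendingDepth 3
set_option linter.unusedSectionVars false

variable {F : Type*} [NormedAddCommGroup F] [NormedSpace ℝ F] [FiniteDimensional ℝ F]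
  {N : Type*} [TopologicalSpace N] [ChartedSpace F N] [IsManifold 𝓘(ℝ, F) ω N]
  {nabla : Connection F N}

/-- In a family of geodesics, analyticity of positions and velocities propagates in time. -/
lemma exists_contMDiffAt_geodesics_of_contMDiffAt [T2Space N] (hN : IsAnalyticConnection nabla)
    {V : Type*} [NormedAddCommGroup V] [NormedSpace ℝ V]
    {γ : V → ℝ → N} {J : V → Set ℝ} (hJo : ∀ v, IsOpen (J v)) (hJ : ∀ v, (J v).OrdConnected)
    (hγ : ∀ v, ∀ t ∈ J v, IsGeodesicAt nabla (γ v) t) {v₀ : V} {I : Set ℝ} (hI : ∀ v, I ⊆ J v)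
    {t₀ : ℝ} (ht₀ : t₀ ∈ I) :
    ∃ ε > 0, ∀ t ∈ I, ∀ t' ∈ I, t ∈ ball t₀ ε → t' ∈ ball t₀ ε →
      ContMDiffAt 𝓘(ℝ, V) 𝓘(ℝ, F).tangent ω
        (fun v ↦ (⟨γ v t, velocity (F := F) (γ v) t⟩ : TangentBundle 𝓘(ℝ, F) N)) v₀ →
      ContMDiffAt 𝓘(ℝ, V) 𝓘(ℝ, F).tangent ω
        (fun v ↦ (⟨γ v t', velocity (F := F) (γ v) t'⟩ : TangentBundle 𝓘(ℝ, F) N)) v₀ := by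
  have : CompleteSpace F := FiniteDimensional.complete ℝ F
  have h0 := hγ v₀ t₀ (hI v₀ ht₀)
  set p := γ v₀ t₀ with hp
  have hps : γ v₀ t₀ ∈ (chartAt F p).source := mem_chart_source F p
  have htgt : extChartAt 𝓘(ℝ, F) p p ∈ (extChartAt 𝓘(ℝ, F) p).target := mem_extChartAt_target p
  obtain ⟨ε₁, hε₁, Φ, hΦ0, hΦ⟩ := exists_geodesic_family
    (u₀ := deriv (extChartAt 𝓘(ℝ, F) p ∘ γ v₀) t₀) (contDiffAt_christoffel hN htgt)
    (extChartAt_target_mem_nhds (I := 𝓘(ℝ, F)) p)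
  have hb : chartState p (γ v₀) t₀ ∈ ball (extChartAt 𝓘(ℝ, F) p p,
      deriv (extChartAt 𝓘(ℝ, F) p ∘ γ v₀) t₀) ε₁ := by
    rw [chartState, ← hp]; exact mem_ball_self hε₁
  obtain ⟨ε₂, hε₂, h2⟩ := Metric.eventually_nhds_iff_ball.1
    ((((h0.hasDerivAt_chartState hps).continuousAt.eventually_mem (isOpen_ball.mem_nhds hb))).and
      (h0.continuousAt.eventually (eventually_mem_source hps)))
  -- Times within `ε₁ / 2` of `t₀` differ by less than the lifetime `ε₁` of the local flow, and `ε₂`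
  -- keeps the state of `γ v₀` in the domain of that flow.
  refine ⟨min (ε₁ / 2) ε₂, by positivity, fun t ht t' ht' htb htb' hA ↦ ?_⟩
  obtain ⟨hst, hsrc⟩ := h2 t (ball_subset_ball (min_le_right _ _) htb)
  have hd : t' - t ∈ Ioo (-ε₁) ε₁ := by
    have h1 := ball_subset_ball (min_le_left (ε₁ / 2) ε₂) htb
    have h2 := ball_subset_ball (min_le_left (ε₁ / 2) ε₂) htb'
    rw [Real.ball_eq_Ioo] at h1 h2
    constructor <;> linarith [h1.1, h1.2, h2.1, h2.2]
  obtain ⟨hpos, -⟩ := contMDiffAt_totalSpace.1 hA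
  have hpos : ContMDiffAt 𝓘(ℝ, V) 𝓘(ℝ, F) ω (fun v ↦ γ v t) v₀ := hpos
  have hvel := (contMDiffAt_along_iff hpos hsrc).1 hA
  have hposc := ((contMDiffAt_iff_target_of_mem_source (f := fun v ↦ γ v t) (x := v₀) hsrc).1 hpos).2
  let σ : V → F × F := fun v ↦ (extChartAt 𝓘(ℝ, F) p (γ v t),
    toChart p (γ v t) (velocity (F := F) (γ v) t))
  have hσ : ContDiffAt ℝ ω σ v₀ := hposc.contDiffAt.prodMk hvel.contDiffAt
  have hσ' {v : V} (hv : γ v t ∈ (chartAt F p).source) : chartState p (γ v) t = σ v :=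
    chartState_eq hv ((hγ v t (hI v ht)).1.of_le (by norm_cast))
  have hσ0 : σ v₀ ∈ ball (extChartAt 𝓘(ℝ, F) p p,
      deriv (extChartAt 𝓘(ℝ, F) p ∘ γ v₀) t₀) ε₁ := by
    rw [← hσ' hsrc]; exact hst
  -- By uniqueness of geodesics the state at `t'` is the analytic flow applied to the state at `t`.
  -- Nothing is assumed about how the family depends on `v` beyond analyticity at time `t`.
  have key : ∀ᶠ v in 𝓝 v₀, γ v t' = (extChartAt 𝓘(ℝ, F) p).symm (Φ (t' - t, σ v)).1 ∧
      chartState p (γ v) t' = Φ (t' - t, σ v) := by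
    filter_upwards [hσ.continuousAt.eventually_mem (isOpen_ball.mem_nhds hσ0),
      hpos.continuousAt.eventually (eventually_mem_source hsrc)] with v hv hvs
    have hgeo (s : ℝ) (hs : s ∈ Ioo (t - ε₁) (t + ε₁)) :=
      isGeodesicAt_of_hasDerivAt (nabla := nabla) (p := p) (c := fun s ↦ Φ (s - t, σ v)) (t := s) (by
        have h5 := (hΦ (s - t, σ v) ⟨⟨by linarith [hs.1], by linarith [hs.2]⟩, hv⟩).1
        have h6 : ContDiffAt ℝ ω (fun s : ℝ ↦ (s - t, σ v)) s :=
          (contDiffAt_id.sub contDiffAt_const).prodMk contDiffAt_const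
        exact (ContDiffAt.comp s (g := Φ) h5 h6).of_le le_top)
        (by
          filter_upwards [isOpen_Ioo.mem_nhds hs] with r hr
          have h5 := (hΦ (r - t, σ v) ⟨⟨by linarith [hr.1], by linarith [hr.2]⟩, hv⟩).2.1
          simpa using HasDerivAt.comp_sub_const r t h5)
        (hΦ (s - t, σ v) ⟨⟨by linarith [hs.1], by linarith [hs.2]⟩, hv⟩).2.2.2
    have htt : t ∈ Ioo (t - ε₁) (t + ε₁) := ⟨by linarith, by linarith⟩
    have htt' : t' ∈ Ioo (t - ε₁) (t + ε₁) := ⟨by linarith [hd.1], by linarith [hd.2]⟩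
    have hstart : (fun s ↦ (extChartAt 𝓘(ℝ, F) p).symm (Φ (s - t, σ v)).1) t = γ v t := by
      simp only [sub_self, hΦ0 _ hv, σ]
      exact chart_symm_apply hvs
    have heq := eventuallyEq_of_isGeodesicAt hN (J := Ioo (t - ε₁) (t + ε₁) ∩ J v)
      (isOpen_Ioo.inter (hJo v)) (ordConnected_Ioo.inter (hJ v)).isPreconnected
      (fun s hs ↦ (hgeo s hs.1).1) (fun s hs ↦ hγ v s hs.2) ⟨htt, hI v ht⟩
      (eq_of_chartState_eq (p := p) (by have h6 := hvs; rw [← hstart] at h6; exact h6)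
        ((hgeo t htt).1.1.of_le (by norm_cast)) hvs
        ((hgeo t htt).2.trans (by simp only [sub_self, hΦ0 _ hv, σ]))) t' ⟨htt', hI v ht'⟩
    refine ⟨heq.self_of_nhds.symm, ?_⟩
    rw [← (hgeo t' htt').2]
    have h6 := heq.fun_comp (extChartAt 𝓘(ℝ, F) p)
    exact Prod.ext h6.symm.self_of_nhds h6.symm.deriv_eq
  have hΦσ : ContDiffAt ℝ ω (fun v ↦ Φ (t' - t, σ v)) v₀ :=
    ContDiffAt.comp v₀ (g := Φ) (hΦ (t' - t, σ v₀) ⟨hd, hσ0⟩).1 (contDiffAt_const.prodMk hσ)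
  have htgt' := (hΦ (t' - t, σ v₀) ⟨hd, hσ0⟩).2.2.2
  have hpos' : ContMDiffAt 𝓘(ℝ, V) 𝓘(ℝ, F) ω (fun v ↦ γ v t') v₀ := by
    have h7 : ContMDiffAt 𝓘(ℝ, V) 𝓘(ℝ, F) ω
        (fun v ↦ (extChartAt 𝓘(ℝ, F) p).symm (Φ (t' - t, σ v)).1) v₀ :=
      ContMDiffAt.comp v₀ (g := (extChartAt 𝓘(ℝ, F) p).symm) (f := fun v ↦ (Φ (t' - t, σ v)).1)
        ((contMDiffOn_extChartAt_symm p).contMDiffAt ((isOpen_extChartAt_target p).mem_nhds htgt'))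
        hΦσ.fst.contMDiffAt
    exact h7.congr_of_eventuallyEq (key.mono fun v hv ↦ hv.1)
  have hsrc' : γ v₀ t' ∈ (chartAt F p).source := by
    rw [key.self_of_nhds.1]
    simpa using (extChartAt 𝓘(ℝ, F) p).map_target htgt'
  refine (contMDiffAt_along_iff hpos' hsrc').2 (hΦσ.snd.contMDiffAt.congr_of_eventuallyEq ?_)
  filter_upwards [key, hpos'.continuousAt.eventually (eventually_mem_source hsrc')] with v h8 h9
  rw [← h8.2, chartState_eq h9 ((hγ v t' (hI v ht')).1.of_le (by norm_cast))]

/-- The exponential map at `y` of a complete connection is analytic. -/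
theorem exists_analytic_exp [T2Space N] (hN : IsAnalyticConnection nabla)
    (hcomplete : IsGeodesicallyComplete nabla) (y : N) :
    ∃ e : F → N, (∀ v, ContMDiffAt 𝓘(ℝ, F) 𝓘(ℝ, F) ω e v) ∧
      ∀ (v : F) (γ : ℝ → N) (J : Set ℝ), IsOpen J → J.OrdConnected → 0 ∈ J → 1 ∈ J →
        (∀ s ∈ J, IsGeodesicAt nabla γ s) →
        (⟨γ 0, velocity (F := F) γ 0⟩ : TangentBundle 𝓘(ℝ, F) N) = ⟨y, ofChart y y v⟩ →
        γ 1 = e v := by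
  have hex (v : F) : ofChart y y v ∈ expDomain nabla y := hcomplete y ▸ mem_univ _
  choose J γ hJo hJ h0 h1 hγ hγ0 using hex
  replace hγ (v : F) := (isGeodesicOn_iff (hJo v)).1 (hγ v)
  refine ⟨fun v ↦ γ v 1, fun v₀ ↦ ?_, fun v δ K hKo hK hK0 hK1 hδ hδ0 ↦ ?_⟩
  · let A : ℝ → Prop := fun t ↦ ContMDiffAt 𝓘(ℝ, F) 𝓘(ℝ, F).tangent ω
        (fun v ↦ (⟨γ v t, velocity (F := F) (γ v) t⟩ : TangentBundle 𝓘(ℝ, F) N)) v₀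
    have hI (v : F) : Icc 0 1 ⊆ J v := (hJ v).out (h0 v) (h1 v)
    have hA : A 0 → A 1 := by
      -- Local propagation in both time directions, together with connectedness of `[0, 1]`,
      -- replaces the choice of a uniform time step.
      refine isPreconnected_Icc.induction₂' (s := Icc (0 : ℝ) 1) (fun s t ↦ A s → A t)
        (fun t ht ↦ ?_) (fun s t u hs ht hu hst htu h ↦ htu (hst h)) (left_mem_Icc.2 zero_le_one)
        (right_mem_Icc.2 zero_le_one)
      obtain ⟨ε, hε, h⟩ := exists_contMDiffAt_geodesics_of_contMDiffAt hN hJo hJ hγ (v₀ := v₀) hI ht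
      filter_upwards [self_mem_nhdsWithin, mem_nhdsWithin_of_mem_nhds (ball_mem_nhds t hε)] with s hs hs'
      exact ⟨h t ht s hs (mem_ball_self hε) hs', h s hs t ht hs' (mem_ball_self hε)⟩
    have hA0 : A 0 := by
      simp only [A, hγ0]
      refine (contMDiffAt_along_iff contMDiffAt_const (mem_chart_source F y)).2 ?_
      simp only [toChart_ofChart (mem_chart_source F y)]
      exact contMDiffAt_id
    exact (contMDiffAt_totalSpace.1 (hA hA0)).1
  · exact (eventuallyEq_of_isGeodesicAt hN (hKo.inter (hJo v)) (hK.inter (hJ v)).isPreconnected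
      (fun s hs ↦ hδ s hs.1) (fun s hs ↦ hγ v s hs.2) ⟨hK0, h0 v⟩ (hδ0.trans (hγ0 v).symm) 1
      ⟨hK1, h1 v⟩).self_of_nhds

end Exponential

/-! ### Extension and uniqueness of affine germs. -/

section Extension
open Set Filter Metric
set_option maxSynthPendingDepth 3
set_option linter.unusedSectionVars false

variable {E : Type*} [NormedAddCommGroup E] [NormedSpace ℝ E] [FiniteDimensional ℝ E]
  {M : Type*} [TopologicalSpace M] [ChartedSpace E M] [IsManifold 𝓘(ℝ, E) ω M]
  {F : Type*} [NormedAddCommGroup F] [NormedSpace ℝ F] [FiniteDimensional ℝ F]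
  {N : Type*} [TopologicalSpace N] [ChartedSpace F N] [IsManifold 𝓘(ℝ, F) ω N]
  {nablaM : Connection E M} {nablaN : Connection F N} {f g : M → N} {x : M}

lemma velocity_comp {γ : ℝ → M} {s : ℝ} (hf : ContMDiffAt 𝓘(ℝ, E) 𝓘(ℝ, F) 1 f (γ s))
    (hγ : ContMDiffAt 𝓘(ℝ, ℝ) 𝓘(ℝ, E) 1 γ s) : velocity (F := F) (f ∘ γ) s =
      mfderiv 𝓘(ℝ, E) 𝓘(ℝ, F) f (γ s) (velocity (F := E) γ s) := by
  rw [velocity, mfderiv_comp s (hf.mdifferentiableAt (by simp)) (hγ.mdifferentiableAt (by simp))]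
  rfl

/-- Affine maps send geodesics to geodesics. -/
theorem IsAffineAt.isGeodesicAt_comp {γ : ℝ → M} {s : ℝ} (hf : IsAffineAt nablaM nablaN f (γ s))
    (hγ : IsGeodesicAt nablaM γ s) : IsGeodesicAt nablaN (f ∘ γ) s := by
  obtain ⟨q, hq⟩ : ∃ q : M, γ s ∈ (chartAt E q).source := ⟨_, mem_chart_source E _⟩
  obtain ⟨p, hp⟩ : ∃ p : N, f (γ s) ∈ (chartAt F p).source := ⟨_, mem_chart_source F _⟩
  obtain ⟨hf1, hf2⟩ := (isAffineAt_iff hq hp).1 hf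
  obtain ⟨hγ1, hγ2⟩ := (isGeodesicAt_iff hq).1 hγ
  have hκ := ((contMDiffAt_curve_iff hq).1 hγ1).2
  have hφ := ((contMDiffAt_iff_chartMap hq hp).1 hf1).2
  have hfγ : ContMDiffAt 𝓘(ℝ, ℝ) 𝓘(ℝ, F) ∞ (f ∘ γ) s := hf1.comp s hγ1
  have e1 : extChartAt 𝓘(ℝ, F) p ∘ (f ∘ γ) =ᶠ[𝓝 s]
      chartMap q p f ∘ (extChartAt 𝓘(ℝ, E) q ∘ γ) := by
    filter_upwards [hγ.continuousAt.eventually (eventually_mem_source hq)] with r hr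
    exact (chartMap_apply hr).symm
  rw [isGeodesicAt_iff (p := p) (γ := f ∘ γ) hp]
  refine ⟨hfγ, ?_⟩
  have h5 := hf2 (deriv (extChartAt 𝓘(ℝ, E) q ∘ γ) s) (deriv (extChartAt 𝓘(ℝ, E) q ∘ γ) s)
  have h7 : extChartAt 𝓘(ℝ, F) p ((f ∘ γ) s) = chartMap q p f (extChartAt 𝓘(ℝ, E) q (γ s)) :=
    e1.self_of_nhds
  rw [h7, e1.deriv.deriv_eq, e1.deriv_eq]
  change ContDiffAt ℝ ∞ (chartMap q p f) ((extChartAt 𝓘(ℝ, E) q ∘ γ) s) at hφ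
  change fderiv ℝ (fderiv ℝ (chartMap q p f)) ((extChartAt 𝓘(ℝ, E) q ∘ γ) s) _ _
    + christoffel nablaN p (chartMap q p f ((extChartAt 𝓘(ℝ, E) q ∘ γ) s))
      (fderiv ℝ (chartMap q p f) ((extChartAt 𝓘(ℝ, E) q ∘ γ) s) _)
      (fderiv ℝ (chartMap q p f) ((extChartAt 𝓘(ℝ, E) q ∘ γ) s) _)
    = fderiv ℝ (chartMap q p f) ((extChartAt 𝓘(ℝ, E) q ∘ γ) s)
      (christoffel nablaM q ((extChartAt 𝓘(ℝ, E) q ∘ γ) s) _ _) at h5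
  change _ + christoffel nablaM q ((extChartAt 𝓘(ℝ, E) q ∘ γ) s) _ _ = 0 at hγ2
  change _ + christoffel nablaN p (chartMap q p f ((extChartAt 𝓘(ℝ, E) q ∘ γ) s)) _ _ = 0
  -- What remains is the chain rule `(φ ∘ κ)'' = D²φ (κ', κ') + Dφ κ''`, combined with the geodesic
  -- equation for `κ` and the affine equation for `φ`.
  generalize extChartAt 𝓘(ℝ, E) q ∘ γ = κ at *
  generalize chartMap (E := E) (F := F) q p f = φ at *
  have hκ2 := hκ.of_le (show (2 : WithTop ℕ∞) ≤ ∞ by norm_cast)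
  have hφ2 := hφ.of_le (show (2 : WithTop ℕ∞) ≤ ∞ by norm_cast)
  have e2 : deriv (φ ∘ κ) =ᶠ[𝓝 s] fun r ↦ fderiv ℝ φ (κ r) (deriv κ r) := by
    filter_upwards [hκ2.eventually (by simp),
      hκ.continuousAt.eventually (hφ2.eventually (by simp))] with r h2 h3
    exact ((h3.differentiableAt (by simp)).hasFDerivAt.comp_hasDerivAt r
      (h2.differentiableAt (by simp)).hasDerivAt).deriv
  have hκ' : HasDerivAt (deriv κ) (deriv (deriv κ) s) s :=
    DifferentiableAt.hasDerivAt ((((hκ2.fderiv_right (m := 1) (by norm_num)).clm_apply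
      contDiffAt_const).differentiableAt (by simp)))
  have e3 := (((hφ2.fderiv_right (m := 1) (by norm_num)).differentiableAt
    (by simp)).hasFDerivAt.comp_hasDerivAt s
      (hκ2.differentiableAt (by simp)).hasDerivAt).clm_apply hκ'
  have e4 : deriv (fun r ↦ fderiv ℝ φ (κ r) (deriv κ r)) s
      = fderiv ℝ (fderiv ℝ φ) (κ s) (deriv κ s) (deriv κ s)
        + fderiv ℝ φ (κ s) (deriv (deriv κ) s) := e3.deriv
  have h6 := congrArg (fderiv ℝ φ (κ s)) hγ2
  rw [map_add, map_zero, ← h5] at h6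
  rw [e2.deriv_eq, e2.self_of_nhds, e4, ← h6]
  abel

/-- Affinity of an analytic map propagates. -/
theorem IsAffineAt.of_isPreconnected (hM : IsAnalyticConnection nablaM)
    (hN : IsAnalyticConnection nablaN) {W : Set M} (hW : IsPreconnected W)
    (hg : ∀ x ∈ W, ContMDiffAt 𝓘(ℝ, E) 𝓘(ℝ, F) ω g x) {x₀ : M} (hx₀ : x₀ ∈ W)
    (h₀ : ∀ᶠ x in 𝓝 x₀, IsAffineAt nablaM nablaN g x) : ∀ x ∈ W, IsAffineAt nablaM nablaN g x := by
  have : CompleteSpace E := FiniteDimensional.complete ℝ E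
  have : CompleteSpace F := FiniteDimensional.complete ℝ F
  have hu : IsOpen {x | ∀ᶠ y in 𝓝 x, IsAffineAt nablaM nablaN g y} :=
    isOpen_setOfPred_eventually_nhds
  suffices W ⊆ {x | ∀ᶠ y in 𝓝 x, IsAffineAt nablaM nablaN g y} from
    fun x hx ↦ (this hx).self_of_nhds
  refine hW.subset_of_closure_inter_subset hu ⟨x₀, hx₀, h₀⟩ fun x ⟨hx, hxW⟩ ↦ ?_
  have hq := mem_chart_source E x
  have hp := mem_chart_source F (g x)
  obtain ⟨hc, hφ⟩ := (contMDiffAt_iff_chartMap hq hp).1 (hg x hxW)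
  have hgx : chartMap x (g x) g (extChartAt 𝓘(ℝ, E) x x) = extChartAt 𝓘(ℝ, F) (g x) (g x) :=
    chartMap_apply hq
  obtain ⟨δ, hδ, hball⟩ := Metric.eventually_nhds_iff_ball.1
    ((eventually_chart_symm_mem hq).and ((hφ.eventually (by simp)).and
      ((hφ.continuousAt.eventually_mem (by rw [hgx]; exact extChartAt_target_mem_nhds (g x))).and
        ((tendsto_chart_symm hq).eventually (hc.eventually (eventually_mem_source hp))))))
  -- For fixed `u` and `w` the defect in the affine equation is an analytic function on a convex
  -- ball, so it vanishes there once it vanishes near one point.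
  have hana (u w : E) : AnalyticOnNhd ℝ (fun z ↦
      fderiv ℝ (fderiv ℝ (chartMap x (g x) g)) z u w
      + christoffel nablaN (g x) (chartMap x (g x) g z) (fderiv ℝ (chartMap x (g x) g) z u)
        (fderiv ℝ (chartMap x (g x) g) z w)
      - fderiv ℝ (chartMap x (g x) g) z (christoffel nablaM x z u w))
      (ball (extChartAt 𝓘(ℝ, E) x x) δ) := by
    intro z hz
    obtain ⟨h1, h2, h3, -⟩ := hball z hz
    have h4 := h2.fderiv_right (m := ω) le_rfl
    have h5 := h4.fderiv_right (m := ω) le_rfl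
    have h6 : ContDiffAt ℝ ω (fun z ↦ christoffel nablaN (g x) (chartMap x (g x) g z)) z :=
      ContDiffAt.comp z (g := christoffel nablaN (g x)) (contDiffAt_christoffel hN h3) h2
    exact ((((h5.clm_apply contDiffAt_const).clm_apply contDiffAt_const).add
      ((h6.clm_apply (h4.clm_apply contDiffAt_const)).clm_apply
        (h4.clm_apply contDiffAt_const))).sub (h4.clm_apply
          (((contDiffAt_christoffel hM h1).clm_apply contDiffAt_const).clm_apply
            contDiffAt_const))).analyticAt
  have hiff (z : E) (hz : z ∈ ball (extChartAt 𝓘(ℝ, E) x x) δ) :=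
    isAffineAt_iff (nablaM := nablaM) (nablaN := nablaN) (f := g) (p := g x)
      (x := (extChartAt 𝓘(ℝ, E) x).symm z) (q := x)
      (by simpa using (extChartAt 𝓘(ℝ, E) x).map_target (hball z hz).1) (hball z hz).2.2.2
  have hnear : ∀ᶠ y in 𝓝 x, y ∈ (chartAt E x).source ∧
      extChartAt 𝓘(ℝ, E) x y ∈ ball (extChartAt 𝓘(ℝ, E) x x) δ :=
    (eventually_mem_source hq).and
      ((continuousAt_extChartAt x).eventually_mem (ball_mem_nhds _ hδ))
  obtain ⟨y, ⟨hy, hyb⟩, hyu⟩ := mem_closure_iff_nhds.1 hx _ hnear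
  have hyu : ∀ᶠ y' in 𝓝 y, IsAffineAt nablaM nablaN g y' := hyu
  have hzero (u w : E) := (hana u w).eqOn_zero_of_preconnected_of_eventuallyEq_zero
    (convex_ball _ _).isPreconnected hyb (by
      filter_upwards [(tendsto_chart_symm hy).eventually hyu, isOpen_ball.mem_nhds hyb] with z h1 h2
      have h3 := ((hiff z h2).1 h1).2 u w
      rw [(extChartAt 𝓘(ℝ, E) x).right_inv (hball z h2).1] at h3
      exact sub_eq_zero.2 h3)
  filter_upwards [hnear, eventually_contMDiffAt (by simp) (hg x hxW)] with y' h1 h2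
  have h3 := hiff _ h1.2
  rw [chart_symm_apply h1.1] at h3
  exact h3.2 ⟨h2.of_le le_top, fun u w ↦ sub_eq_zero.1 (hzero u w h1.2)⟩

/-- Analytic maps between manifolds which agree near a point of a connected set agree on this
set. -/
theorem eventuallyEq_of_contMDiffAt_omega [T2Space N] {W : Set M} (hW : IsPreconnected W)
    (hf : ∀ x ∈ W, ContMDiffAt 𝓘(ℝ, E) 𝓘(ℝ, F) ω f x)
    (hg : ∀ x ∈ W, ContMDiffAt 𝓘(ℝ, E) 𝓘(ℝ, F) ω g x) {x₀ : M} (hx₀ : x₀ ∈ W)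
    (h₀ : f =ᶠ[𝓝 x₀] g) : ∀ x ∈ W, f =ᶠ[𝓝 x] g := by
  have : CompleteSpace E := FiniteDimensional.complete ℝ E
  have : CompleteSpace F := FiniteDimensional.complete ℝ F
  have hu : IsOpen {x | f =ᶠ[𝓝 x] g} := isOpen_setOfPred_eventually_nhds
  refine hW.subset_of_closure_inter_subset hu ⟨x₀, hx₀, h₀⟩ fun x ⟨hx, hxW⟩ ↦ ?_
  have hsub : {x | f =ᶠ[𝓝 x] g} ⊆ {x | f x = g x} := fun y hy ↦ hy.self_of_nhds
  have hfg : f x = g x := eq_of_mem_closure_setOf_eq (hf x hxW).continuousAt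
    (hg x hxW).continuousAt (closure_mono hsub hx)
  have hq := mem_chart_source E x
  have hp := mem_chart_source F (f x)
  have hp' : g x ∈ (chartAt F (f x)).source := hfg ▸ hp
  obtain ⟨hfc, hfa⟩ := (contMDiffAt_iff_chartMap hq hp).1 (hf x hxW)
  obtain ⟨hgc, hga⟩ := (contMDiffAt_iff_chartMap hq hp').1 (hg x hxW)
  obtain ⟨δ, hδ, hball⟩ := Metric.eventually_nhds_iff_ball.1
    ((hfa.eventually (by simp)).and (hga.eventually (by simp)))
  have hnear : ∀ᶠ y in 𝓝 x, y ∈ (chartAt E x).source ∧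
      extChartAt 𝓘(ℝ, E) x y ∈ ball (extChartAt 𝓘(ℝ, E) x x) δ :=
    (eventually_mem_source hq).and
      ((continuousAt_extChartAt x).eventually_mem (ball_mem_nhds _ hδ))
  obtain ⟨y, ⟨hy, hyb⟩, hyu⟩ := mem_closure_iff_nhds.1 hx _ hnear
  have hyu : f =ᶠ[𝓝 y] g := hyu
  have heq := AnalyticOnNhd.eqOn_of_preconnected_of_eventuallyEq
    (f := chartMap (F := F) x (f x) f) (g := chartMap x (f x) g)
    (fun z hz ↦ (hball z hz).1.analyticAt) (fun z hz ↦ (hball z hz).2.analyticAt)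
    (convex_ball (extChartAt 𝓘(ℝ, E) x x) δ).isPreconnected hyb (by
      filter_upwards [(tendsto_chart_symm hy).eventually hyu] with z h1
      simp only [chartMap, h1])
  change f =ᶠ[𝓝 x] g
  filter_upwards [hnear, hfc.eventually (eventually_mem_source hp),
    hgc.eventually (eventually_mem_source hp')] with y' h1 h2 h3
  have h4 := heq h1.2
  rw [chartMap_apply h1.1, chartMap_apply h1.1] at h4
  rw [← chart_symm_apply h2, h4, chart_symm_apply h3]

/-- Affine maps defined near some point of a suitable neighbourhood of `p` extend to this
neighbourhood. -/
theorem exists_nhds_affine_extension [T2Space N] (hM : IsAnalyticConnection nablaM)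
    (hN : IsAnalyticConnection nablaN) (hcomplete : IsGeodesicallyComplete nablaN) (p : M) :
    ∃ W : Set M, p ∈ W ∧ IsOpen W ∧ IsPreconnected W ∧ ∀ x ∈ W, ∀ f : M → N,
      (∀ᶠ y in 𝓝 x, IsAffineAt nablaM nablaN f y) → ∃ g : M → N, f =ᶠ[𝓝 x] g ∧
        ∀ y ∈ W, ContMDiffAt 𝓘(ℝ, E) 𝓘(ℝ, F) ω g y ∧ IsAffineAt nablaM nablaN g y := by
  have : CompleteSpace E := FiniteDimensional.complete ℝ E
  obtain ⟨r, hr, L, c, hB, hcc, hc⟩ := exists_chart_geodesics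
    (contDiffAt_christoffel hM (mem_extChartAt_target p)) (extChartAt_target_mem_nhds (I := 𝓘(ℝ, E)) p)
  have hWeq := (extChartAt 𝓘(ℝ, E) p).symm_image_eq_source_inter_preimage hB
  have hWo : IsOpen ((extChartAt 𝓘(ℝ, E) p).source ∩
      extChartAt 𝓘(ℝ, E) p ⁻¹' ball (extChartAt 𝓘(ℝ, E) p p) r) :=
    (continuousOn_extChartAt p).isOpen_inter_preimage (isOpen_extChartAt_source p) isOpen_ball
  have hWc : IsPreconnected ((extChartAt 𝓘(ℝ, E) p).source ∩
      extChartAt 𝓘(ℝ, E) p ⁻¹' ball (extChartAt 𝓘(ℝ, E) p p) r) :=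
    hWeq ▸ (convex_ball _ r).isPreconnected.image _ ((continuousOn_extChartAt_symm p).mono hB)
  -- `W` is a coordinate ball on which initial velocities of joining geodesics depend analytically
  -- on the end points. It is fixed before `x` and `f`, as the covering argument requires.
  refine ⟨(extChartAt 𝓘(ℝ, E) p).source ∩
    extChartAt 𝓘(ℝ, E) p ⁻¹' ball (extChartAt 𝓘(ℝ, E) p p) r,
    ⟨mem_extChartAt_source p, mem_ball_self hr⟩, hWo, hWc, fun x ⟨hxs, hxb⟩ f hf ↦ ?_⟩
  have hx : x ∈ (chartAt E p).source := by simpa using hxs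
  obtain ⟨e, he, hexp⟩ := exists_analytic_exp hN hcomplete (f x)
  let A : E →L[ℝ] F :=
    toChart (f x) (f x) ∘L mfderiv 𝓘(ℝ, E) 𝓘(ℝ, F) f x ∘L ofChart p x
  -- This is `exp ∘ df_x ∘ exp_x⁻¹`. Since `N` is complete, `e` accepts every vector, however large
  -- `df_x` is.
  let g : M → N := fun y ↦ e (A (L (extChartAt 𝓘(ℝ, E) p x, extChartAt 𝓘(ℝ, E) p y)))
  have hga (y : M) (hy : y ∈ (extChartAt 𝓘(ℝ, E) p).source ∩
      extChartAt 𝓘(ℝ, E) p ⁻¹' ball (extChartAt 𝓘(ℝ, E) p p) r) :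
      ContMDiffAt 𝓘(ℝ, E) 𝓘(ℝ, F) ω g y := by
    have h1 : ContDiffAt ℝ ω (fun z ↦ A (L (extChartAt 𝓘(ℝ, E) p x, z)))
        (extChartAt 𝓘(ℝ, E) p y) :=
      A.contDiff.contDiffAt.comp _ (ContDiffAt.comp (extChartAt 𝓘(ℝ, E) p y) (g := L)
        (hc (_, _) ⟨hxb, hy.2⟩).1 (contDiffAt_const.prodMk contDiffAt_id))
    exact (he _).comp y (ContMDiffAt.comp y (g := fun z ↦ A (L (extChartAt 𝓘(ℝ, E) p x, z)))
      h1.contMDiffAt (contMDiffAt_extChartAt' (by simpa using hy.1)))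
  have hfg : f =ᶠ[𝓝 x] g := by
    have hxx := hcc _ hxb
    -- For `y = x` the geodesic is constant, so by compactness, for `y` near `x` it stays where `f`
    -- is affine. The bound `3 / 2` gives a compact interval inside `(-2, 2)` whose interior
    -- contains `[0, 1]`.
    have hev : ∀ᶠ y in 𝓝 x, ∀ t ∈ Icc (-(3 / 2) : ℝ) (3 / 2), IsAffineAt nablaM nablaN f
        ((extChartAt 𝓘(ℝ, E) p).symm
          (c (t, (extChartAt 𝓘(ℝ, E) p x, extChartAt 𝓘(ℝ, E) p y))).1) := by
      refine isCompact_Icc.eventually_forall_of_forall_eventually fun t ht ↦ ?_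
      have ht2 : t ∈ Ioo (-2 : ℝ) 2 := ⟨by linarith [ht.1], by linarith [ht.2]⟩
      have h1 : Tendsto (fun q : M × ℝ ↦ (c (q.2, (extChartAt 𝓘(ℝ, E) p x,
          extChartAt 𝓘(ℝ, E) p q.1))).1) (𝓝 (x, t)) (𝓝 (extChartAt 𝓘(ℝ, E) p x)) := by
        have h2 : ContinuousAt (fun q : M × ℝ ↦ (q.2, (extChartAt 𝓘(ℝ, E) p x,
          extChartAt 𝓘(ℝ, E) p q.1))) (x, t) :=
          continuousAt_snd.prodMk (continuousAt_const.prodMk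
            (ContinuousAt.comp (g := extChartAt 𝓘(ℝ, E) p) (f := Prod.fst)
              (continuousAt_extChartAt' hxs) continuousAt_fst))
        have h3 := ContinuousAt.comp (g := c) (x := (x, t))
          ((hc (extChartAt 𝓘(ℝ, E) p x, extChartAt 𝓘(ℝ, E) p x) ⟨hxb, hxb⟩).2.2.2 t
            ht2).1.continuousAt h2
        have h4 := h3.fst.tendsto
        simp only [Function.comp_apply, hxx t ht2] at h4
        exact h4
      exact h1.eventually ((tendsto_chart_symm hx).eventually hf)
    filter_upwards [hev, hWo.mem_nhds ⟨hxs, hxb⟩] with y hy hyW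
    obtain ⟨-, hc0, hc1, hct⟩ := hc (extChartAt 𝓘(ℝ, E) p x, extChartAt 𝓘(ℝ, E) p y) ⟨hxb, hyW.2⟩
    let γ : ℝ → M := fun t ↦ (extChartAt 𝓘(ℝ, E) p).symm
      (c (t, (extChartAt 𝓘(ℝ, E) p x, extChartAt 𝓘(ℝ, E) p y))).1
    have hγ (t : ℝ) (ht : t ∈ Ioo (-2 : ℝ) 2) : IsGeodesicAt nablaM γ t ∧
        chartState p γ t = c (t, (extChartAt 𝓘(ℝ, E) p x, extChartAt 𝓘(ℝ, E) p y)) := by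
      refine isGeodesicAt_of_hasDerivAt (p := p)
        (c := fun t ↦ c (t, (extChartAt 𝓘(ℝ, E) p x, extChartAt 𝓘(ℝ, E) p y))) ?_ ?_ (hct t ht).2.2.2
      · exact (ContDiffAt.comp t (g := c) (hct t ht).1
          (contDiffAt_id.prodMk contDiffAt_const)).of_le le_top
      · filter_upwards [isOpen_Ioo.mem_nhds ht] with s hs using (hct s hs).2.1
    have hγ0 : γ 0 = x := by simp only [γ, hc0, chart_symm_apply hx]
    have hγ1 : γ 1 = y := by simp only [γ, hc1, (extChartAt 𝓘(ℝ, E) p).left_inv hyW.1]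
    have h0 : (0 : ℝ) ∈ Ioo (-2 : ℝ) 2 := by norm_num
    have hstart : (⟨γ 0, velocity (F := E) γ 0⟩ : TangentBundle 𝓘(ℝ, E) M)
        = ⟨x, ofChart p x (L (extChartAt 𝓘(ℝ, E) p x, extChartAt 𝓘(ℝ, E) p y))⟩ := by
      refine eq_of_chartState_eq (p := p) (hγ0 ▸ hx) ((hγ 0 h0).1.1.of_le (by norm_cast)) hx ?_
      rw [(hγ 0 h0).2, hc0, toChart_ofChart hx]
    have h1 := hexp (A (L (extChartAt 𝓘(ℝ, E) p x, extChartAt 𝓘(ℝ, E) p y))) (f ∘ γ)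
      (Ioo (-(3 / 2)) (3 / 2)) isOpen_Ioo ordConnected_Ioo (by norm_num) (by norm_num)
      (fun s hs ↦ (hy s ⟨hs.1.le, hs.2.le⟩).isGeodesicAt_comp
        (hγ s ⟨by linarith [hs.1], by linarith [hs.2]⟩).1) (by
        have h2 := congrArg (tangentMap 𝓘(ℝ, E) 𝓘(ℝ, F) f) hstart
        simp only [A, ContinuousLinearMap.comp_apply, ofChart_toChart (mem_chart_source F (f x))]
        rw [velocity_comp ((hy 0 (by norm_num)).1.of_le (by norm_cast))
          ((hγ 0 h0).1.1.of_le (by norm_cast))]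
        exact h2)
    rw [Function.comp_apply, hγ1] at h1
    exact h1
  refine ⟨g, hfg, fun y hy ↦ ⟨hga y hy, ?_⟩⟩
  -- Near `x` the map `g` is `f`, hence affine; analyticity spreads affinity over `W`.
  exact IsAffineAt.of_isPreconnected hM hN hWc hga ⟨hxs, hxb⟩ (by
    filter_upwards [hf, hfg.eventuallyEq_nhds] with z h1 h2 using h1.congr h2) y hy

/-- Affine maps are analytic. -/
lemma contMDiffAt_omega_of_isAffineAt [T2Space N] (hM : IsAnalyticConnection nablaM)
    (hN : IsAnalyticConnection nablaN) (hcomplete : IsGeodesicallyComplete nablaN)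
    (hf : ∀ᶠ y in 𝓝 x, IsAffineAt nablaM nablaN f y) : ContMDiffAt 𝓘(ℝ, E) 𝓘(ℝ, F) ω f x := by
  obtain ⟨W, hx, -, -, h⟩ := exists_nhds_affine_extension hM hN hcomplete x
  obtain ⟨g, hfg, hg⟩ := h x hx f hf
  exact (hg x hx).1.congr_of_eventuallyEq hfg

/-- Affine maps which agree near a point of a connected open set agree on this set. -/
theorem eventuallyEq_of_isAffineAt [T2Space N] (hM : IsAnalyticConnection nablaM)
    (hN : IsAnalyticConnection nablaN) (hcomplete : IsGeodesicallyComplete nablaN) {W : Set M}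
    (hWo : IsOpen W) (hW : IsPreconnected W) (hf : ∀ x ∈ W, IsAffineAt nablaM nablaN f x)
    (hg : ∀ x ∈ W, IsAffineAt nablaM nablaN g x) {x₀ : M} (hx₀ : x₀ ∈ W) (h₀ : f =ᶠ[𝓝 x₀] g) :
    ∀ x ∈ W, f =ᶠ[𝓝 x] g :=
  eventuallyEq_of_contMDiffAt_omega hW
    (fun x hx ↦ contMDiffAt_omega_of_isAffineAt hM hN hcomplete
      (by filter_upwards [hWo.mem_nhds hx] with y hy using hf y hy))
    (fun x hx ↦ contMDiffAt_omega_of_isAffineAt hM hN hcomplete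
      (by filter_upwards [hWo.mem_nhds hx] with y hy using hg y hy)) hx₀ h₀

end Extension

/-! ### The space of germs and the monodromy theorem. -/

section Monodromy
open Set Filter

variable {X α : Type*} [TopologicalSpace X]

/-- Germs of functions `f` at the points `x` with `P f x`, as a setoid on the pairs `(x, f)`. -/
def germSetoid (P : (X → α) → X → Prop) : Setoid {q : X × (X → α) // P q.2 q.1} where
  r q q' := q.1.1 = q'.1.1 ∧ q.1.2 =ᶠ[𝓝 q.1.1] q'.1.2
  iseqv := ⟨fun _ ↦ ⟨rfl, .rfl⟩, fun h ↦ ⟨h.1.symm, h.1 ▸ h.2.symm⟩,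
    fun h h' ↦ ⟨h.1.trans h'.1, h.2.trans (h.1 ▸ h'.2)⟩⟩

/-- The space of germs of functions `f` at the points `x` with `P f x`. -/
def GermSpace (P : (X → α) → X → Prop) : Type _ := Quotient (germSetoid P)

namespace GermSpace

variable {P : (X → α) → X → Prop} {f g : X → α} {x y : X}

/-- The germ of `f` at `x`. -/
def mk (f : X → α) (x : X) (h : P f x) : GermSpace P := Quotient.mk (germSetoid P) ⟨(x, f), h⟩

/-- The base point of a germ. -/
def base (e : GermSpace P) : X := 
  Quotient.lift (s := germSetoid P) (fun q ↦ q.1.1) (fun _ _ h ↦ And.left h) e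

lemma base_mk (h : P f x) : base (mk f x h) = x := rfl

lemma mk_eq_mk_iff (h : P f x) (h' : P g y) : mk f x h = mk g y h' ↔ x = y ∧ f =ᶠ[𝓝 x] g :=
  Quotient.eq (r := germSetoid P)

lemma exists_mk_eq (e : GermSpace P) : ∃ (f : X → α) (h : P f (base e)), mk f (base e) h = e := by
  obtain ⟨⟨⟨x, f⟩, h⟩, rfl⟩ := Quotient.exists_rep e
  exact ⟨f, h, rfl⟩

/-- The finest topology for which, for every `f`, taking the germ of `f` at `y` is continuous on the
set of `y` with `P f y`. -/
instance : TopologicalSpace (GermSpace P) where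
  IsOpen S := ∀ (x : X) (f : X → α) (h : P f x), mk f x h ∈ S →
    ∀ᶠ y in 𝓝 x, ∀ h' : P f y, mk f y h' ∈ S
  isOpen_univ := fun _ _ _ _ ↦ .of_forall fun _ _ ↦ mem_univ _
  isOpen_inter S T hS hT x f h hST := by
    filter_upwards [hS x f h hST.1, hT x f h hST.2] with y h1 h2 h' using ⟨h1 h', h2 h'⟩
  isOpen_sUnion 𝒮 h𝒮 x f h hS := by
    obtain ⟨S, hS, hfS⟩ := hS
    filter_upwards [h𝒮 S hS x f h hfS] with y h1 h' using ⟨S, hS, h1 h'⟩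

lemma isOpen_iff {S : Set (GermSpace P)} : IsOpen S ↔ ∀ (x : X) (f : X → α) (h : P f x),
    mk f x h ∈ S → ∀ᶠ y in 𝓝 x, ∀ h' : P f y, mk f y h' ∈ S := Iff.rfl

/-- The germs of `f` at the points of `W`. -/
def sheet (P : (X → α) → X → Prop) (f : X → α) (W : Set X) : Set (GermSpace P) :=
  {e | ∃ y ∈ W, ∃ h : P f y, e = mk f y h}

/-- Two functions with the same germ at a point have the same germs at all nearby points, and
`hcongr` moves `P` from one to the other. -/
lemma isOpen_sheet (hcongr : ∀ f g x, P f x → f =ᶠ[𝓝 x] g → P g x)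
    {W : Set X} (hW : IsOpen W) : IsOpen (sheet P f W) := by
  refine isOpen_iff.2 fun x g h ⟨y, hy, h1, h2⟩ ↦ ?_
  obtain ⟨rfl, h3⟩ := (mk_eq_mk_iff h h1).1 h2
  filter_upwards [h3.eventuallyEq_nhds, hW.mem_nhds hy] with z h4 h5 h6
  exact ⟨z, h5, hcongr g f z h6 h4, (mk_eq_mk_iff _ _).2 ⟨rfl, h4⟩⟩

/-- A sheet contains at most one germ over each base point, so it isolates that germ in the fibre.
-/
lemma discreteTopology_fiber (hcongr : ∀ f g x, P f x → f =ᶠ[𝓝 x] g → P g x)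
    (p : X) : DiscreteTopology (base (P := P) ⁻¹' {p}) := by
  rw [discreteTopology_iff_isOpen_singleton]
  rintro ⟨e, rfl⟩
  obtain ⟨f, h, he⟩ := exists_mk_eq e
  refine isOpen_induced_iff.2 ⟨sheet P f univ, isOpen_sheet hcongr isOpen_univ, ?_⟩
  ext ⟨e', he'⟩
  constructor
  · rintro ⟨y, -, hy, rfl⟩
    obtain rfl : y = base e := he'
    exact Subtype.ext he
  · intro h'
    obtain rfl : e' = e := congrArg Subtype.val h'
    exact ⟨_, mem_univ _, h, he.symm⟩

/-- The projection of the space of germs is a covering map if germs extend uniquely to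
neighbourhoods which do not depend on the germ. -/
theorem isCoveringMap_base (hcongr : ∀ f g x, P f x → f =ᶠ[𝓝 x] g → P g x)
    (hext : ∀ p : X, ∃ W : Set X, p ∈ W ∧ IsOpen W ∧
      (∀ x ∈ W, ∀ f, P f x → ∃ g, f =ᶠ[𝓝 x] g ∧ ∀ y ∈ W, P g y) ∧
      ∀ f g, (∀ y ∈ W, P f y) → (∀ y ∈ W, P g y) → ∀ x ∈ W, f =ᶠ[𝓝 x] g → ∀ y ∈ W, f =ᶠ[𝓝 y] g) :
    IsCoveringMap (base (P := P)) := by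
  intro p
  obtain ⟨W, hp, hW, hex, huniq⟩ := hext p
  have := discreteTopology_fiber (P := P) hcongr p
  have hi (i : base (P := P) ⁻¹' {p}) : ∃ g, ∃ h : ∀ y ∈ W, P g y, mk g p (h p hp) = i.1 := by
    obtain ⟨e, rfl⟩ := i
    obtain ⟨f, h, he⟩ := exists_mk_eq e
    obtain ⟨g, hg, hgP⟩ := hex _ hp f h
    exact ⟨g, hgP, ((mk_eq_mk_iff _ _).2 ⟨rfl, hg.symm⟩).trans he⟩
  choose g hg hgi using hi
  -- The sheets over `W` are indexed by the fibre over `p`. A germ at any point of `W` extends to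
  -- `W`, and by uniqueness lies on the sheet indexed by the germ of its extension at `p`.
  have hcov : base (P := P) ⁻¹' W ⊆ ⋃ i, sheet P (g i) W := by
    intro e he
    obtain ⟨f, h, hfe⟩ := exists_mk_eq e
    obtain ⟨k, hk, hkP⟩ := hex _ he f h
    refine mem_iUnion.2 ⟨⟨mk k p (hkP p hp), rfl⟩, base e, he, hg _ _ he, hfe.symm.trans ?_⟩
    rw [mk_eq_mk_iff]
    refine ⟨rfl, hk.trans (huniq _ _ hkP (hg _) p hp ?_ _ he)⟩
    exact ((mk_eq_mk_iff (hkP p hp) (hg _ p hp)).1 (hgi ⟨mk k p (hkP p hp), rfl⟩).symm).2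
  -- Over an empty fibre there are no sheets, so by `hcov` nothing lies over `W`.
  rcases isEmpty_or_nonempty (base (P := P) ⁻¹' {p}) with hempty | hne
  · refine IsEvenlyCovered.of_preimage_eq_empty _ (hW.mem_nhds hp) ?_
    simpa using hcov
  · have : Nonempty (X → GermSpace P) := ⟨fun _ ↦ hne.some.1⟩
    refine IsEvenlyCovered.of_trivialization (t := IsOpen.trivializationDiscrete
      (fun i ↦ sheet P (g i) W) W hW ?_ ?_ ?_ ?_ hcov) hp
    · refine fun i V hV ↦ ⟨fun hVo ↦ ?_, fun hVo ↦ ?_⟩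
      · convert! isOpen_sheet (f := g i) hcongr hVo using 1
        ext e
        constructor
        · rintro ⟨h1, y, hy, h2, rfl⟩
          exact ⟨y, h1, h2, rfl⟩
        · rintro ⟨y, hy, h2, rfl⟩
          exact ⟨hy, y, hV hy, h2, rfl⟩
      · rw [isOpen_iff_mem_nhds]
        intro x hx
        filter_upwards [isOpen_iff.1 hVo x (g i) (hg i x (hV hx)) ⟨hx, x, hV hx, hg i x (hV hx), rfl⟩,
          hW.mem_nhds (hV hx)] with y h1 h2
        exact (h1 (hg i y h2)).1
    · rintro i e ⟨y, hy, h1, rfl⟩ e' ⟨y', hy', h1', rfl⟩ h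
      rw [base_mk, base_mk] at h
      subst h
      rfl
    · exact fun i y hy ↦ ⟨mk (g i) y (hg i y hy), ⟨y, hy, hg i y hy, rfl⟩, rfl⟩
    · refine fun i j hij ↦ disjoint_left.2 ?_
      rintro e ⟨y, hy, h1, rfl⟩ ⟨y', hy', h1', h2⟩
      obtain ⟨rfl, h3⟩ := (mk_eq_mk_iff _ _).1 h2
      refine hij (Subtype.ext ?_)
      rw [← hgi i, ← hgi j, mk_eq_mk_iff]
      exact ⟨rfl, huniq _ _ (hg i) (hg j) _ hy h3 p hp⟩

end GermSpace

/-- The monodromy theorem: a germ extends to a simply connected space if germs extend uniquely to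
neighbourhoods which do not depend on the germ. -/
theorem exists_global_of_unique_extension [SimplyConnectedSpace X] [LocallyPathConnectedSpace X]
    {P : (X → α) → X → Prop} (hcongr : ∀ f g x, P f x → f =ᶠ[𝓝 x] g → P g x)
    (hext : ∀ p : X, ∃ W : Set X, p ∈ W ∧ IsOpen W ∧
      (∀ x ∈ W, ∀ f, P f x → ∃ g, f =ᶠ[𝓝 x] g ∧ ∀ y ∈ W, P g y) ∧
      ∀ f g, (∀ y ∈ W, P f y) → (∀ y ∈ W, P g y) → ∀ x ∈ W, f =ᶠ[𝓝 x] g → ∀ y ∈ W, f =ᶠ[𝓝 y] g)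
    {f : X → α} {x₀ : X} (hf : P f x₀) : ∃ g, (∀ x, P g x) ∧ f =ᶠ[𝓝 x₀] g := by
  -- Lifting the identity map gives a continuous section through the given germ; this is where
  -- simple connectedness enters.
  obtain ⟨s, ⟨hs0, hs⟩, -⟩ := (GermSpace.isCoveringMap_base hcongr
    hext).existsUnique_continuousMap_lifts (.id X) x₀ (GermSpace.mk f x₀ hf) rfl
  have hbase (x : X) : (s x).base = x := congrFun hs x
  have hrep (x : X) : ∃ (k : X → α) (h : P k x), GermSpace.mk k x h = s x := by
    obtain ⟨k, h, hk⟩ := (s x).exists_mk_eq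
    rw [hbase] at h
    refine ⟨k, h, Eq.trans ?_ hk⟩
    rw [GermSpace.mk_eq_mk_iff]
    exact ⟨(hbase x).symm, .rfl⟩
  choose k hkP hk using hrep
  -- By continuity the section stays on the open sheet of `k x` near `x`, so the separately chosen
  -- representatives `k y` have there the values of the single function `k x`.
  have hloc (x : X) : (fun y ↦ k y y) =ᶠ[𝓝 x] k x := by
    have h1 := s.continuous.continuousAt.eventually_mem
      ((GermSpace.isOpen_sheet (f := k x) hcongr isOpen_univ).mem_nhds
        (show s x ∈ GermSpace.sheet P (k x) univ from ⟨x, mem_univ x, hkP x, (hk x).symm⟩))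
    filter_upwards [h1] with y ⟨z, _, hz, h2⟩
    rw [← hk y, GermSpace.mk_eq_mk_iff] at h2
    exact h2.2.self_of_nhds
  refine ⟨fun y ↦ k y y, fun x ↦ hcongr _ _ x (hkP x) (hloc x).symm, Filter.EventuallyEq.trans ?_ (hloc x₀).symm⟩
  exact ((GermSpace.mk_eq_mk_iff hf (hkP x₀)).1 (hs0.symm.trans (hk x₀).symm)).2
end Monodromy

/-! ### Global extension over a simply connected manifold. -/

section Main
open Set Filter
set_option maxSynthPendingDepth 3

lemma tangentMap_eq_of_eventuallyEq {E : Type*} [NormedAddCommGroup E] [NormedSpace ℝ E]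
    {M : Type*} [TopologicalSpace M] [ChartedSpace E M]
    {F : Type*} [NormedAddCommGroup F] [NormedSpace ℝ F]
    {N : Type*} [TopologicalSpace N] [ChartedSpace F N] {f g : M → N} {x : M} (h : f =ᶠ[𝓝 x] g)
    (v : TangentSpace 𝓘(ℝ, E) x) :
    tangentMap 𝓘(ℝ, E) 𝓘(ℝ, F) f ⟨x, v⟩ = tangentMap 𝓘(ℝ, E) 𝓘(ℝ, F) g ⟨x, v⟩ := by
  refine TotalSpace.ext h.self_of_nhds ?_
  simp only [tangentMap]
  rw [h.mfderiv_eq]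
  exact HEq.rfl

variable {E : Type*} [NormedAddCommGroup E] [NormedSpace ℝ E] [FiniteDimensional ℝ E]
  {M : Type*} [TopologicalSpace M] [ChartedSpace E M] [IsManifold 𝓘(ℝ, E) ω M]
  {F : Type*} [NormedAddCommGroup F] [NormedSpace ℝ F] [FiniteDimensional ℝ F]
  {N : Type*} [TopologicalSpace N] [ChartedSpace F N] [IsManifold 𝓘(ℝ, F) ω N] [T2Space N]
  {nablaM : Connection E M} {nablaN : Connection F N}

/-- A germ of an affine map extends to a simply connected manifold. -/
theorem exists_affine_extension [SimplyConnectedSpace M] (hM : IsAnalyticConnection nablaM)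
    (hN : IsAnalyticConnection nablaN) (hcomplete : IsGeodesicallyComplete nablaN) {f : M → N}
    {x₀ : M} (hf : ∀ᶠ x in 𝓝 x₀, IsAffineAt nablaM nablaN f x) :
    ∃ g : M → N, (∀ x, IsAffineAt nablaM nablaN g x) ∧ f =ᶠ[𝓝 x₀] g := by
  have := ChartedSpace.locallyPathConnectedSpace E M
  obtain ⟨g, hg, hfg⟩ := exists_global_of_unique_extension
    -- Affinity is required near `x`, not only at `x`: the extension theorem starts from an affine
    -- germ.
    (P := fun (f : M → N) x ↦ ∀ᶠ y in 𝓝 x, IsAffineAt nablaM nablaN f y)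
    (fun f g x h hfg ↦ by filter_upwards [h, hfg.eventuallyEq_nhds] with y h1 h2 using h1.congr h2)
    (fun p ↦ by
      obtain ⟨W, hp, hWo, hW, hex⟩ := exists_nhds_affine_extension hM hN hcomplete p
      refine ⟨W, hp, hWo, fun x hx f hf ↦ ?_, fun f g hf hg x hx ↦
        eventuallyEq_of_isAffineAt hM hN hcomplete hWo hW (fun y hy ↦ (hf y hy).self_of_nhds)
          (fun y hy ↦ (hg y hy).self_of_nhds) hx⟩
      obtain ⟨g, hfg, hg⟩ := hex x hx f hf
      exact ⟨g, hfg, fun y hy ↦ by filter_upwards [hWo.mem_nhds hy] with z hz using (hg z hz).2⟩) hf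
  exact ⟨g, fun x ↦ (hg x).self_of_nhds, hfg⟩

end Main

end AffineGeometry

end

theorem proposition5p18
    {E : Type*} [NormedAddCommGroup E] [NormedSpace ℝ E] [FiniteDimensional ℝ E]
    {F : Type*} [NormedAddCommGroup F] [NormedSpace ℝ F] [FiniteDimensional ℝ F]
    {M : Type*} [TopologicalSpace M] [ChartedSpace E M] [IsManifold 𝓘(ℝ, E) ω M] [T2Space M]
    {N : Type*} [TopologicalSpace N] [ChartedSpace F N] [IsManifold 𝓘(ℝ, F) ω N] [T2Space N]
    (nablaM : Connection E M) (nablaN : Connection F N)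
    (hM : IsAnalyticConnection nablaM) (hN : IsAnalyticConnection nablaN)
    (hcomplete : IsGeodesicallyComplete nablaN)
    [SimplyConnectedSpace M] :
    (∀ (U : Set M) (f : M → N), IsOpen U → IsConnected U → IsAffineOn nablaM nablaN f U →
      ∃ g : M → N, IsAffineOn nablaM nablaN g Set.univ ∧ Set.EqOn g f U) ∧
    (∀ (x₀ : M) (y₀ : N) (σ₀ : TangentSpace 𝓘(ℝ, E) x₀ →L[ℝ] TangentSpace 𝓘(ℝ, F) y₀),
      (∀ r : ℕ,
        Relates σ₀ (iterCovTensor nablaM (torsionTensor nablaM) r)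
          (iterCovTensor nablaN (torsionTensor nablaN) r) ∧
        Relates σ₀ (iterCovTensor nablaM (curvatureTensor nablaM) r)
          (iterCovTensor nablaN (curvatureTensor nablaN) r)) →
      ∃ f : M → N, IsAffineOn nablaM nablaN f Set.univ ∧ f x₀ = y₀ ∧
        ∀ v : TangentSpace 𝓘(ℝ, E) x₀,
          tangentMap 𝓘(ℝ, E) 𝓘(ℝ, F) f ⟨x₀, v⟩ = ⟨y₀, σ₀ v⟩) := by
  refine ⟨fun U f hU hUc hf ↦ ?_, fun x₀ y₀ σ₀ h ↦ ?_⟩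
  · obtain ⟨x₀, hx₀⟩ := hUc.nonempty
    have hf' := (isAffineOn_iff hU).1 hf
    obtain ⟨g, hg, hfg⟩ := exists_affine_extension hM hN hcomplete
      (f := f) (x₀ := x₀) (Filter.eventually_of_mem (hU.mem_nhds hx₀) hf')
    -- The extension is known to agree with `f` only near `x₀`; uniqueness on the connected set `U`
    -- gives agreement throughout.
    exact ⟨g, (isAffineOn_iff isOpen_univ).2 fun x _ ↦ hg x, fun x hx ↦
      (eventuallyEq_of_isAffineAt hM hN hcomplete hU hUc.isPreconnected hf' (fun y _ ↦ hg y) hx₀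
        hfg x hx).self_of_nhds.symm⟩
  · obtain ⟨f, hf, hf0, hfd⟩ := exists_affine_germ hM hN h
    obtain ⟨g, hg, hfg⟩ := exists_affine_extension hM hN hcomplete hf
    refine ⟨g, (isAffineOn_iff isOpen_univ).2 fun x _ ↦ hg x, hfg.self_of_nhds ▸ hf0, fun v ↦ ?_⟩
    rw [← hfd v]
    exact tangentMap_eq_of_eventuallyEq hfg.symm v
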